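/- Let $k$ be a commutative ring and let $n \ge 2$, $r \ge 1$, $r' \ge 1$ be integers. For $s\ge 1$ let $U(s;\mathbb{A}^n)\subset(\mathbb{A}^n_k)^s$ be the complement of the union over $i<j$ of the closed subschemes $\{x_{li}=x_{lj}\text{ for all }1\le l\le s\}$, let $S_n$ act on it by permuting the coordinates $x_{l1},\dots,x_{ln}$ of all $s$ factors $\mathbb{A}^n$ simultaneously, and let $\pi\colon U(s;\mathbb{A}^n)\to B(s;\mathbb{A}^n)=U(s;\mathbb{A}^n)/S_n$ be the quotient. On $B(s;\mathbb{A}^n)$ there is the canonical degree-$n$ étale algebra $\mathcal{E}(s)=(\pi_*\mathcal{O}_{U(s;\mathbb{A}^n)}^{\,n})^{S_n}$, with canonical generating sections $t_l=(x_{l1},\dots,x_{ln})$, $1\le l\le s$. For $s\le s'$, padding an $s$-tuple of $n$-tuples with zero $n$-tuples induces the stabilization map $B(s;\mathbb{A}^n)\to B(s';\mathbb{A}^n)$. Let $X$ be a $k$-scheme, let $\mathcal{A}$ and $\mathcal{A}'$ be degree-$n$ étale algebras on $X$ (sheaves of $\mathcal{O}_X$-algebras, locally free of constant rank $n$, with $\mathcal{A}(V)$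 étale over $\mathcal{O}_X(V)$ for every affine open $V$) that are isomorphic as $\mathcal{O}_X$-algebras, and let $a_1,\dots,a_r\in\Gamma(X,\mathcal{A})$ and $a'_1,\dots,a'_{r'}\in\Gamma(X,\mathcal{A}')$ generate $\mathcal{A}$ and $\mathcal{A}'$ respectively (that is, their restrictions generate the algebra of sections over every affine open). Then there are unique $k$-morphisms $\phi\colon X\to B(r;\mathbb{A}^n)$ and $\phi'\colon X\to B(r';\mathbb{A}^n)$ (the classifying morphisms) such that $\phi^*(\mathcal{E}(r),t_1,\dots,t_r)\cong(\mathcal{A},a_1,\dots,a_r)$ and $\phi'^*(\mathcal{E}(r'),t_1,\dots,t_{r'})\cong(\mathcal{A}',a'_1,\dots,a'_{r'})$, and, putting $R=r+r'$: 1. The composites $\tilde\phi\colon X\to B(r;\mathbb{A}^n)\to B(R;\mathbb{A}^n)$ and $\tilde\phi'\colon X\to B(r';\mathbb{A}^n)\to B(R;\mathbb{A}^n)$ with the stabilization maps are naively $\mathbb{A}^1$-homotopic: they are joined by a finite sequence of elementary $\mathbb{A}^1$-homotopies, where an elementary $\mathbb{A}^1$-homotopy from $f$ to $g\colon X\to B$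 is a $k$-morphism $X\times\mathbb{A}^1\to B$ that restricts to $f$ at $0$ and to $g$ at $1$. 2. $E(\tilde\phi)=E(\tilde\phi')$ for every $\mathbb{A}^1$-invariant cohomology theory $E$, that is, for every contravariant functor $E$, with values in any category, defined on a full subcategory of the category of $k$-schemes that is stable under $-\times\mathbb{A}^1$ and contains $X$ and $B(R;\mathbb{A}^n)$, such that $E(Y)\to E(Y\times\mathbb{A}^1)$ is an isomorphism for every $Y$ in that subcategory. -/

import Mathlib

open CategoryTheory AlgebraicGeometry TopologicalSpace Opposite

universe u v w

noncomputable section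

namespace EtaleGen

/-! ### Sheaves of algebras on a scheme -/

/-- A sheaf of (commutative) `𝒪_X`-algebras on a scheme `X`: a sheaf of commutative rings
together with a morphism of sheaves of rings from the structure sheaf. -/
structure AlgSheaf (X : Scheme.{u}) where
  sheaf : TopCat.Sheaf CommRingCat.{u} X
  unit : X.sheaf ⟶ sheaf

namespace AlgSheaf

variable {X Y : Scheme.{u}}

/-- The ring `𝒜(U)` of sections over `U`. -/
abbrev sec (A : AlgSheaf X) (U : X.Opens) : CommRingCat.{u} := A.sheaf.presheaf.obj (op U)

/-- The structure map `𝒪_X(U) ⟶ 𝒜(U)`. -/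
def str (A : AlgSheaf X) (U : X.Opens) : Γ(X, U) ⟶ A.sec U := A.unit.hom.app (op U)

/-- The restriction map `𝒜(U) ⟶ 𝒜(V)` for `V ≤ U`. -/
def res (A : AlgSheaf X) {U V : X.Opens} (h : V ≤ U) : A.sec U ⟶ A.sec V :=
  A.sheaf.presheaf.map (homOfLE h).op

instance (A : AlgSheaf X) (U : X.Opens) : Algebra Γ(X, U) (A.sec U) := (A.str U).hom.toAlgebra

/-- `𝒜` and `𝒜'` are isomorphic as sheaves of `𝒪_X`-algebras. -/
def IsIsomorphic (A A' : AlgSheaf X) : Prop :=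
  ∃ α : A.sheaf ≅ A'.sheaf, A.unit ≫ α.hom = A'.unit

/-- `𝒜` is locally free of constant rank `n` as a sheaf of `𝒪_X`-modules: every point has an open
neighbourhood `V` with sections `e₁, …, eₙ ∈ 𝒜(V)` such that the induced morphism of sheaves of
modules `𝒪_V^n ⟶ 𝒜|_V` is an isomorphism. -/
def IsLocallyFreeOfRank (A : AlgSheaf X) (n : ℕ) : Prop :=
  ∀ x : X, ∃ (V : X.Opens) (e : Fin n → A.sec V), x ∈ V ∧
    ∀ (W : X.Opens) (h : W ≤ V),
      Function.Bijective fun c : Fin n → Γ(X, W) ↦ ∑ i, c i • A.res h (e i)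

/-- `𝒜` is a degree-`n` étale algebra on `X`. -/
structure IsEtaleOfDegree (A : AlgSheaf X) (n : ℕ) : Prop where
  locallyFree : A.IsLocallyFreeOfRank n
  etale : ∀ U : X.Opens, IsAffineOpen U → Algebra.Etale Γ(X, U) (A.sec U)

/-- The global sections `a₁, …, a_r` generate `𝒜`: over every affine open `U`, the only
`𝒪_X(U)`-subalgebra of `𝒜(U)` containing the restrictions of the `a_j` is `𝒜(U)` itself. -/
def Generates (A : AlgSheaf X) {r : ℕ} (a : Fin r → A.sec ⊤) : Prop :=
  ∀ U : X.Opens, IsAffineOpen U →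
    Algebra.adjoin Γ(X, U) (Set.range fun j ↦ A.res (le_top : U ≤ ⊤) (a j)) = ⊤

/-- A morphism of sheaves of rings `ℰ ⟶ φ_* 𝒜` which is linear over `𝒪_Y ⟶ φ_* 𝒪_X`. -/
structure HomOver (φ : X ⟶ Y) (E : AlgSheaf Y) (A : AlgSheaf X) where
  app (V : Y.Opens) : E.sec V ⟶ A.sec (φ ⁻¹ᵁ V)
  naturality {U V : Y.Opens} (h : V ≤ U) :
    E.res h ≫ app V = app U ≫ A.res (φ.preimage_mono h)
  linear (V : Y.Opens) : E.str V ≫ app V = φ.app V ≫ A.str (φ ⁻¹ᵁ V)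

/-- `θ : ℰ ⟶ φ_* 𝒜` exhibits `𝒜` as the pullback `φ^* ℰ` (for `ℰ` quasi-coherent):
over all affine opens `V` of `Y` and `W ≤ φ⁻¹ V` of `X`, the algebra `𝒜(W)` is the base change
`𝒪_X(W) ⊗_{𝒪_Y(V)} ℰ(V)`. -/
def HomOver.IsPullback {φ : X ⟶ Y} {E : AlgSheaf Y} {A : AlgSheaf X} (θ : HomOver φ E A) : Prop :=
  ∀ (V : Y.Opens) (W : X.Opens) (h : W ≤ φ ⁻¹ᵁ V), IsAffineOpen V → IsAffineOpen W →
    IsPushout (φ.appLE V W h) (E.str V) (A.str W) (θ.app V ≫ A.res h)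

end AlgSheaf

/-! ### The schemes `U(r; 𝔸ⁿ)` and `B(r; 𝔸ⁿ)` -/

section Construction

variable (k : Type u) [CommRing k] (n r : ℕ)

/-- The coordinate ring `k[x_{ji}]`, `1 ≤ j ≤ r`, `1 ≤ i ≤ n`, of `(𝔸ⁿ)^r`. -/
abbrev Coord : Type u := MvPolynomial (Fin r × Fin n) k

/-- The diagonal action of the symmetric group, `σ • x_{ji} = x_{j,σ(i)}`. -/
instance permAction : MulSemiringAction (Equiv.Perm (Fin n)) (Coord k n r) where
  smul σ p := MvPolynomial.rename (Prod.map id σ) p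
  one_smul p := by
    change MvPolynomial.rename (Prod.map id id) p = p
    rw [Prod.map_id]; exact MvPolynomial.rename_id_apply p
  mul_smul σ τ p := by
    change MvPolynomial.rename _ p = MvPolynomial.rename _ (MvPolynomial.rename _ p)
    rw [MvPolynomial.rename_rename]; rfl
  smul_zero σ := map_zero (MvPolynomial.rename (Prod.map id σ))
  smul_add σ := map_add (MvPolynomial.rename (Prod.map id σ))
  smul_one σ := map_one (MvPolynomial.rename (Prod.map id σ))
  smul_mul σ := map_mul (MvPolynomial.rename (Prod.map id σ))

variable {k n r} in
lemma perm_smul_def (σ : Equiv.Perm (Fin n)) (p : Coord k n r) :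
    σ • p = MvPolynomial.rename (Prod.map id σ) p := rfl

instance : SMulCommClass (Equiv.Perm (Fin n)) k (Coord k n r) where
  smul_comm σ c p := map_smul (MvPolynomial.rename (Prod.map id σ)) c p

/-- The ring of invariants `k[x_{ji}]^{S_n}`. -/
abbrev Inv : Subalgebra k (Coord k n r) :=
  FixedPoints.subalgebra k (Coord k n r) (Equiv.Perm (Fin n))

instance : Algebra.IsInvariant (Inv k n r) (Coord k n r) (Equiv.Perm (Fin n)) where
  isInvariant b hb := ⟨⟨b, hb⟩, rfl⟩

/-- The affine scheme `(𝔸ⁿ)^r` over `k`. -/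
abbrev AffR : Scheme.{u} := Spec (.of (Coord k n r))

/-- The quotient `(𝔸ⁿ)^r / S_n`, the spectrum of the ring of invariants. -/
abbrev QuotR : Scheme.{u} := Spec (.of (Inv k n r))

/-- The quotient map `(𝔸ⁿ)^r ⟶ (𝔸ⁿ)^r / S_n`. -/
def quotMap : AffR k n r ⟶ QuotR k n r := Spec.map (CommRingCat.ofHom (Inv k n r).val.toRingHom)

/-- The automorphism of `(𝔸ⁿ)^r` corresponding to a permutation. -/
def actAff (σ : Equiv.Perm (Fin n)) : AffR k n r ⟶ AffR k n r :=
  Spec.map (CommRingCat.ofHom (MulSemiringAction.toRingHom _ (Coord k n r) σ))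

/-- The closed subset `Z_{ij}` of `(𝔸ⁿ)^r`, cut out by the equations `x_{li} = x_{lj}` for all
`l`. -/
def Z (i j : Fin n) : Set (AffR k n r) :=
  PrimeSpectrum.zeroLocus
    (Set.range fun l : Fin r ↦ (MvPolynomial.X (l, i) - MvPolynomial.X (l, j) : Coord k n r))

lemma isClosed_Z (i j : Fin n) : IsClosed (Z k n r i j) := PrimeSpectrum.isClosed_zeroLocus _

/-- `U(r; 𝔸ⁿ)`, the complement in `(𝔸ⁿ)^r` of the union of the `Z_{ij}`, `i < j`. -/
def UOpens : (AffR k n r).Opens where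
  carrier := (⋃ (i : Fin n) (j : Fin n) (_ : i < j), Z k n r i j)ᶜ
  is_open' := by
    rw [isOpen_compl_iff]
    exact isClosed_iUnion_of_finite fun i ↦ isClosed_iUnion_of_finite fun j ↦
      isClosed_iUnion_of_finite fun _ ↦ isClosed_Z k n r i j

variable {k n r} in
lemma mem_UOpens {p : AffR k n r} : p ∈ UOpens k n r ↔ ∀ i j : Fin n, i ≠ j →
    ∃ l : Fin r, (MvPolynomial.X (l, i) - MvPolynomial.X (l, j) : Coord k n r) ∉ p.asIdeal := by
  have h1 : p ∈ UOpens k n r ↔ ∀ i j : Fin n, i < j → p ∉ Z k n r i j := by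
    change p ∈ (⋃ (i : Fin n) (j : Fin n) (_ : i < j), Z k n r i j)ᶜ ↔ _
    simp
  have h2 : ∀ i j : Fin n, p ∉ Z k n r i j ↔
      ∃ l : Fin r, (MvPolynomial.X (l, i) - MvPolynomial.X (l, j) : Coord k n r) ∉ p.asIdeal := by
    intro i j
    change ¬ (Set.range fun l : Fin r ↦
      (MvPolynomial.X (l, i) - MvPolynomial.X (l, j) : Coord k n r)) ⊆ p.asIdeal ↔ _
    rw [Set.range_subset_iff, not_forall]
    rfl
  rw [h1]
  refine ⟨fun h i j hij ↦ ?_, fun h i j hij ↦ (h2 i j).2 (h i j hij.ne)⟩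
  rcases lt_or_gt_of_ne hij with hlt | hlt
  · exact (h2 i j).1 (h i j hlt)
  · obtain ⟨l, hl⟩ := (h2 j i).1 (h j i hlt)
    refine ⟨l, fun hc ↦ hl ?_⟩
    rw [← neg_sub]
    exact p.asIdeal.neg_mem hc

variable {k n r} in
lemma actAff_mem {p : AffR k n r} (σ : Equiv.Perm (Fin n)) (hp : p ∈ UOpens k n r) :
    actAff k n r σ p ∈ UOpens k n r := by
  rw [mem_UOpens] at hp ⊢
  intro i j hij
  obtain ⟨l, hl⟩ := hp (σ i) (σ j) (σ.injective.ne hij)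
  refine ⟨l, fun hc ↦ hl ?_⟩
  have hc' : σ • (MvPolynomial.X (l, i) - MvPolynomial.X (l, j) : Coord k n r) ∈ p.asIdeal := hc
  simpa [perm_smul_def] using hc'

lemma actAff_quotMap (σ : Equiv.Perm (Fin n)) :
    actAff k n r σ ≫ quotMap k n r = quotMap k n r := by
  rw [actAff, quotMap, ← Spec.map_comp]
  congr 1
  exact CommRingCat.hom_ext (RingHom.ext fun p ↦ p.2 σ)

variable {k n r} in
/-- The fibres of the quotient map are orbits. -/
lemma exists_actAff_eq {p q : AffR k n r} (h : quotMap k n r p = quotMap k n r q) :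
    ∃ σ, actAff k n r σ p = q := by
  have h' : p.asIdeal.under (Inv k n r) = q.asIdeal.under (Inv k n r) :=
    congrArg PrimeSpectrum.asIdeal h
  have hp : p.asIdeal.IsPrime := p.isPrime
  have hq : q.asIdeal.IsPrime := q.isPrime
  obtain ⟨σ, hσ⟩ := Algebra.IsInvariant.exists_smul_of_under_eq (Inv k n r) (Coord k n r)
    (Equiv.Perm (Fin n)) p.asIdeal q.asIdeal h'
  refine ⟨σ⁻¹, PrimeSpectrum.ext ?_⟩
  ext x
  rw [hσ, Ideal.mem_pointwise_smul_iff_inv_smul_mem]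
  rfl

/-- `B(r; 𝔸ⁿ)` as an open subset of `(𝔸ⁿ)^r / S_n`: the image of the `S_n`-stable open
subset `U(r; 𝔸ⁿ)`. -/
def BOpens : (QuotR k n r).Opens where
  carrier := quotMap k n r '' (UOpens k n r : Set (AffR k n r))
  is_open' := by
    have hcl : IsClosedMap (quotMap k n r) := by
      have := Algebra.IsInvariant.isIntegral (Inv k n r) (Coord k n r) (Equiv.Perm (Fin n))
      exact PrimeSpectrum.isClosedMap_comap_of_isIntegral
        (algebraMap (Inv k n r) (Coord k n r)) (algebraMap_isIntegral_iff.2 this)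
    have hsurj : Function.Surjective (quotMap k n r) := by
      have := Algebra.IsInvariant.isIntegral (Inv k n r) (Coord k n r) (Equiv.Perm (Fin n))
      exact Algebra.IsIntegral.comap_surjective (Inv k n r) (Coord k n r)
    have heq : quotMap k n r '' (UOpens k n r : Set (AffR k n r)) =
        (quotMap k n r '' (UOpens k n r : Set (AffR k n r))ᶜ)ᶜ := by
      ext y
      constructor
      · rintro ⟨p, hp, rfl⟩ ⟨q, hq, hqp⟩
        obtain ⟨σ, rfl⟩ := exists_actAff_eq hqp.symm
        exact hq (actAff_mem σ hp)
      · intro hy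
        obtain ⟨p, rfl⟩ := hsurj y
        by_contra hc
        exact hy ⟨p, fun hp ↦ hc ⟨p, hp, rfl⟩, rfl⟩
    rw [heq, isOpen_compl_iff]
    exact hcl _ (UOpens k n r).isOpen.isClosed_compl

lemma UOpens_le_quotMap : UOpens k n r ≤ quotMap k n r ⁻¹ᵁ BOpens k n r :=
  fun p hp ↦ ⟨p, hp, rfl⟩

lemma UOpens_le_actAff (σ : Equiv.Perm (Fin n)) :
    UOpens k n r ≤ actAff k n r σ ⁻¹ᵁ UOpens k n r :=
  fun _ hp ↦ actAff_mem σ hp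

/-- The scheme `U(r; 𝔸ⁿ)`. -/
abbrev U : Scheme.{u} := (UOpens k n r).toScheme

/-- The scheme `B(r; 𝔸ⁿ) = U(r; 𝔸ⁿ) / S_n`. -/
abbrev BScheme : Scheme.{u} := (BOpens k n r).toScheme

/-- `B(r; 𝔸ⁿ)` as a `k`-scheme. -/
def B : Over (Spec (.of k)) :=
  Over.mk ((BOpens k n r).ι ≫ Spec.map (CommRingCat.ofHom (algebraMap k (Inv k n r))))

/-- The quotient map `π : U(r; 𝔸ⁿ) ⟶ B(r; 𝔸ⁿ)`. -/
def quotU : U k n r ⟶ BScheme k n r :=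
  (quotMap k n r).resLE (BOpens k n r) (UOpens k n r) (UOpens_le_quotMap k n r)

/-- The action of a permutation on `U(r; 𝔸ⁿ)`. -/
def actU (σ : Equiv.Perm (Fin n)) : U k n r ⟶ U k n r :=
  (actAff k n r σ).resLE (UOpens k n r) (UOpens k n r) (UOpens_le_actAff k n r σ)

lemma actU_quotU (σ : Equiv.Perm (Fin n)) : actU k n r σ ≫ quotU k n r = quotU k n r := by
  rw [actU, quotU, Scheme.Hom.resLE_comp_resLE]
  simp only [actAff_quotMap]

lemma preimage_le (σ : Equiv.Perm (Fin n)) (W : (BScheme k n r).Opens) :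
    quotU k n r ⁻¹ᵁ W ≤ actU k n r σ ⁻¹ᵁ (quotU k n r ⁻¹ᵁ W) := by
  rw [← Scheme.Hom.comp_preimage, actU_quotU]

/-! ### The canonical étale algebra with generators on `B(r; 𝔸ⁿ)` -/

/-- The ring `ℰ(W)` of sections over `W` of the canonical algebra: the `S_n`-equivariant
morphisms `f = (f₁, …, fₙ) : π⁻¹ W ⟶ 𝔸ⁿ`. These are the `S_n`-invariant sections over `π⁻¹ W` of
the trivial algebra `𝒪_U^n`, that is, the sections over `W` of
`E(r; 𝔸ⁿ) = (U(r; 𝔸ⁿ) × 𝔸ⁿ) / S_n ⟶ B(r; 𝔸ⁿ)`. -/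
def equivSec (W : (BScheme k n r).Opens) : Subring (Fin n → Γ(U k n r, quotU k n r ⁻¹ᵁ W)) where
  carrier := {f | ∀ (σ : Equiv.Perm (Fin n)) (i : Fin n),
    (actU k n r σ).appLE _ _ (preimage_le k n r σ W) (f i) = f (σ i)}
  mul_mem' hf hg σ i := by simp [hf σ i, hg σ i]
  one_mem' σ i := by simp
  add_mem' hf hg σ i := by simp [hf σ i, hg σ i]
  zero_mem' σ i := by simp
  neg_mem' hf σ i := by simp [hf σ i]

lemma actU_appLE_map (σ : Equiv.Perm (Fin n)) {V W : (BScheme k n r).Opens} (h : V ≤ W)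
    (x : Γ(U k n r, quotU k n r ⁻¹ᵁ W)) :
    (actU k n r σ).appLE _ _ (preimage_le k n r σ V)
      ((U k n r).presheaf.map (homOfLE ((quotU k n r).preimage_mono h)).op x) =
    (U k n r).presheaf.map (homOfLE ((quotU k n r).preimage_mono h)).op
      ((actU k n r σ).appLE _ _ (preimage_le k n r σ W) x) := by
  rw [← CommRingCat.comp_apply, ← CommRingCat.comp_apply, Scheme.Hom.map_appLE,
    Scheme.Hom.appLE_map]

/-- Restriction of equivariant sections. -/
def equivRes {V W : (BScheme k n r).Opens} (h : V ≤ W) : equivSec k n r W →+* equivSec k n r V where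
  toFun f := ⟨fun i ↦ (U k n r).presheaf.map (homOfLE ((quotU k n r).preimage_mono h)).op (f.1 i),
    fun σ i ↦ by rw [actU_appLE_map k n r σ h, f.2 σ i]⟩
  map_one' := Subtype.ext (funext fun i ↦ map_one _)
  map_mul' f g := Subtype.ext (funext fun i ↦ map_mul _ _ _)
  map_zero' := Subtype.ext (funext fun i ↦ map_zero _)
  map_add' f g := Subtype.ext (funext fun i ↦ map_add _ _ _)

/-- The presheaf `W ↦ ℰ(W)`. -/
def canonicalPresheaf : TopCat.Presheaf CommRingCat.{u} (BScheme k n r) where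
  obj W := CommRingCat.of (equivSec k n r W.unop)
  map h := CommRingCat.ofHom (equivRes k n r h.unop.le)
  map_id W := by
    refine CommRingCat.hom_ext (RingHom.ext fun f ↦ Subtype.ext (funext fun i ↦ ?_))
    exact ConcreteCategory.congr_hom ((U k n r).presheaf.map_id _) (f.1 i)
  map_comp g h := by
    refine CommRingCat.hom_ext (RingHom.ext fun f ↦ Subtype.ext (funext fun i ↦ ?_))
    exact ConcreteCategory.congr_hom ((U k n r).presheaf.map_comp
      (homOfLE ((quotU k n r).preimage_mono g.unop.le)).op
      (homOfLE ((quotU k n r).preimage_mono h.unop.le)).op) (f.1 i)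

lemma canonicalPresheaf_isSheaf : (canonicalPresheaf k n r).IsSheaf := by
  rw [TopCat.Presheaf.isSheaf_iff_isSheafUniqueGluing]
  intro ι V sf hsf
  let G : TopCat.Sheaf CommRingCat.{u} (BScheme k n r) :=
    (TopCat.Sheaf.pushforward CommRingCat.{u} (quotU k n r).base).obj (U k n r).sheaf
  have hG : ∀ i : Fin n, ∃! s : ToType (G.1.obj (op (iSup V))),
      TopCat.Presheaf.IsGluing G.1 V (fun a ↦ (sf a).1 i) s := by
    intro i
    refine G.existsUnique_gluing V _ fun a b ↦ ?_
    exact congrFun (congrArg Subtype.val (hsf a b)) i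
  choose s hs hu using hG
  refine ⟨⟨s, fun σ i ↦ ?_⟩, fun a ↦ Subtype.ext (funext fun i ↦ hs i a), fun t ht ↦ ?_⟩
  · refine hu (σ i) _ fun a ↦ ?_
    have h1 := actU_appLE_map k n r σ (le_iSup V a) (s i)
    have h2 : (U k n r).presheaf.map (homOfLE ((quotU k n r).preimage_mono (le_iSup V a))).op (s i)
      = (sf a).1 i := hs i a
    rw [h2, (sf a).2 σ i] at h1
    exact h1.symm
  · refine Subtype.ext (funext fun i ↦ hu i _ fun a ↦ ?_)
    exact congrFun (congrArg Subtype.val (ht a)) i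

lemma actU_appLE_quotU (σ : Equiv.Perm (Fin n)) (W : (BScheme k n r).Opens)
    (x : Γ(BScheme k n r, W)) :
    (actU k n r σ).appLE _ _ (preimage_le k n r σ W) ((quotU k n r).app W x) =
      (quotU k n r).app W x := by
  have h := Scheme.Hom.comp_appLE (actU k n r σ) (quotU k n r) W (quotU k n r ⁻¹ᵁ W)
    (preimage_le k n r σ W)
  simp only [actU_quotU, Scheme.Hom.appLE_eq_app] at h
  exact (ConcreteCategory.congr_hom h x).symm

/-- The constant vector of the pullback of a function on `W` to `π⁻¹ W`. -/
def equivConst (W : (BScheme k n r).Opens) : Γ(BScheme k n r, W) →+* equivSec k n r W where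
  toFun x := ⟨fun _ ↦ (quotU k n r).app W x, fun σ _ ↦ actU_appLE_quotU k n r σ W x⟩
  map_one' := Subtype.ext (funext fun _ ↦ map_one _)
  map_mul' _ _ := Subtype.ext (funext fun _ ↦ map_mul _ _ _)
  map_zero' := Subtype.ext (funext fun _ ↦ map_zero _)
  map_add' _ _ := Subtype.ext (funext fun _ ↦ map_add _ _ _)

/-- The canonical `𝒪_B`-algebra `ℰ(r; 𝔸ⁿ) = (π_* 𝒪_U^n)^{S_n}` on `B(r; 𝔸ⁿ)`; a function on
`W` acts as the constant vector of its pullback to `π⁻¹ W`. -/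
def canonicalAlg : AlgSheaf (BScheme k n r) where
  sheaf := ⟨canonicalPresheaf k n r, canonicalPresheaf_isSheaf k n r⟩
  unit := ⟨{
    app W := CommRingCat.ofHom (R := Γ(BScheme k n r, W.unop)) (S := equivSec k n r W.unop)
      (equivConst k n r W.unop)
    naturality V W h := by
      refine CommRingCat.hom_ext (RingHom.ext fun f ↦ Subtype.ext (funext fun i ↦ ?_))
      exact ConcreteCategory.congr_hom ((quotU k n r).naturality h) f }⟩

/-- The coordinate function `x_{ji}` on `U(r; 𝔸ⁿ)`. -/
def coordU (j : Fin r) (i : Fin n) : Γ(U k n r, ⊤) :=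
  (UOpens k n r).ι.appTop ((Scheme.ΓSpecIso (.of (Coord k n r))).inv (MvPolynomial.X (j, i)))

lemma actU_coordU (σ : Equiv.Perm (Fin n)) (j : Fin r) (i : Fin n) :
    (actU k n r σ).appTop (coordU k n r j i) = coordU k n r j (σ i) := by
  have h1 : actU k n r σ ≫ (UOpens k n r).ι = (UOpens k n r).ι ≫ actAff k n r σ :=
    Scheme.Hom.resLE_comp_ι _ _
  have h2 : (actU k n r σ).appTop (coordU k n r j i) =
      (actU k n r σ ≫ (UOpens k n r).ι).appTop
        ((Scheme.ΓSpecIso (.of (Coord k n r))).inv (MvPolynomial.X (j, i))) := by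
    rw [Scheme.Hom.comp_appTop]; rfl
  have h3 : (actAff k n r σ).appTop
      ((Scheme.ΓSpecIso (.of (Coord k n r))).inv (MvPolynomial.X (j, i))) =
      (Scheme.ΓSpecIso (.of (Coord k n r))).inv (MvPolynomial.X (j, σ i)) := by
    rw [actAff, ← CommRingCat.comp_apply, ← Scheme.ΓSpecIso_inv_naturality, CommRingCat.comp_apply]
    congr 1
    exact MvPolynomial.rename_X _ _
  rw [h2, h1, Scheme.Hom.comp_appTop, CommRingCat.comp_apply, h3]
  rfl

/-- The canonical global section `t_j = (x_{j1}, …, x_{jn})` of `ℰ(r; 𝔸ⁿ)`. -/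
def canonicalSec (j : Fin r) : (canonicalAlg k n r).sec ⊤ :=
  (⟨fun i ↦ coordU k n r j i, fun σ i ↦
    (ConcreteCategory.congr_hom (Scheme.Hom.appLE_eq_app (actU k n r σ)) _).trans
      (actU_coordU k n r σ j i)⟩ : equivSec k n r ⊤)

end Construction

/-! ### Classifying maps -/

section Classifying

variable {k : Type u} [CommRing k] {n r : ℕ}

/-- `φ : X ⟶ B(r; 𝔸ⁿ)` is a classifying morphism for `(𝒜, a₁, …, a_r)`: the pullback along `φ`
of the canonical algebra with its canonical sections is isomorphic to `(𝒜, a₁, …, a_r)`. -/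
def Classifies {X : Over (Spec (.of k))} (φ : X ⟶ B k n r) (A : AlgSheaf X.left)
    (a : Fin r → A.sec ⊤) : Prop :=
  ∃ θ : AlgSheaf.HomOver (Y := BScheme k n r) φ.left (canonicalAlg k n r) A,
    θ.IsPullback ∧ ∀ j, θ.app ⊤ (canonicalSec k n r j) = a j

end Classifying

/-! ### Stabilization maps -/

section Stabilization

variable (k : Type u) [CommRing k] (n : ℕ) {r R : ℕ}

/-- The comorphism `k[x_{ji}]_{j ≤ R} ⟶ k[x_{ji}]_{j ≤ r}` of the map `(𝔸ⁿ)^r ⟶ (𝔸ⁿ)^R` that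
pads an `r`-tuple of `n`-tuples with the `n`-tuple `(0, …, 0)`. -/
def padHom (r R : ℕ) : Coord k n R →ₐ[k] Coord k n r :=
  MvPolynomial.aeval fun p ↦ if h : p.1.1 < r then MvPolynomial.X (⟨p.1.1, h⟩, p.2) else 0

variable {k n} in
lemma padHom_smul (σ : Equiv.Perm (Fin n)) (p : Coord k n R) :
    padHom k n r R (σ • p) = σ • padHom k n r R p := by
  rw [perm_smul_def, perm_smul_def, ← AlgHom.comp_apply, ← AlgHom.comp_apply]
  congr 1
  refine MvPolynomial.algHom_ext fun q ↦ ?_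
  simp only [AlgHom.comp_apply, MvPolynomial.rename_X, padHom, MvPolynomial.aeval_X, Prod.map,
    id]
  split_ifs <;> simp

/-- The map induced on rings of invariants. -/
def padInv (r R : ℕ) : Inv k n R →ₐ[k] Inv k n r :=
  ((padHom k n r R).comp (Inv k n R).val).codRestrict (Inv k n r) fun p σ ↦ by
    have := p.2 σ
    change σ • padHom k n r R p.1 = padHom k n r R p.1
    rw [← padHom_smul, this]

/-- The map `(𝔸ⁿ)^r / S_n ⟶ (𝔸ⁿ)^R / S_n` induced by padding with zeros. -/
def stabQuot (r R : ℕ) : QuotR k n r ⟶ QuotR k n R :=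
  Spec.map (CommRingCat.ofHom (padInv k n r R).toRingHom)

lemma BOpens_le_stabQuot (h : r ≤ R) : BOpens k n r ≤ stabQuot k n r R ⁻¹ᵁ BOpens k n R := by
  rintro _ ⟨p, hp, rfl⟩
  refine ⟨Spec.map (CommRingCat.ofHom (padHom k n r R).toRingHom) p, ?_, ?_⟩
  · change _ ∈ UOpens k n R
    have hp' : p ∈ UOpens k n r := hp
    rw [mem_UOpens] at hp' ⊢
    intro i j hij
    obtain ⟨l, hl⟩ := hp' i j hij
    refine ⟨Fin.castLE h l, fun hc ↦ hl ?_⟩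
    have hc' : padHom k n r R (MvPolynomial.X (Fin.castLE h l, i) -
      MvPolynomial.X (Fin.castLE h l, j)) ∈ p.asIdeal := hc
    simpa [padHom] using hc'
  · rfl

/-- The stabilization map `B(r; 𝔸ⁿ) ⟶ B(R; 𝔸ⁿ)` for `r ≤ R`. -/
def stab (h : r ≤ R) : B k n r ⟶ B k n R :=
  Over.homMk ((stabQuot k n r R).resLE (BOpens k n R) (BOpens k n r) (BOpens_le_stabQuot k n h)) (by
    change Scheme.Hom.resLE _ _ _ _ ≫ (BOpens k n R).ι ≫ _ = (BOpens k n r).ι ≫ _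
    rw [Scheme.Hom.resLE_comp_ι_assoc, stabQuot, ← Spec.map_comp]
    congr 2
    exact CommRingCat.hom_ext (RingHom.ext fun c ↦ (padInv k n r R).commutes c))

end Stabilization

/-! ### Naive `𝔸¹`-homotopies -/

section Homotopy

variable {S : Scheme.{u}}

/-- The `S`-scheme `X × 𝔸¹`. -/
def timesA1 (X : Over S) : Over S := Over.mk ((𝔸(PUnit.{u + 1}; X.left) ↘ X.left) ≫ X.hom)

/-- The projection `X × 𝔸¹ ⟶ X`. -/
def projA1 (X : Over S) : timesA1 X ⟶ X := Over.homMk (𝔸(PUnit.{u + 1}; X.left) ↘ X.left)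

/-- The morphism `X ⟶ X × 𝔸¹`, `x ↦ (x, c)`, for a global function `c` on `X`. -/
def sectionA1 (X : Over S) (c : Γ(X.left, ⊤)) : X ⟶ timesA1 X :=
  Over.homMk (AffineSpace.homOfVector (𝟙 X.left) fun _ ↦ c) (by
    have h := AffineSpace.homOfVector_over_assoc (𝟙 X.left) (fun _ : PUnit.{u + 1} ↦ c) X.hom
    rw [Category.id_comp] at h
    exact h)

/-- There is an elementary `𝔸¹`-homotopy from `f` to `g`. -/
def ElementaryHomotopic {X Y : Over S} (f g : X ⟶ Y) : Prop :=
  ∃ H : timesA1 X ⟶ Y, sectionA1 X 0 ≫ H = f ∧ sectionA1 X 1 ≫ H = g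

/-- `f` and `g` are naively `𝔸¹`-homotopic: they are joined by a finite sequence of elementary
`𝔸¹`-homotopies. -/
def NaivelyHomotopic {X Y : Over S} (f g : X ⟶ Y) : Prop :=
  Relation.ReflTransGen ElementaryHomotopic f g

/-- A contravariant functor `E` on a full subcategory `P` of `S`-schemes, stable under `- × 𝔸¹`,
is `𝔸¹`-invariant if `E(X) ⟶ E(X × 𝔸¹)` is an isomorphism for all `X`. -/
def IsA1Invariant {P : ObjectProperty (Over S)} (hP : ∀ X, P X → P (timesA1 X))
    {C : Type v} [Category.{w} C] (E : P.FullSubcategoryᵒᵖ ⥤ C) : Prop :=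
  ∀ (X : Over S) (hX : P X),
    IsIso (E.map (P.homMk (X := ⟨timesA1 X, hP X hX⟩) (Y := ⟨X, hX⟩) (projA1 X)).op)

end Homotopy

end EtaleGen

end

open EtaleGen

/-!
A degree-`n` étale algebra becomes isomorphic to a product of `n` copies of the base over a
faithfully flat cover. Over such a cover an `r`-tuple of sections is an `n`-tuple of points of `𝔸ʳ`,
up to permutation. It generates the algebra if and only if these points are pairwise disjoint, so a
generating tuple locally defines a point of `U(r; 𝔸ⁿ)` up to permutation. The values of the
multisymmetric functions at these points do not depend on any choice, hence descend and define the
classifying morphism to `B(r; 𝔸ⁿ)`. As `U(r; 𝔸ⁿ)` is an `S_n`-torsor over `B(r; 𝔸ⁿ)`, Galois descent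
shows that this morphism pulls the canonical algebra back to the given one; conversely, a morphism
with this property has the prescribed values of multisymmetric functions, so it is unique.

Consequently a generating tuple of `𝒜[t]` is an `𝔸¹`-homotopy between the classifying morphisms of
its values at `t = 0` and `t = 1`. Three linear homotopies of this kind connect `(a, 0)` and
`(a', 0)`.
-/

noncomputable section

namespace EtaleGen

/-! ### Separated families of homomorphisms -/

section SepFamily

open TensorProduct

variable {ι R A L : Type*} [CommRing R] [CommRing A] [Algebra R A] [CommRing L] [Algebra R L]

/-- A family of algebra homomorphisms `A → L` is separated if the corresponding `L`-points of
`Spec A` are pairwise disjoint, that is, no two of them agree at any point of `Spec L`. -/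
def SepFamily (s : ι → A →ₐ[R] L) : Prop :=
  ∀ i j, i ≠ j → Ideal.span (Set.range fun b ↦ s i b - s j b) = ⊤

/-- The homomorphism `L ⊗ A → ∏ L` induced by a family of homomorphisms `A → L`. -/
def familyHom (s : ι → A →ₐ[R] L) : L ⊗[R] A →ₐ[L] (ι → L) :=
  Algebra.TensorProduct.lift (Algebra.ofId L (ι → L)) (AlgHom.pi s) fun _ _ ↦ Commute.all _ _

@[simp]
lemma familyHom_tmul (s : ι → A →ₐ[R] L) (l : L) (b : A) (i : ι) :
    familyHom s (l ⊗ₜ b) i = l * s i b := by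
  simp [familyHom, Algebra.ofId_apply]

lemma SepFamily.familyHom_surjective [Finite ι] {s : ι → A →ₐ[R] L} (hs : SepFamily s) :
    Function.Surjective (familyHom s) := by
  let ev i : L ⊗[R] A →ₐ[L] L := (Pi.evalAlgHom L (fun _ ↦ L) i).comp (familyHom s)
  have ev_surjective i : Function.Surjective (ev i) := fun l ↦ ⟨l ⊗ₜ 1, by simp [ev]⟩
  have coprime : Pairwise (Function.onFun IsCoprime fun i ↦ RingHom.ker (ev i)) := by
    intro i j hij
    have map_ker : (RingHom.ker (ev j)).map (ev i) = ⊤ := by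
      rw [eq_top_iff, ← hs i j hij, Ideal.span_le]
      rintro _ ⟨b, rfl⟩
      have mem_ker : (1 ⊗ₜ b - s j b ⊗ₜ 1 : L ⊗[R] A) ∈ RingHom.ker (ev j) := by
        simp [ev, RingHom.mem_ker]
      simpa [ev] using Ideal.mem_map_of_mem (ev i) mem_ker
    rw [Function.onFun, Ideal.isCoprime_iff_sup_eq, sup_comm]
    have := Ideal.comap_map_of_surjective (ev i) (ev_surjective i) (RingHom.ker (ev j))
    rwa [map_ker, Ideal.comap_top, eq_comm] at this
  intro v
  obtain ⟨x, hx⟩ := Ideal.exists_forall_sub_mem_ideal coprime fun i ↦ (v i ⊗ₜ 1 : L ⊗[R] A)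
  refine ⟨x, funext fun i ↦ ?_⟩
  simpa [ev, RingHom.mem_ker, sub_eq_zero] using hx i

lemma sepFamily_of_familyHom_surjective {s : ι → A →ₐ[R] L}
    (hs : Function.Surjective (familyHom s)) : SepFamily s := by
  classical
  intro i j hij
  set I := Ideal.span (Set.range fun b ↦ s i b - s j b)
  have sub_mem (x : L ⊗[R] A) : familyHom s x i - familyHom s x j ∈ I := by
    induction x using TensorProduct.induction_on with
    | zero => simp
    | tmul l b =>
      rw [familyHom_tmul, familyHom_tmul, ← mul_sub]
      exact I.mul_mem_left _ (Ideal.subset_span ⟨b, rfl⟩)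
    | add x y hx hy =>
      rw [map_add, Pi.add_apply, Pi.add_apply, add_sub_add_comm]
      exact I.add_mem hx hy
  obtain ⟨x, hx⟩ := hs (Pi.single i 1)
  rw [Ideal.eq_top_iff_one]
  simpa [hx, hij.symm] using sub_mem x

lemma SepFamily.familyHom_bijective [Finite ι] (e : Module.Basis ι R A) {s : ι → A →ₐ[R] L}
    (hs : SepFamily s) : Function.Bijective (familyHom s) := by
  let coords : (L ⊗[R] A) ≃ₗ[L] (ι → L) := (e.baseChange L).equivFun
  have endo_bijective : Function.Bijective ((familyHom s).toLinearMap ∘ₗ coords.symm.toLinearMap) :=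
    OrzechProperty.bijective_of_surjective_endomorphism _
      (hs.familyHom_surjective.comp coords.symm.surjective)
  simpa [Function.comp_def] using endo_bijective.comp coords.bijective

lemma SepFamily.comp {L' : Type*} [CommRing L'] [Algebra R L'] {s : ι → A →ₐ[R] L}
    (hs : SepFamily s) (g : L →ₐ[R] L') : SepFamily fun i ↦ g.comp (s i) := by
  intro i j hij
  rw [← Ideal.map_top g, ← hs i j hij, Ideal.map_span, ← Set.range_comp]
  congr 1
  ext
  simp

lemma span_range_sub_eq_of_adjoin {κ : Type*} {a : κ → A}
    (ha : Algebra.adjoin R (Set.range a) = ⊤) (f g : A →ₐ[R] L) :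
    Ideal.span (Set.range fun b ↦ f b - g b) =
      Ideal.span (Set.range fun l ↦ f (a l) - g (a l)) := by
  set I := Ideal.span (Set.range fun l ↦ f (a l) - g (a l))
  have agree : (Ideal.Quotient.mkₐ R I).comp f = (Ideal.Quotient.mkₐ R I).comp g := by
    refine AlgHom.ext_of_adjoin_eq_top ha ?_
    rintro _ ⟨l, rfl⟩
    exact Ideal.Quotient.eq.2 (Ideal.subset_span ⟨l, rfl⟩)
  refine le_antisymm (Ideal.span_le.2 ?_) (Ideal.span_mono ?_)
  · rintro _ ⟨b, rfl⟩
    exact Ideal.Quotient.eq.1 (DFunLike.congr_fun agree b)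
  · rintro _ ⟨l, rfl⟩
    exact ⟨a l, rfl⟩

lemma sepFamily_iff_of_adjoin {κ : Type*} {a : κ → A} (ha : Algebra.adjoin R (Set.range a) = ⊤)
    (s : ι → A →ₐ[R] L) :
    SepFamily s ↔ ∀ i j, i ≠ j → Ideal.span (Set.range fun l ↦ s i (a l) - s j (a l)) = ⊤ :=
  forall₃_congr fun i j _ ↦ by rw [span_range_sub_eq_of_adjoin ha]

lemma exists_algHom_pi_eq_eval {M : Type*} [CommRing M] [IsLocalRing M] [Finite ι]
    (g : (ι → M) →ₐ[M] M) : ∃ i, ∀ v, g v = v i := by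
  classical
  cases nonempty_fintype ι
  have sum_single : ∑ i, g (Pi.single i 1) = 1 := by
    rw [← map_sum, Finset.univ_sum_single (fun _ : ι ↦ (1 : M))]
    exact map_one g
  obtain ⟨i, hi⟩ : ∃ i, IsUnit (g (Pi.single i 1)) := by
    by_contra! h
    have : ∑ i, g (Pi.single i 1) ∈ IsLocalRing.maximalIdeal M :=
      sum_mem fun i _ ↦ (IsLocalRing.mem_maximalIdeal _).2 (h i)
    exact (Ideal.ne_top_iff_one _).1 Ideal.IsPrime.ne_top' (sum_single ▸ this)
  refine ⟨i, fun v ↦ hi.mul_left_cancel ?_⟩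
  have single_mul : Pi.single i 1 * v = v i • (Pi.single i 1 : ι → M) := by
    rw [← Pi.single_mul_left, one_mul, ← Pi.single_smul, smul_eq_mul, mul_one]
  rw [← map_mul, single_mul, map_smul, smul_eq_mul, mul_comm]

lemma SepFamily.exists_perm [IsLocalRing L] [Finite ι] (e : Module.Basis ι R A)
    {s s' : ι → A →ₐ[R] L} (hs : SepFamily s) (hs' : SepFamily s') :
    ∃ τ : Equiv.Perm ι, ∀ i, s' i = s (τ i) := by
  let E := AlgEquiv.ofBijective (familyHom s) (hs.familyHom_bijective e)
  have exists_eq (i : ι) : ∃ j, s' i = s j := by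
    let g : (ι → L) →ₐ[L] L := ((Pi.evalAlgHom L (fun _ ↦ L) i).comp (familyHom s')).comp
      E.symm.toAlgHom
    obtain ⟨j, hj⟩ := exists_algHom_pi_eq_eval g
    refine ⟨j, AlgHom.ext fun b ↦ ?_⟩
    have symm_apply : E.symm (familyHom s (1 ⊗ₜ b)) = 1 ⊗ₜ b := E.symm_apply_apply (1 ⊗ₜ b)
    simpa [g, symm_apply] using hj (familyHom s (1 ⊗ₜ b))
  choose τ hτ using exists_eq
  have τ_injective : Function.Injective τ := by
    intro i j hij
    by_contra hne
    have := hs' i j hne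
    rw [hτ i, hτ j, hij] at this
    simp [Set.range_const] at this
  exact ⟨Equiv.ofBijective τ (Finite.injective_iff_bijective.1 τ_injective), hτ⟩

end SepFamily

/-! ### Values of multisymmetric functions -/

section EvalPt

variable {k L : Type*} [CommRing k] [CommRing L] {n r : ℕ}

/-- Evaluation of a polynomial in the coordinates `x_{ji}` at a point `α` of `(𝔸ⁿ)ʳ`, where `κ`
gives the values of the constants. -/
def evalPt (κ : k →+* L) (α : Fin r → Fin n → L) : Coord k n r →+* L :=
  MvPolynomial.eval₂Hom κ fun p ↦ α p.1 p.2

@[simp]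
lemma evalPt_C (κ : k →+* L) (α : Fin r → Fin n → L) (c : k) :
    evalPt κ α (MvPolynomial.C c) = κ c := MvPolynomial.eval₂_C _ _ _

@[simp]
lemma evalPt_X (κ : k →+* L) (α : Fin r → Fin n → L) (p : Fin r × Fin n) :
    evalPt κ α (MvPolynomial.X p) = α p.1 p.2 :=
  MvPolynomial.eval₂_X _ _ _

lemma coord_ringHom_ext {f g : Coord k n r →+* L}
    (hC : ∀ c, f (MvPolynomial.C c) = g (MvPolynomial.C c))
    (hX : ∀ j i, f (MvPolynomial.X (j, i)) = g (MvPolynomial.X (j, i))) : f = g :=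
  MvPolynomial.ringHom_ext hC fun p ↦ hX p.1 p.2

lemma comp_evalPt {L' : Type*} [CommRing L'] (g : L →+* L') (κ : k →+* L)
    (α : Fin r → Fin n → L) : g.comp (evalPt κ α) = evalPt (g.comp κ) fun j i ↦ g (α j i) :=
  coord_ringHom_ext (by simp) (by simp)

lemma algHom_evalPt {R L' : Type*} [CommRing R] [CommRing L'] [Algebra R L] [Algebra R L']
    (g : L →ₐ[R] L') (κ : k →+* R) (α : Fin r → Fin n → L) (f : Coord k n r) :
    g (evalPt ((algebraMap R L).comp κ) α f) =
      evalPt ((algebraMap R L').comp κ) (fun j i ↦ g (α j i)) f := by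
  rw [← g.comp_algebraMap, RingHom.comp_assoc]
  exact RingHom.congr_fun (comp_evalPt (g : L →+* L') _ α) f

lemma evalPt_perm (κ : k →+* L) (α : Fin r → Fin n → L) (f : Inv k n r)
    (τ : Equiv.Perm (Fin n)) : evalPt κ (fun j i ↦ α j (τ i)) f = evalPt κ α f := by
  have comp_rename : (evalPt κ α).comp (MvPolynomial.rename (Prod.map id τ)).toRingHom =
      evalPt κ (fun j i ↦ α j (τ i)) := coord_ringHom_ext (by simp) (by simp)
  conv_rhs => rw [← f.2 τ]
  rw [perm_smul_def, ← comp_rename]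
  rfl

end EvalPt

section Value

open TensorProduct

variable {k : Type*} [CommRing k] {n r : ℕ}

lemma SepFamily.evalPt_eq {R A L : Type*} [CommRing R] [CommRing A] [Algebra R A] [CommRing L]
    [Algebra R L] (e : Module.Basis (Fin n) R A) {s s' : Fin n → A →ₐ[R] L} (hs : SepFamily s)
    (hs' : SepFamily s') (κ : k →+* L) (a : Fin r → A) (f : Inv k n r) :
    evalPt κ (fun j i ↦ s i (a j)) f = evalPt κ (fun j i ↦ s' i (a j)) f := by
  refine Module.eq_of_localization_maximal (R := L)
    (Mₚ := fun P _ ↦ Localization.AtPrime P)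
    (f := fun P _ ↦ Algebra.linearMap L (Localization.AtPrime P)) _ _ fun P _ ↦ ?_
  let g : L →ₐ[R] Localization.AtPrime P := IsScalarTower.toAlgHom R L _
  obtain ⟨τ, hτ⟩ := (hs.comp g).exists_perm e (hs'.comp g)
  have g_evalPt (s : Fin n → A →ₐ[R] L) :
      (g : L →+* Localization.AtPrime P) (evalPt κ (fun j i ↦ s i (a j)) f) =
        evalPt ((g : L →+* Localization.AtPrime P).comp κ) (fun j i ↦ g.comp (s i) (a j)) f :=
    RingHom.congr_fun (comp_evalPt _ κ _) _
  change (g : L →+* Localization.AtPrime P) (evalPt _ _ _) =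
    (g : L →+* Localization.AtPrime P) (evalPt _ _ _)
  rw [g_evalPt, g_evalPt]
  simp_rw [hτ]
  exact (evalPt_perm _ (fun j i ↦ g.comp (s i) (a j)) f τ).symm

lemma SepFamily.map_evalPt_eq {R A L L' M : Type*} [CommRing R] [CommRing A] [Algebra R A]
    [CommRing L] [Algebra R L] [CommRing L'] [Algebra R L'] [CommRing M] [Algebra R M]
    (e : Module.Basis (Fin n) R A) {s : Fin n → A →ₐ[R] L} (hs : SepFamily s)
    {s' : Fin n → A →ₐ[R] L'} (hs' : SepFamily s') (g : L →ₐ[R] M) (g' : L' →ₐ[R] M)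
    (κ : k →+* R) (a : Fin r → A) (f : Inv k n r) :
    g (evalPt ((algebraMap R L).comp κ) (fun j i ↦ s i (a j)) f) =
      g' (evalPt ((algebraMap R L').comp κ) (fun j i ↦ s' i (a j)) f) := by
  rw [algHom_evalPt, algHom_evalPt]
  exact (hs.comp g).evalPt_eq e (hs'.comp g') _ a f

variable {R A : Type u} [CommRing R] [CommRing A] [Algebra R A]

lemma exists_faithfullyFlat_algEquiv_pi [Nontrivial R] [Algebra.Etale R A]
    (e : Module.Basis (Fin n) R A) :
    ∃ (L : Type u) (_ : CommRing L) (_ : Algebra R L) (_ : Module.FaithfullyFlat R L),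
      Nonempty (L ⊗[R] A ≃ₐ[L] (Fin n → L)) := by
  have := Module.Free.of_basis e
  have := Module.Finite.of_basis e
  have rank_eq : Module.rankAtStalk (R := R) A = n := by
    ext p
    simp [Module.rankAtStalk_eq_finrank_of_free, Module.finrank_eq_card_basis e]
  obtain ⟨L, _, _, _, _, _, hL⟩ := Algebra.IsFiniteSplit.exists_tensorProduct_of_etale rank_eq
  obtain ⟨m, ⟨E⟩⟩ := hL.nonempty_algEquiv_fun
  have : Nontrivial L := (FaithfulSMul.algebraMap_injective R L).nontrivial
  obtain rfl : n = m := by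
    have h := E.toLinearEquiv.finrank_eq
    rwa [Module.finrank_eq_card_basis (e.baseChange L), Module.finrank_pi, Fintype.card_fin,
      Fintype.card_fin] at h
  exact ⟨L, inferInstance, inferInstance, inferInstance, ⟨E⟩⟩

lemma sepFamily_of_algEquiv_pi {ι L : Type*} [CommRing L] [Algebra R L]
    (E : L ⊗[R] A ≃ₐ[L] (ι → L)) :
    SepFamily fun i ↦ (((Pi.evalAlgHom L (fun _ ↦ L) i).comp E.toAlgHom).restrictScalars R).comp
      Algebra.TensorProduct.includeRight := by
  refine sepFamily_of_familyHom_surjective ?_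
  convert! E.surjective using 1
  refine congrArg (DFunLike.coe (F := L ⊗[R] A →ₐ[L] ι → L)) (a₂ := E.toAlgHom) <|
    Algebra.TensorProduct.ext (Subsingleton.elim _ _) (AlgHom.ext fun b ↦ funext fun i ↦ by simp)

lemma exists_sepFamily [Algebra.Etale R A] (e : Module.Basis (Fin n) R A) :
    ∃ (L : Type u) (_ : CommRing L) (_ : Algebra R L) (_ : Module.FaithfullyFlat R L)
      (s : Fin n → A →ₐ[R] L), SepFamily s := by
  cases subsingleton_or_nontrivial R with
  | inl _ =>
    have : Subsingleton A := Module.subsingleton R A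
    exact ⟨R, inferInstance, inferInstance, inferInstance,
      fun _ ↦ (AlgEquiv.ofBijective (Algebra.ofId R A)
        ⟨Function.injective_of_subsingleton _, Function.surjective_to_subsingleton _⟩).symm,
      fun _ _ _ ↦ Subsingleton.elim (α := Ideal R) _ _⟩
  | inr _ =>
    obtain ⟨L, _, _, _, ⟨E⟩⟩ := exists_faithfullyFlat_algEquiv_pi e
    exact ⟨L, inferInstance, inferInstance, inferInstance, _, sepFamily_of_algEquiv_pi E⟩

/-- `x` is the value of the multisymmetric function `f` at the `r`-tuple `a` of elements of the
degree-`n` étale algebra `A`: over every ring over which `A` splits, the components of `a` are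
`n`-tuples, and `f` takes the value `x` at them. -/
def IsValue (κ : k →+* R) (a : Fin r → A) (f : Inv k n r) (x : R) : Prop :=
  ∀ (L : Type u) [CommRing L] [Algebra R L] (s : Fin n → A →ₐ[R] L), SepFamily s →
    algebraMap R L x = evalPt ((algebraMap R L).comp κ) (fun j i ↦ s i (a j)) f

lemma IsValue.unique [Algebra.Etale R A] (e : Module.Basis (Fin n) R A) {κ : k →+* R}
    {a : Fin r → A} {f : Inv k n r} {x y : R} (hx : IsValue κ a f x) (hy : IsValue κ a f y) :
    x = y := by
  obtain ⟨L, _, _, _, s, hs⟩ := exists_sepFamily e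
  exact FaithfulSMul.algebraMap_injective R L ((hx L s hs).trans (hy L s hs).symm)

lemma IsValue.of_sepFamily (e : Module.Basis (Fin n) R A) {κ : k →+* R} {a : Fin r → A}
    {f : Inv k n r} {x : R} {L : Type u} [CommRing L] [Algebra R L] [Module.FaithfullyFlat R L]
    {s : Fin n → A →ₐ[R] L} (hs : SepFamily s)
    (hx : algebraMap R L x = evalPt ((algebraMap R L).comp κ) (fun j i ↦ s i (a j)) f) :
    IsValue κ a f x := by
  intro L' _ _ s' hs'
  have inj : Function.Injective (Algebra.TensorProduct.includeLeft : L' →ₐ[R] L' ⊗[R] L) :=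
    FaithfulSMul.algebraMap_injective L' (L' ⊗[R] L)
  apply inj
  rw [hs'.map_evalPt_eq (M := L' ⊗[R] L) e hs Algebra.TensorProduct.includeLeft
    Algebra.TensorProduct.includeRight, ← hx, AlgHom.commutes, AlgHom.commutes]

-- The value over a splitting agrees on both factors of `L ⊗ L`, so it descends to `R`.
lemma exists_isValue [Algebra.Etale R A] (e : Module.Basis (Fin n) R A) (κ : k →+* R)
    (a : Fin r → A) (f : Inv k n r) : ∃ x, IsValue κ a f x := by
  obtain ⟨L, _, _, _, s, hs⟩ := exists_sepFamily e
  suffices h : evalPt ((algebraMap R L).comp κ) (fun j i ↦ s i (a j)) f ∈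
      Set.range (algebraMap R L) from h.imp fun x hx ↦ .of_sepFamily e hs hx
  refine (Algebra.IsEffective.of_faithfullyFlat R L _).1 ?_
  rw [Algebra.TensorProduct.includeLeftSubRight_apply, sub_eq_zero]
  exact hs.map_evalPt_eq (M := L ⊗[R] L) e hs Algebra.TensorProduct.includeLeft
    Algebra.TensorProduct.includeRight κ a f

lemma IsValue.map {R' A' : Type u} [CommRing R'] [CommRing A'] [Algebra R' A']
    {κ : k →+* R} {a : Fin r → A} {f : Inv k n r} {x : R}
    (hx : IsValue κ a f x) (g : R →+* R') (h : A →+* A')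
    (hgh : ∀ c, h (algebraMap R A c) = algebraMap R' A' (g c))
    (hgen : Algebra.adjoin R' (Set.range h) = ⊤) :
    IsValue (g.comp κ) (fun j ↦ h (a j)) f (g x) := by
  intro L _ _ s hs
  let _ : Algebra R L := ((algebraMap R' L).comp g).toAlgebra
  let s' : Fin n → A →ₐ[R] L := fun i ↦
    { (s i : A' →+* L).comp h with
      commutes' c := (congrArg (s i) (hgh c)).trans ((s i).commutes (g c)) }
  exact hx L s' ((sepFamily_iff_of_adjoin hgen s).1 hs)

/-- The evaluation homomorphism of multisymmetric functions at an `r`-tuple of elements of a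
degree-`n` étale algebra. -/
def valueHom [Algebra.Etale R A] (e : Module.Basis (Fin n) R A) (κ : k →+* R) (a : Fin r → A) :
    Inv k n r →+* R where
  toFun f := (exists_isValue e κ a f).choose
  map_one' := (exists_isValue e κ a 1).choose_spec.unique e fun L _ _ s _ ↦ by simp
  map_zero' := (exists_isValue e κ a 0).choose_spec.unique e fun L _ _ s _ ↦ by simp
  map_mul' f g := (exists_isValue e κ a (f * g)).choose_spec.unique e fun L _ _ s hs ↦ by
    rw [map_mul, (exists_isValue e κ a f).choose_spec L s hs,
      (exists_isValue e κ a g).choose_spec L s hs, Subalgebra.coe_mul, map_mul]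
  map_add' f g := (exists_isValue e κ a (f + g)).choose_spec.unique e fun L _ _ s hs ↦ by
    rw [map_add, (exists_isValue e κ a f).choose_spec L s hs,
      (exists_isValue e κ a g).choose_spec L s hs, Subalgebra.coe_add, map_add]

lemma valueHom_isValue [Algebra.Etale R A] (e : Module.Basis (Fin n) R A) (κ : k →+* R)
    (a : Fin r → A) (f : Inv k n r) : IsValue κ a f (valueHom e κ a f) :=
  (exists_isValue e κ a f).choose_spec

end Value

/-! ### Galois descent -/

section Galois

open TensorProduct

lemma eq_zero_of_forall_baseChange {R M : Type*} [CommRing R] [AddCommGroup M] [Module R M]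
    [Module.Projective R M] {m : M}
    (h : ∀ c : R, c ≠ 0 → ∃ (L : Type u) (_ : CommRing L) (_ : Algebra R L),
      algebraMap R L c ≠ 0 ∧ (1 ⊗ₜ[R] m : L ⊗[R] M) = 0) : m = 0 := by
  refine (Module.forall_dual_apply_eq_zero_iff R m).1 fun f ↦ by_contra fun hf ↦ ?_
  obtain ⟨L, _, _, map_ne_zero, tmul_eq_zero⟩ := h _ hf
  refine map_ne_zero ?_
  simpa [Algebra.algebraMap_eq_smul_one] using congrArg (f.baseChange L) tmul_eq_zero

variable {G ι S T : Type*} [Group G] [MulAction G ι] [CommRing S] [CommRing T] [Algebra S T]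
  [MulSemiringAction G T]

/-- Equivariant functions from a `G`-set to a ring with an action of `G`. -/
def IsEquivariant (G : Type*) [Group G] [MulAction G ι] [MulSemiringAction G T] (f : ι → T) :
    Prop :=
  ∀ (g : G) i, g • f i = f (g • i)

variable (G S) in
lemma sepFamily_toAlgHom [FaithfulSMul G ι] {κ : Type*} {x : κ → ι → T}
    [SMulCommClass G S T] (hx : ∀ j, IsEquivariant G (x j))
    (hsep : ∀ i i', i ≠ i' → Ideal.span (Set.range fun j ↦ x j i - x j i') = ⊤) :
    SepFamily (MulSemiringAction.toAlgHom S T : G → T →ₐ[S] T) := by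
  intro g h hgh
  obtain ⟨i, hi⟩ : ∃ i : ι, g • i ≠ h • i := by
    by_contra! smul_eq
    exact hgh (eq_of_smul_eq_smul smul_eq)
  rw [eq_top_iff, ← hsep _ _ hi]
  refine Ideal.span_mono ?_
  rintro _ ⟨j, rfl⟩
  exact ⟨x j i, by simp [hx j _ _]⟩

section Trace

variable [Fintype G] [Algebra.IsInvariant S T G]

variable (G S) in
lemma exists_algebraMap_eq_sum_smul (t : T) : ∃ c : S, algebraMap S T c = ∑ g : G, g • t :=
  Algebra.IsInvariant.isInvariant (G := G) _ fun h ↦ by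
    rw [Finset.smul_sum]
    exact Fintype.sum_equiv (Equiv.mulLeft h) _ _ fun g ↦ smul_smul h g t

variable [SMulCommClass G S T] [FaithfulSMul S T]

variable (G S) in
/-- The trace of an action of a finite group `G`, with values in the ring `S` of invariants. -/
def invTrace : T →ₗ[S] S where
  toFun t := (exists_algebraMap_eq_sum_smul G S t).choose
  map_add' t t' := FaithfulSMul.algebraMap_injective S T <| by
    rw [map_add, (exists_algebraMap_eq_sum_smul G S t).choose_spec,
      (exists_algebraMap_eq_sum_smul G S t').choose_spec,
      (exists_algebraMap_eq_sum_smul G S (t + t')).choose_spec]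
    simp only [smul_add, Finset.sum_add_distrib]
  map_smul' c t := FaithfulSMul.algebraMap_injective S T <| by
    rw [RingHom.id_apply, smul_eq_mul, map_mul, ← Algebra.smul_def,
      (exists_algebraMap_eq_sum_smul G S t).choose_spec,
      (exists_algebraMap_eq_sum_smul G S (c • t)).choose_spec]
    simp only [smul_comm _ c, ← Finset.smul_sum]

variable (S) in
lemma algebraMap_invTrace (t : T) : algebraMap S T (invTrace G S t) = ∑ g : G, g • t :=
  (exists_algebraMap_eq_sum_smul G S t).choose_spec

-- The image of the trace is an ideal which generates the unit ideal of `T`; as `T` is integral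
-- over `S`, it is the unit ideal.
lemma exists_invTrace_eq_one
    (hG : SepFamily (MulSemiringAction.toAlgHom S T : G → T →ₐ[S] T)) :
    ∃ w : T, invTrace G S w = 1 := by
  classical
  let I : Ideal S := LinearMap.range (invTrace G S : T →ₗ[S] S)
  have sum_mem_map (z : T ⊗[S] T) :
      ∑ g, familyHom (MulSemiringAction.toAlgHom S T : G → T →ₐ[S] T) z g ∈
        I.map (algebraMap S T) := by
    induction z using TensorProduct.induction_on with
    | zero => simp
    | tmul t t' =>
      simp only [familyHom_tmul, MulSemiringAction.toAlgHom_apply, ← Finset.mul_sum,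
        ← algebraMap_invTrace S]
      exact Ideal.mul_mem_left _ _ (Ideal.mem_map_of_mem _ ⟨t', rfl⟩)
    | add y z hy hz =>
      simp only [map_add, Pi.add_apply, Finset.sum_add_distrib]
      exact add_mem hy hz
  obtain ⟨z, hz⟩ := hG.familyHom_surjective (Pi.single 1 1)
  have map_eq_top : I.map (algebraMap S T) = ⊤ := by
    rw [Ideal.eq_top_iff_one]
    simpa [hz] using sum_mem_map z
  have isIntegral := Algebra.IsInvariant.isIntegral S T G
  rw [Ideal.map_eq_top_iff _ (FaithfulSMul.algebraMap_injective S T)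
    (algebraMap_isIntegral_iff.2 isIntegral), Ideal.eq_top_iff_one] at map_eq_top
  exact map_eq_top

variable {E : Type*} [CommRing E] [Algebra S E] {ev : ι → E →ₐ[S] T}

lemma algHom_lid_rTensor_invTrace (hev : ∀ z, IsEquivariant G fun i ↦ ev i z) (z : T ⊗[S] E)
    (i : ι) : ev i (TensorProduct.lid S E ((invTrace G S).rTensor E z)) =
      ∑ g : G, g • familyHom ev z (g⁻¹ • i) := by
  induction z using TensorProduct.induction_on with
  | zero => simp
  | tmul t y =>
    rw [LinearMap.rTensor_tmul, lid_tmul, map_smul, Algebra.smul_def, algebraMap_invTrace,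
      Finset.sum_mul]
    simp only [familyHom_tmul, smul_mul', hev y _ _, smul_inv_smul]
  | add y z hy hz =>
    simp only [map_add, hy, hz, Pi.add_apply, smul_add, Finset.sum_add_distrib]

lemma exists_equivariant_dual_basis [Fintype ι]
    (hG : SepFamily (MulSemiringAction.toAlgHom S T : G → T →ₐ[S] T)) (hs : SepFamily ev)
    (hev : ∀ z, IsEquivariant G fun i ↦ ev i z) (hinj : Function.Injective fun z i ↦ ev i z) :
    ∃ F : ι → Finset (T × E),
      ∀ z, z = ∑ i, ∑ m ∈ F i, invTrace G S (m.1 * ev i z) • m.2 := by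
  classical
  obtain ⟨w, hw⟩ := exists_invTrace_eq_one hG
  choose P hP using fun i ↦ hs.familyHom_surjective (Pi.single i 1)
  choose F hF using fun i ↦ TensorProduct.exists_finset (w • P i)
  refine ⟨F, fun z ↦ hinj (funext fun j ↦ ?_)⟩
  have lid_rTensor (i : ι) : ∑ m ∈ F i, invTrace G S (m.1 * ev i z) • m.2 =
      TensorProduct.lid S E ((invTrace G S).rTensor E (ev i z • w • P i)) := by
    simp [hF, Finset.smul_sum, smul_tmul', mul_comm]
  have sum_smul : familyHom ev (∑ i, ev i z • w • P i) = fun i ↦ w * ev i z := by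
    ext i
    simp [hP, Pi.single_apply, mul_comm]
  simp only [lid_rTensor, ← map_sum, algHom_lid_rTensor_invTrace hev, sum_smul, smul_mul',
    hev z _ _, smul_inv_smul, ← Finset.sum_mul]
  rw [← algebraMap_invTrace S, hw, map_one, one_mul]

end Trace

variable [Finite G] [SMulCommClass G S T] [Algebra.IsInvariant S T G] [FaithfulSMul S T]
  (hG : SepFamily (MulSemiringAction.toAlgHom S T : G → T →ₐ[S] T))

include hG

lemma includeLeft_injective_of_isInvariant {R : Type*} [CommRing R] [Algebra S R] :
    Function.Injective (Algebra.TensorProduct.includeLeft : R →ₐ[S] R ⊗[S] T) := by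
  cases nonempty_fintype G
  obtain ⟨w, hw⟩ := exists_invTrace_eq_one hG
  let retraction : R ⊗[S] T →ₗ[S] R := (TensorProduct.rid S R).toLinearMap ∘ₗ
    (invTrace G S ∘ₗ LinearMap.mulLeft S w).lTensor R
  exact Function.LeftInverse.injective (g := retraction) fun c ↦ by simp [retraction, hw]

variable [Finite ι] {E : Type*} [CommRing E] [Algebra S E] {ev : ι → E →ₐ[S] T}

lemma exists_apply_eq_of_isEquivariant (hs : SepFamily ev)
    (hev : ∀ z, IsEquivariant G fun i ↦ ev i z) {f : ι → T} (hf : IsEquivariant G f) :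
    ∃ z, ∀ i, ev i z = f i := by
  cases nonempty_fintype G
  obtain ⟨w, hw⟩ := exists_invTrace_eq_one hG
  obtain ⟨z, hz⟩ := hs.familyHom_surjective fun i ↦ w * f i
  refine ⟨TensorProduct.lid S E ((invTrace G S).rTensor E z), fun i ↦ ?_⟩
  simp only [algHom_lid_rTensor_invTrace hev, hz, smul_mul', hf _ _, smul_inv_smul,
    ← Finset.sum_mul, ← algebraMap_invTrace S, hw, map_one, one_mul]

lemma mem_adjoin_of_isEquivariant {κ : Type*} {x : κ → ι → T} (hx : ∀ j, IsEquivariant G (x j))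
    (hsep : ∀ i i', i ≠ i' → Ideal.span (Set.range fun j ↦ x j i - x j i') = ⊤) {f : ι → T}
    (hf : IsEquivariant G f) : f ∈ Algebra.adjoin S (Set.range x) := by
  let Q := Algebra.adjoin S (Set.range x)
  let ev i : Q →ₐ[S] T := (Pi.evalAlgHom S (fun _ ↦ T) i).comp Q.val
  have sepFamily_ev : SepFamily ev := by
    intro i i' hi
    rw [eq_top_iff, ← hsep _ _ hi]
    refine Ideal.span_mono ?_
    rintro _ ⟨j, rfl⟩
    exact ⟨⟨x j, Algebra.subset_adjoin ⟨j, rfl⟩⟩, rfl⟩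
  have isEquivariant_of_mem : ∀ q ∈ Q, IsEquivariant G q := by
    intro q hq
    induction hq using Algebra.adjoin_induction with
    | mem q hq => obtain ⟨j, rfl⟩ := hq; exact hx j
    | algebraMap c => exact fun g i ↦ smul_algebraMap g c
    | add q q' _ _ h h' => exact fun g i ↦ by simp [h g i, h' g i]
    | mul q q' _ _ h h' => exact fun g i ↦ by simp [h g i, h' g i]
  obtain ⟨z, hz⟩ := exists_apply_eq_of_isEquivariant hG sepFamily_ev
    (fun z ↦ isEquivariant_of_mem z z.2) hf
  exact (funext hz : (z : ι → T) = f) ▸ z.2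

lemma projective_of_isEquivariant (hs : SepFamily ev)
    (hev : ∀ z, IsEquivariant G fun i ↦ ev i z) (hinj : Function.Injective fun z i ↦ ev i z) :
    Module.Projective S E := by
  cases nonempty_fintype G
  cases nonempty_fintype ι
  obtain ⟨F, hF⟩ := exists_equivariant_dual_basis hG hs hev hinj
  refine Module.projective_def'.2 ⟨∑ i, ∑ m ∈ F i, Finsupp.lsingle m.2 ∘ₗ invTrace G S ∘ₗ
    LinearMap.mulLeft S m.1 ∘ₗ (ev i).toLinearMap, LinearMap.ext fun z ↦ ?_⟩
  simpa using (hF z).symm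

lemma familyHom_comp_injective (hs : SepFamily ev)
    (hev : ∀ z, IsEquivariant G fun i ↦ ev i z) (hinj : Function.Injective fun z i ↦ ev i z)
    {L : Type*} [CommRing L] [Algebra S L] (h : T →ₐ[S] L) :
    Function.Injective (familyHom fun i ↦ h.comp (ev i)) := by
  cases nonempty_fintype G
  cases nonempty_fintype ι
  obtain ⟨F, hF⟩ := exists_equivariant_dual_basis hG hs hev hinj
  have eq_sum (z : L ⊗[S] E) : z = ∑ i, ∑ m ∈ F i,
      (∑ g : G, h (g • m.1) * familyHom (fun i ↦ h.comp (ev i)) z (g • i)) ⊗ₜ m.2 := by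
    induction z using TensorProduct.induction_on with
    | zero => simp
    | tmul l z =>
      have sum_eq (i : ι) (t : T) : ∑ g : G, h (g • t) * (l * h (ev (g • i) z)) =
          invTrace G S (t * ev i z) • l := by
        rw [Algebra.smul_def, ← h.commutes, algebraMap_invTrace, map_sum, Finset.sum_mul]
        refine Finset.sum_congr rfl fun g _ ↦ ?_
        rw [smul_mul', map_mul, hev z g i, mul_left_comm, mul_comm l]
      conv_lhs => rw [hF z]
      simp only [familyHom_tmul, AlgHom.comp_apply, sum_eq, tmul_sum, smul_tmul]
    | add y z hy hz =>
      conv_lhs => rw [hy, hz]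
      simp only [map_add, Pi.add_apply, mul_add, Finset.sum_add_distrib, add_tmul]
  refine (injective_iff_map_eq_zero _).2 fun z hz ↦ ?_
  rw [eq_sum z, hz]
  simp

lemma injective_of_isEquivariant (hs : SepFamily ev) (hev : ∀ z, IsEquivariant G fun i ↦ ev i z)
    (hinj : Function.Injective fun z i ↦ ev i z) {R C : Type*} [CommRing R] [Algebra S R]
    [CommRing C] [Algebra R C] {Φ : R ⊗[S] E →ₐ[R] C}
    (h : ∀ c : R, c ≠ 0 → ∃ (L : Type u) (_ : CommRing L) (_ : Algebra R L)
      (s : ι → C →ₐ[R] L) (g : T →+* L), algebraMap R L c ≠ 0 ∧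
        (∀ d, g (algebraMap S T d) = algebraMap R L (algebraMap S R d)) ∧
        ∀ i z, s i (Φ (1 ⊗ₜ z)) = g (ev i z)) : Function.Injective Φ := by
  have : Module.Projective S E := projective_of_isEquivariant hG hs hev hinj
  refine (injective_iff_map_eq_zero Φ).2 fun m hm ↦
    eq_zero_of_forall_baseChange (R := R) fun c hc ↦ ?_
  obtain ⟨L, _, _, s, g, map_ne_zero, g_algebraMap, s_apply⟩ := h c hc
  let _ : Algebra S L := ((algebraMap R L).comp (algebraMap S R)).toAlgebra
  have : IsScalarTower S R L := .of_algebraMap_eq' rfl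
  let g' : T →ₐ[S] L := { g with commutes' := g_algebraMap }
  have familyHom_apply (w : R ⊗[S] E) (i : ι) : familyHom (fun i ↦ g'.comp (ev i))
      (AlgebraTensorModule.cancelBaseChange S R L L E (1 ⊗ₜ w)) i = s i (Φ w) := by
    induction w using TensorProduct.induction_on with
    | zero => simp
    | tmul c z =>
      have s_tmul : s i (Φ (c ⊗ₜ z)) = c • s i (Φ (1 ⊗ₜ z)) := by
        rw [← map_smul, ← map_smul, smul_tmul', smul_eq_mul, mul_one]
      rw [AlgebraTensorModule.cancelBaseChange_tmul, familyHom_tmul, s_tmul, s_apply,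
        smul_one_mul]
      rfl
    | add y z hy hz => simp only [tmul_add, map_add, Pi.add_apply, hy, hz]
  refine ⟨L, _, _, map_ne_zero,
    (AlgebraTensorModule.cancelBaseChange S R L L E).injective ?_⟩
  refine familyHom_comp_injective hG hs hev hinj g' (funext fun i ↦ ?_)
  rw [familyHom_apply, hm, map_zero, map_zero, map_zero]
  rfl

end Galois

/-! ### Restriction of sections -/

section Sections

variable {X Y : Scheme.{u}}

lemma app_map_apply (f : X ⟶ Y) {U V : Y.Opens} (h : V ≤ U) (s : Γ(Y, U)) :
    f.app V (Y.presheaf.map (homOfLE h).op s) =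
      X.presheaf.map (homOfLE (f.preimage_mono h)).op (f.app U s) :=
  ConcreteCategory.congr_hom (f.naturality (homOfLE h).op) s

lemma map_map_apply {U V W : X.Opens} (h : V ≤ U) (h' : W ≤ V) (s : Γ(X, U)) :
    X.presheaf.map (homOfLE h').op (X.presheaf.map (homOfLE h).op s) =
      X.presheaf.map (homOfLE (h'.trans h)).op s := by
  rw [← CommRingCat.comp_apply, ← Functor.map_comp]
  rfl

lemma map_appLE_apply (f : X ⟶ Y) {U U' : Y.Opens} {V : X.Opens} (e : V ≤ f ⁻¹ᵁ U) (h : U ≤ U')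
    (s : Γ(Y, U')) : f.appLE U V e (Y.presheaf.map (homOfLE h).op s) =
      f.appLE U' V (e.trans (f.preimage_mono h)) s := by
  rw [← CommRingCat.comp_apply, Scheme.Hom.map_appLE]

lemma appLE_map_apply (f : X ⟶ Y) {U : Y.Opens} {V V' : X.Opens} (e : V ≤ f ⁻¹ᵁ U) (h : V' ≤ V)
    (s : Γ(Y, U)) : X.presheaf.map (homOfLE h).op (f.appLE U V e s) =
      f.appLE U V' (h.trans e) s := by
  rw [← CommRingCat.comp_apply, Scheme.Hom.appLE_map]

lemma section_ext {U : X.Opens} {s t : Γ(X, U)}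
    (h : ∀ x ∈ U, ∃ (V : X.Opens) (hV : V ≤ U), x ∈ V ∧
      X.presheaf.map (homOfLE hV).op s = X.presheaf.map (homOfLE hV).op t) : s = t := by
  choose V hV hx hst using h
  exact X.sheaf.eq_of_locally_eq' (fun x : U ↦ V x.1 x.2) U (fun x ↦ homOfLE (hV _ _))
    (fun x hxU ↦ Opens.mem_iSup.2 ⟨⟨x, hxU⟩, hx _ _⟩) s t fun x ↦ hst _ _

lemma exists_section {U : X.Opens} {ι : Type u} (V : ι → X.Opens) (hV : ∀ i, V i ≤ U)
    (hU : U ≤ iSup V) (s : ∀ i, Γ(X, V i))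
    (hs : ∀ i j, X.presheaf.map (homOfLE inf_le_left).op (s i) =
      X.presheaf.map (homOfLE (inf_le_right : V i ⊓ V j ≤ V j)).op (s j)) :
    ∃ t : Γ(X, U), ∀ i, X.presheaf.map (homOfLE (hV i)).op t = s i :=
  (X.sheaf.existsUnique_gluing' V U (fun i ↦ homOfLE (hV i)) hU s hs).exists

end Sections

/-! ### Invariant functions on the spectrum of a ring with a group action -/

section Invariants

variable {G S T : Type*} [Group G] [CommRing S] [CommRing T] [Algebra S T] [MulSemiringAction G T]

section Localization

variable {S' T' : Type*} [CommRing S'] [CommRing T'] [Algebra S S'] [Algebra T T'] (h : S)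
  [IsLocalization.Away h S'] [IsLocalization.Away (algebraMap S T h) T'] {q : S' →+* T'}
  (hq : ∀ s, q (algebraMap S S' s) = algebraMap T T' (algebraMap S T s))

include h hq

lemma injective_of_isLocalizationAway [FaithfulSMul S T] : Function.Injective q := by
  have : IsLocalization ((Submonoid.powers h).map (algebraMap S T)) T' := by
    rwa [Submonoid.map_powers]
  have q_eq_map : q = IsLocalization.map T' (algebraMap S T) (Submonoid.powers h).le_comap_map :=
    IsLocalization.ringHom_ext (Submonoid.powers h) <| RingHom.ext fun s ↦ by simp [hq]
  rw [q_eq_map]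
  exact IsLocalization.map_injective_of_injective _ _ _ (FaithfulSMul.algebraMap_injective S T)

lemma exists_eq_of_isLocalizationAway [Finite G] [SMulCommClass G S T] [Algebra.IsInvariant S T G]
    {ρ : G → T' →+* T'} (hρ : ∀ g t, ρ g (algebraMap T T' t) = algebraMap T T' (g • t)) {z : T'}
    (hz : ∀ g, ρ g z = z) : ∃ y, q y = z := by
  cases nonempty_fintype G
  obtain ⟨N, t, ht⟩ := IsLocalization.Away.surj (algebraMap S T h) z
  have exists_pow_mul_smul_eq (g : G) :
      ∃ M, algebraMap S T h ^ M * (g • t) = algebraMap S T h ^ M * t := by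
    refine IsLocalization.Away.exists_of_eq (S := T') _ ?_
    rw [← hρ, ← ht, map_mul, map_pow, hρ, hz, smul_algebraMap]
  choose M hM using exists_pow_mul_smul_eq
  obtain ⟨s, hs⟩ := Algebra.IsInvariant.isInvariant (A := S) (G := G)
    (algebraMap S T h ^ (∑ g, M g) * t) fun g ↦ by
      obtain ⟨m, hm⟩ := Nat.exists_eq_add_of_le'
        (Finset.single_le_sum (fun _ _ ↦ Nat.zero_le _) (Finset.mem_univ g) : M g ≤ ∑ g, M g)
      rw [smul_mul', smul_pow', smul_algebraMap, hm, pow_add, mul_assoc, hM, ← mul_assoc]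
  obtain ⟨w, hw⟩ := (IsLocalization.Away.algebraMap_isUnit (S := S') h).pow ((∑ g, M g) + N)
  have q_w : q w = algebraMap T T' (algebraMap S T h) ^ ((∑ g, M g) + N) := by
    rw [hw, map_pow, hq]
  refine ⟨↑w⁻¹ * algebraMap S S' s, (w.isUnit.map q).mul_left_cancel ?_⟩
  rw [← map_mul, w.mul_inv_cancel_left, hq, hs, q_w, pow_add, mul_assoc, mul_comm (_ ^ N), ht,
    map_mul, map_pow]

end Localization

lemma specMap_appLE_algebraMap {R R' : CommRingCat.{u}} (φ : R ⟶ R') (O : (Spec R).Opens)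
    (P : (Spec R').Opens) (e : P ≤ Spec.map φ ⁻¹ᵁ O) (x : R) :
    (Spec.map φ).appLE O P e (algebraMap R Γ(Spec R, O) x) =
      algebraMap R' Γ(Spec R', P) (φ x) := by
  have comp_eq : (Scheme.ΓSpecIso R).inv ≫ (Spec R).presheaf.map (homOfLE le_top).op ≫
      (Spec.map φ).appLE O P e =
        φ ≫ (Scheme.ΓSpecIso R').inv ≫ (Spec R').presheaf.map (homOfLE le_top).op := by
    rw [Scheme.Hom.map_appLE, Scheme.Hom.appLE, Scheme.ΓSpecIso_inv_naturality_assoc]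
    rfl
  exact ConcreteCategory.congr_hom comp_eq x

/-- The basic open subset of `Spec R` defined by an element of `R`. -/
def specBasicOpen {R : CommRingCat.{u}} (f : R) : (Spec R).Opens := PrimeSpectrum.basicOpen f

instance {R : CommRingCat.{u}} (f : R) : IsLocalization.Away f Γ(Spec R, specBasicOpen f) :=
  StructureSheaf.IsLocalization.to_basicOpen R f

lemma exists_specBasicOpen_mem_le {R : CommRingCat.{u}} {O : (Spec R).Opens} {x : Spec R}
    (hx : x ∈ O) : ∃ f : R, x ∈ specBasicOpen f ∧ specBasicOpen f ≤ O := by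
  obtain ⟨_, ⟨f, rfl⟩, hxf, hfO⟩ :=
    PrimeSpectrum.isTopologicalBasis_basic_opens.exists_subset_of_mem_open hx O.isOpen
  exact ⟨f, hxf, hfO⟩

end Invariants

section SpecInvariants

variable {G : Type*} [Group G] {S T : CommRingCat.{u}} [Algebra S T] [MulSemiringAction G T]

variable (S T) in
/-- The morphism `Spec T ⟶ Spec S` of an `S`-algebra `T`; when `S` is the ring of invariants of a
group action on `T`, the quotient map of the action. -/
abbrev specQuot : Spec T ⟶ Spec S := Spec.map (CommRingCat.ofHom (algebraMap S T) : S ⟶ T)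

instance (f : S) : IsLocalization.Away (algebraMap S T f)
    Γ(Spec T, specQuot S T ⁻¹ᵁ specBasicOpen f) :=
  inferInstanceAs (IsLocalization.Away _ Γ(Spec T, specBasicOpen (algebraMap S T f)))

variable (T) in
/-- The morphism `Spec T ⟶ Spec T` given by an element of a group acting on `T`. -/
abbrev specAct (g : G) : Spec T ⟶ Spec T :=
  Spec.map (CommRingCat.ofHom (MulSemiringAction.toRingHom G T g) : T ⟶ T)

lemma specQuot_app_injective [FaithfulSMul S T] (O : (Spec S).Opens) :
    Function.Injective ((specQuot S T).app O) := by
  refine (injective_iff_map_eq_zero _).2 fun y hy ↦ section_ext fun x hx ↦ ?_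
  obtain ⟨f, hxf, hfO⟩ := exists_specBasicOpen_mem_le hx
  refine ⟨_, hfO, hxf, ?_⟩
  have app_injective : Function.Injective ((specQuot S T).app (specBasicOpen f)) := by
    refine injective_of_isLocalizationAway (S := S) (T := T) f
      (q := ((specQuot S T).app (specBasicOpen f)).hom) fun s ↦ ?_
    rw [← Scheme.Hom.appLE_eq_app]
    exact specMap_appLE_algebraMap _ _ _ le_rfl s
  apply app_injective
  rw [app_map_apply, hy, map_zero, map_zero, map_zero]

variable [SMulCommClass G S T]

lemma specAct_specQuot (g : G) : specAct T g ≫ specQuot S T = specQuot S T := by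
  rw [← Spec.map_comp]
  congr 1
  exact CommRingCat.hom_ext (RingHom.ext fun s ↦ smul_algebraMap g s)

lemma specQuot_preimage_le (O : (Spec S).Opens) (g : G) :
    specQuot S T ⁻¹ᵁ O ≤ specAct T g ⁻¹ᵁ (specQuot S T ⁻¹ᵁ O) := by
  rw [← Scheme.Hom.comp_preimage, specAct_specQuot]

variable [Finite G] [Algebra.IsInvariant S T G]

lemma exists_specQuot_app_basicOpen_eq (f : S)
    (z : Γ(Spec T, specQuot S T ⁻¹ᵁ specBasicOpen f))
    (hz : ∀ g : G, (specAct T g).appLE _ _ (specQuot_preimage_le _ g) z = z) :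
    ∃ y, (specQuot S T).app (specBasicOpen f) y = z := by
  refine exists_eq_of_isLocalizationAway (S := S) (T := T) f
    (q := ((specQuot S T).app (specBasicOpen f)).hom) (fun s ↦ ?_)
    (ρ := fun g : G ↦ ((specAct T g).appLE _ _ (specQuot_preimage_le _ g)).hom)
    (fun g t ↦ specMap_appLE_algebraMap _ _ _ _ t) hz
  rw [← Scheme.Hom.appLE_eq_app]
  exact specMap_appLE_algebraMap _ _ _ le_rfl s

lemma exists_specQuot_app_eq [FaithfulSMul S T] (O : (Spec S).Opens)
    (z : Γ(Spec T, specQuot S T ⁻¹ᵁ O))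
    (hz : ∀ g : G, (specAct T g).appLE _ _ (specQuot_preimage_le _ g) z = z) :
    ∃ y, (specQuot S T).app O y = z := by
  choose f hxf hfO using fun x : O ↦ exists_specBasicOpen_mem_le x.2
  have exists_local (x : O) : ∃ y, (specQuot S T).app (specBasicOpen (f x)) y =
      (Spec T).presheaf.map (homOfLE ((specQuot S T).preimage_mono (hfO x))).op z := by
    refine exists_specQuot_app_basicOpen_eq (G := G) _ _ fun g ↦ ?_
    conv_rhs => rw [← hz g]
    rw [map_appLE_apply, appLE_map_apply]
  choose y hy using exists_local
  have app_res_y (x : O) {W : (Spec S).Opens} (hW : W ≤ specBasicOpen (f x)) :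
      (specQuot S T).app W ((Spec S).presheaf.map (homOfLE hW).op (y x)) =
        (Spec T).presheaf.map
          (homOfLE ((specQuot S T).preimage_mono (hW.trans (hfO x)))).op z := by
    rw [app_map_apply, hy, map_map_apply]
  obtain ⟨s, hs⟩ := exists_section _ hfO
    (fun x hx ↦ Opens.mem_iSup.2 ⟨⟨x, hx⟩, hxf _⟩) y fun a b ↦ specQuot_app_injective _ <|
      (app_res_y a inf_le_left).trans (app_res_y b inf_le_right).symm
  refine ⟨s, section_ext fun x hx ↦
    ⟨_, (specQuot S T).preimage_mono (hfO ⟨_, hx⟩), hxf ⟨_, hx⟩, ?_⟩⟩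
  rw [← app_map_apply (specQuot S T) (hfO ⟨_, hx⟩), hs, hy]

end SpecInvariants

/-! ### Morphisms to affine schemes -/

section SpecHom

variable {Y Z : Scheme.{u}} {R R' : CommRingCat.{u}}

/-- The morphism to an affine scheme defined by a ring homomorphism to the global sections. -/
def specHom (ρ : R ⟶ Γ(Y, ⊤)) : Y ⟶ Spec R := Y.toSpecΓ ≫ Spec.map ρ

/-- The ring homomorphism to the global sections defined by a morphism to an affine scheme. -/
def globalHom (f : Y ⟶ Spec R) : R ⟶ Γ(Y, ⊤) := (Scheme.ΓSpecIso R).inv ≫ f.appTop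

lemma globalHom_specHom (ρ : R ⟶ Γ(Y, ⊤)) : globalHom (specHom ρ) = ρ := by
  simp [globalHom, specHom]

lemma globalHom_injective : Function.Injective (globalHom : (Y ⟶ Spec R) → _) := by
  intro f g h
  refine ext_of_isAffine ?_
  rwa [globalHom, globalHom, cancel_epi] at h

lemma globalHom_comp (g : Z ⟶ Y) (f : Y ⟶ Spec R) :
    globalHom (g ≫ f) = globalHom f ≫ g.appTop := by
  simp [globalHom]

lemma globalHom_comp_specMap (f : Y ⟶ Spec R) (φ : R' ⟶ R) :
    globalHom (f ≫ Spec.map φ) = φ ≫ globalHom f := by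
  simp [globalHom]

lemma notMem_asIdeal_iff (f : Y ⟶ Spec R) (y : Y) (p : R) :
    p ∉ (f y).asIdeal ↔ y ∈ Y.basicOpen (globalHom f p) := by
  rw [globalHom, CommRingCat.comp_apply, ← Scheme.preimage_basicOpen_top f]
  change _ ↔ f y ∈ (Spec R).basicOpen _
  rw [basicOpen_eq_of_affine]
  rfl

end SpecHom

/-! ### The quotient map `U(r; 𝔸ⁿ) ⟶ B(r; 𝔸ⁿ)` -/

section Torsor

lemma appLE_apply_of_eq_id {Y : Scheme.{u}} {g : Y ⟶ Y} (hg : g = 𝟙 Y) (W : Y.Opens)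
    (e : W ≤ g ⁻¹ᵁ W) (z : Γ(Y, W)) : g.appLE W W e z = z := by
  subst hg
  exact ConcreteCategory.congr_hom (Y.presheaf.map_id (op W)) z

lemma appLE_apply_of_eq_comp {Y : Scheme.{u}} {g h l : Y ⟶ Y} (hl : l = g ≫ h) (W : Y.Opens)
    (el : W ≤ l ⁻¹ᵁ W) (eg : W ≤ g ⁻¹ᵁ W) (eh : W ≤ h ⁻¹ᵁ W) (z : Γ(Y, W)) :
    l.appLE W W el z = g.appLE W W eg (h.appLE W W eh z) := by
  subst hl
  rw [← CommRingCat.comp_apply, Scheme.Hom.appLE_comp_appLE]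

variable {k : Type u} [CommRing k] {n r : ℕ}

lemma UOpens_eq_preimage : UOpens k n r = quotMap k n r ⁻¹ᵁ BOpens k n r := by
  refine le_antisymm (UOpens_le_quotMap k n r) fun p hp ↦ ?_
  obtain ⟨q, hq, hqp⟩ := hp
  obtain ⟨σ, rfl⟩ := exists_actAff_eq hqp
  exact actAff_mem σ hq

lemma quotU_ι : quotU k n r ≫ (BOpens k n r).ι = (UOpens k n r).ι ≫ quotMap k n r :=
  Scheme.Hom.resLE_comp_ι _ _

lemma image_quotU_preimage (V : (BScheme k n r).Opens) :
    (UOpens k n r).ι ''ᵁ (quotU k n r ⁻¹ᵁ V) = quotMap k n r ⁻¹ᵁ ((BOpens k n r).ι ''ᵁ V) := by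
  have val_quotU (p : U k n r) : (quotU k n r p).1 = quotMap k n r p.1 :=
    congrArg (fun f : U k n r ⟶ QuotR k n r ↦ f p) quotU_ι
  ext p
  constructor
  · rintro ⟨q, hq, rfl⟩
    exact ⟨quotU k n r q, hq, val_quotU q⟩
  · rintro ⟨b, hb, hbp⟩
    have hp : p ∈ UOpens k n r := by
      rw [UOpens_eq_preimage]
      change quotMap k n r p ∈ BOpens k n r
      rw [← hbp]
      exact b.2
    refine ⟨⟨p, hp⟩, ?_, rfl⟩
    change quotU k n r ⟨p, hp⟩ ∈ V
    rwa [show quotU k n r ⟨p, hp⟩ = b from Subtype.ext ((val_quotU ⟨p, hp⟩).trans hbp.symm)]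

lemma isAffineOpen_quotU_preimage {V : (BScheme k n r).Opens} (hV : IsAffineOpen V) :
    IsAffineOpen (quotU k n r ⁻¹ᵁ V) := by
  rw [← Scheme.Hom.isAffineOpen_iff_of_isOpenImmersion (UOpens k n r).ι, image_quotU_preimage]
  have : IsAffineHom (quotMap k n r) := inferInstanceAs (IsAffineHom (Spec.map _))
  exact (hV.image_of_isOpenImmersion (BOpens k n r).ι).preimage (quotMap k n r)

lemma quotMap_appLE_injective {O : (QuotR k n r).Opens} {P : (AffR k n r).Opens}
    (h : P = quotMap k n r ⁻¹ᵁ O) : Function.Injective ((quotMap k n r).appLE O P h.le) := by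
  subst h
  rw [Scheme.Hom.appLE_eq_app]
  exact specQuot_app_injective (S := .of (Inv k n r)) (T := .of (Coord k n r)) O

lemma exists_quotMap_appLE_eq {O : (QuotR k n r).Opens} {P : (AffR k n r).Opens}
    (h : P = quotMap k n r ⁻¹ᵁ O) (hP : ∀ σ, P ≤ actAff k n r σ ⁻¹ᵁ P) (z : Γ(AffR k n r, P))
    (hz : ∀ σ, (actAff k n r σ).appLE P P (hP σ) z = z) :
    ∃ y, (quotMap k n r).appLE O P h.le y = z := by
  subst h
  rw [Scheme.Hom.appLE_eq_app]
  exact exists_specQuot_app_eq (G := Equiv.Perm (Fin n)) (S := .of (Inv k n r))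
    (T := .of (Coord k n r)) O z hz

lemma quotU_app_injective (V : (BScheme k n r).Opens) :
    Function.Injective ((quotU k n r).app V) := by
  rw [← Scheme.Hom.appLE_eq_app, quotU, Scheme.Hom.resLE_appLE]
  exact quotMap_appLE_injective (image_quotU_preimage V)

lemma exists_quotU_app_eq (V : (BScheme k n r).Opens) (z : Γ(U k n r, quotU k n r ⁻¹ᵁ V))
    (hz : ∀ σ, (actU k n r σ).appLE _ _ (preimage_le k n r σ V) z = z) :
    ∃ y, (quotU k n r).app V y = z := by
  simp only [actU, Scheme.Hom.resLE_appLE] at hz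
  rw [← Scheme.Hom.appLE_eq_app]
  simp only [quotU, Scheme.Hom.resLE_appLE]
  exact exists_quotMap_appLE_eq (image_quotU_preimage V) _ z hz

lemma actAff_one : actAff k n r 1 = 𝟙 _ := by
  rw [actAff, ← Spec.map_id]
  congr 1
  exact CommRingCat.hom_ext (RingHom.ext fun p : Coord k n r ↦ one_smul (Equiv.Perm (Fin n)) p)

lemma actAff_mul (σ τ : Equiv.Perm (Fin n)) :
    actAff k n r (σ * τ) = actAff k n r σ ≫ actAff k n r τ := by
  rw [actAff, actAff, actAff, ← Spec.map_comp]
  congr 1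
  exact CommRingCat.hom_ext (RingHom.ext fun p : Coord k n r ↦ mul_smul σ τ p)

lemma actU_one : actU k n r 1 = 𝟙 _ := by
  rw [← cancel_mono (UOpens k n r).ι, actU, Scheme.Hom.resLE_comp_ι, Category.id_comp, actAff_one,
    Category.comp_id]

lemma actU_mul (σ τ : Equiv.Perm (Fin n)) :
    actU k n r (σ * τ) = actU k n r σ ≫ actU k n r τ := by
  rw [← cancel_mono (UOpens k n r).ι, actU, actU, actU, Category.assoc, Scheme.Hom.resLE_comp_ι,
    Scheme.Hom.resLE_comp_ι, Scheme.Hom.resLE_comp_ι_assoc, actAff_mul]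

/-- The action of the symmetric group on functions on `π⁻¹ V`, as a monoid homomorphism. -/
def permActionHom (V : (BScheme k n r).Opens) :
    Equiv.Perm (Fin n) →* (Γ(U k n r, quotU k n r ⁻¹ᵁ V) →+* Γ(U k n r, quotU k n r ⁻¹ᵁ V)) where
  toFun σ := ((actU k n r σ).appLE _ _ (preimage_le k n r σ V)).hom
  map_one' := RingHom.ext fun z ↦ appLE_apply_of_eq_id actU_one _ _ z
  map_mul' σ τ := RingHom.ext fun z ↦ appLE_apply_of_eq_comp (actU_mul σ τ) _ _ _ _ z

instance permActionU (V : (BScheme k n r).Opens) :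
    MulSemiringAction (Equiv.Perm (Fin n)) Γ(U k n r, quotU k n r ⁻¹ᵁ V) :=
  MulSemiringAction.compHom _ (permActionHom V)

lemma smul_sectionU_def (V : (BScheme k n r).Opens) (σ : Equiv.Perm (Fin n))
    (z : Γ(U k n r, quotU k n r ⁻¹ᵁ V)) :
    σ • z = (actU k n r σ).appLE _ _ (preimage_le k n r σ V) z := rfl

instance quotUAlgebra (V : (BScheme k n r).Opens) :
    Algebra Γ(BScheme k n r, V) Γ(U k n r, quotU k n r ⁻¹ᵁ V) :=
  ((quotU k n r).app V).hom.toAlgebra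

lemma algebraMap_quotU (V : (BScheme k n r).Opens) (c : Γ(BScheme k n r, V)) :
    algebraMap Γ(BScheme k n r, V) Γ(U k n r, quotU k n r ⁻¹ᵁ V) c = (quotU k n r).app V c := rfl

instance (V : (BScheme k n r).Opens) :
    FaithfulSMul Γ(BScheme k n r, V) Γ(U k n r, quotU k n r ⁻¹ᵁ V) :=
  (faithfulSMul_iff_algebraMap_injective _ _).2 (quotU_app_injective V)

instance (V : (BScheme k n r).Opens) : Algebra.IsInvariant Γ(BScheme k n r, V)
    Γ(U k n r, quotU k n r ⁻¹ᵁ V) (Equiv.Perm (Fin n)) where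
  isInvariant z hz := exists_quotU_app_eq V z hz

instance (V : (BScheme k n r).Opens) : SMulCommClass (Equiv.Perm (Fin n)) Γ(BScheme k n r, V)
    Γ(U k n r, quotU k n r ⁻¹ᵁ V) where
  smul_comm σ c z := by
    rw [Algebra.smul_def, Algebra.smul_def, smul_mul', algebraMap_quotU, smul_sectionU_def,
      actU_appLE_quotU]

/-- The section over an open subset of `U(r; 𝔸ⁿ)` defined by a polynomial. -/
def polySec (W : (U k n r).Opens) : Coord k n r →+* Γ(U k n r, W) :=
  (globalHom (R := .of (Coord k n r)) (UOpens k n r).ι ≫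
    (U k n r).presheaf.map (homOfLE le_top).op).hom

/-- The section over an open subset of `B(r; 𝔸ⁿ)` defined by an invariant polynomial. -/
def invPolySec (V : (BScheme k n r).Opens) : Inv k n r →+* Γ(BScheme k n r, V) :=
  (globalHom (R := .of (Inv k n r)) (BOpens k n r).ι ≫
    (BScheme k n r).presheaf.map (homOfLE le_top).op).hom

lemma quotU_app_invPolySec (V : (BScheme k n r).Opens) (f : Inv k n r) :
    (quotU k n r).app V (invPolySec V f) = polySec (quotU k n r ⁻¹ᵁ V) (f : Coord k n r) := by
  have globalHom_comp_quotU :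
      globalHom (R := .of (Inv k n r)) (BOpens k n r).ι ≫ (quotU k n r).appTop =
        CommRingCat.ofHom (Inv k n r).val.toRingHom ≫
          globalHom (R := .of (Coord k n r)) (UOpens k n r).ι := by
    rw [← globalHom_comp, ← globalHom_comp_specMap, quotU_ι]
    rfl
  change (quotU k n r).app V ((BScheme k n r).presheaf.map _ _) = _
  rw [app_map_apply]
  exact congrArg _ (ConcreteCategory.congr_hom globalHom_comp_quotU f)

lemma isEquivariant_polySec (V : (BScheme k n r).Opens) (j : Fin r) :
    IsEquivariant (Equiv.Perm (Fin n))
      fun i ↦ polySec (quotU k n r ⁻¹ᵁ V) (MvPolynomial.X (j, i)) := by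
  intro σ i
  refine (actU_appLE_map k n r σ (le_top : V ≤ ⊤) (coordU k n r j i)).trans (congrArg _ ?_)
  exact (ConcreteCategory.congr_hom (Scheme.Hom.appLE_eq_app (actU k n r σ)) _).trans
    (actU_coordU k n r σ j i)

lemma span_polySec_eq_top {W : (U k n r).Opens} (hW : IsAffineOpen W) {i i' : Fin n}
    (h : i ≠ i') : Ideal.span (Set.range fun j : Fin r ↦ polySec W (MvPolynomial.X (j, i)) -
      polySec W (MvPolynomial.X (j, i'))) = ⊤ := by
  rw [← hW.self_le_iSup_basicOpen_iff]
  intro p hp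
  obtain ⟨l, hl⟩ := mem_UOpens.1 p.2 i i' h
  refine Opens.mem_iSup.2 ⟨⟨_, l, rfl⟩, ?_⟩
  change p ∈ (U k n r).basicOpen (polySec W _ - polySec W _)
  rw [← map_sub]
  change p ∈ (U k n r).basicOpen ((U k n r).presheaf.map _ _)
  rw [Scheme.basicOpen_res]
  exact ⟨hp, (notMem_asIdeal_iff (R := .of (Coord k n r)) (UOpens k n r).ι p _).1 hl⟩

/-- The symmetric group acts freely on the preimage in `U(r; 𝔸ⁿ)` of an affine open subset. -/
lemma sepFamily_toAlgHom_quotU {V : (BScheme k n r).Opens} (hV : IsAffineOpen V) :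
    SepFamily (MulSemiringAction.toAlgHom Γ(BScheme k n r, V) Γ(U k n r, quotU k n r ⁻¹ᵁ V) :
      Equiv.Perm (Fin n) → _) :=
  sepFamily_toAlgHom _ _ (isEquivariant_polySec V)
    fun _ _ h ↦ span_polySec_eq_top (isAffineOpen_quotU_preimage hV) h

end Torsor

/-! ### Morphisms to `B(r; 𝔸ⁿ)` -/

section Points

variable {k : Type u} [CommRing k] {n r : ℕ}

lemma comap_evalPt_mem_UOpens {L : Type*} [CommRing L] (κ : k →+* L) {α : Fin r → Fin n → L}
    (hα : ∀ i i', i ≠ i' → Ideal.span (Set.range fun j ↦ α j i - α j i') = ⊤)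
    (q : PrimeSpectrum L) : PrimeSpectrum.comap (evalPt κ α) q ∈ UOpens k n r := by
  refine mem_UOpens.2 fun i i' hi ↦ ?_
  by_contra! mem_asIdeal
  refine q.isPrime.ne_top (top_le_iff.1 ?_)
  rw [← hα i i' hi, Ideal.span_le]
  rintro _ ⟨j, rfl⟩
  simpa using mem_asIdeal j

lemma comap_valueHom_mem_BOpens {R A : Type u} [CommRing R] [CommRing A] [Algebra R A]
    [Algebra.Etale R A] (e : Module.Basis (Fin n) R A) (κ : k →+* R) {a : Fin r → A}
    (ha : Algebra.adjoin R (Set.range a) = ⊤) (p : PrimeSpectrum R) :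
    PrimeSpectrum.comap (valueHom e κ a) p ∈ BOpens k n r := by
  obtain ⟨L, _, _, _, s, hs⟩ := exists_sepFamily e
  obtain ⟨q, rfl⟩ := PrimeSpectrum.comap_surjective_of_faithfullyFlat (A := R) (B := L) p
  refine ⟨_, comap_evalPt_mem_UOpens ((algebraMap R L).comp κ)
    ((sepFamily_iff_of_adjoin ha s).1 hs) q, PrimeSpectrum.ext (SetLike.ext fun f ↦ ?_)⟩
  change evalPt _ _ (f : Coord k n r) ∈ q.asIdeal ↔
    algebraMap R L (valueHom e κ a f) ∈ q.asIdeal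
  rw [valueHom_isValue e κ a f L s hs]

end Points

section MapsToB

variable {k : Type u} [CommRing k] {n r : ℕ} {Y Z : Scheme.{u}}

/-- The functions obtained by pulling back invariant polynomials along a morphism to
`B(r; 𝔸ⁿ)`. -/
def pullInv (φ : Y ⟶ BScheme k n r) : Inv k n r →+* Γ(Y, ⊤) :=
  (globalHom (R := .of (Inv k n r)) (φ ≫ (BOpens k n r).ι)).hom

lemma pullInv_injective : Function.Injective (pullInv : (Y ⟶ BScheme k n r) → _) := by
  intro φ ψ h
  rw [← cancel_mono (BOpens k n r).ι]
  exact globalHom_injective (CommRingCat.hom_ext h)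

lemma pullInv_comp (g : Z ⟶ Y) (φ : Y ⟶ BScheme k n r) (f : Inv k n r) :
    pullInv (g ≫ φ) f = g.appTop (pullInv φ f) := by
  rw [pullInv, Category.assoc, globalHom_comp]
  rfl

lemma appLE_invPolySec (φ : Y ⟶ BScheme k n r) (V : (BScheme k n r).Opens) (W : Y.Opens)
    (e : W ≤ φ ⁻¹ᵁ V) (f : Inv k n r) :
    φ.appLE V W e (invPolySec V f) = Y.presheaf.map (homOfLE le_top).op (pullInv φ f) := by
  change φ.appLE V W e ((BScheme k n r).presheaf.map (homOfLE le_top).op _) = _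
  rw [map_appLE_apply, pullInv, globalHom_comp]
  rfl

lemma exists_pullInv_eq (ρ : Inv k n r →+* Γ(Y, ⊤))
    (h : ∀ y, specHom (R := .of (Inv k n r)) (CommRingCat.ofHom ρ) y ∈ BOpens k n r) :
    ∃ φ : Y ⟶ BScheme k n r, pullInv φ = ρ := by
  have range_subset : Set.range (specHom (R := .of (Inv k n r)) (CommRingCat.ofHom ρ)) ⊆
      Set.range (BOpens k n r).ι := by
    rw [Scheme.Opens.range_ι]
    rintro _ ⟨y, rfl⟩
    exact h y
  refine ⟨IsOpenImmersion.lift (BOpens k n r).ι _ range_subset, ?_⟩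
  rw [pullInv, IsOpenImmersion.lift_fac, globalHom_specHom]
  rfl

lemma mem_BOpens_of_valueHom (f : Y ⟶ QuotR k n r) {y : Y} {O : Y.Opens} (hy : y ∈ O)
    {C D : Type u} [CommRing C] [CommRing D] [Algebra C D] [Algebra.Etale C D]
    (e : Module.Basis (Fin n) C D) (κ : k →+* C) {b : Fin r → D}
    (hb : Algebra.adjoin C (Set.range b) = ⊤) (g : C →+* Γ(Y, O))
    (hf : ∀ q, Y.presheaf.map (homOfLE le_top).op
      (globalHom (R := .of (Inv k n r)) f q) = g (valueHom e κ b q)) : f y ∈ BOpens k n r := by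
  let p : PrimeSpectrum C := PrimeSpectrum.comap ((Y.presheaf.germ O y hy).hom.comp g)
    (IsLocalRing.closedPoint (Y.presheaf.stalk y))
  suffices f y = PrimeSpectrum.comap (valueHom e κ b) p from
    this ▸ comap_valueHom_mem_BOpens e κ hb p
  refine PrimeSpectrum.ext (SetLike.ext fun q ↦ not_iff_not.1 ?_)
  rw [notMem_asIdeal_iff (R := .of (Inv k n r)) f y q, Scheme.mem_basicOpen_top]
  change _ ↔ Y.presheaf.germ O y hy (g (valueHom e κ b q)) ∉ IsLocalRing.maximalIdeal _
  rw [← hf, TopCat.Presheaf.germ_res_apply', IsLocalRing.mem_maximalIdeal, mem_nonunits_iff,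
    not_not]

lemma exists_ringHom_gluing {R : Type*} [CommRing R] {I : Type u} (W : I → Y.Opens)
    (hW : ∀ y, ∃ i, y ∈ W i) (v : ∀ i, R →+* Γ(Y, W i))
    (hv : ∀ i j, ∀ y ∈ W i, y ∈ W j → ∃ (O : Y.Opens) (hi : O ≤ W i) (hj : O ≤ W j), y ∈ O ∧
      ∀ f, Y.presheaf.map (homOfLE hi).op (v i f) = Y.presheaf.map (homOfLE hj).op (v j f)) :
    ∃ ρ : R →+* Γ(Y, ⊤), ∀ i f, Y.presheaf.map (homOfLE le_top).op (ρ f) = v i f := by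
  have exists_glued (f : R) :
      ∃ s : Γ(Y, ⊤), ∀ i, Y.presheaf.map (homOfLE le_top).op s = v i f := by
    refine exists_section W (fun _ ↦ le_top) (fun y _ ↦ Opens.mem_iSup.2 (hW y)) (fun i ↦ v i f)
      fun i j ↦ section_ext fun y hy ↦ ?_
    obtain ⟨O, hi, hj, hyO, hO⟩ := hv i j y hy.1 hy.2
    exact ⟨O, le_inf hi hj, hyO,
      (map_map_apply _ _ _).trans ((hO f).trans (map_map_apply _ _ _).symm)⟩
  choose ρ hρ using exists_glued
  have ext_of_cover (s t : Γ(Y, ⊤)) (h : ∀ i, Y.presheaf.map (homOfLE (le_top : W i ≤ ⊤)).op s =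
      Y.presheaf.map (homOfLE le_top).op t) : s = t := section_ext fun y _ ↦ by
    obtain ⟨i, hi⟩ := hW y
    exact ⟨W i, le_top, hi, h i⟩
  exact ⟨
    { toFun := ρ
      map_one' := ext_of_cover _ _ fun i ↦ by rw [hρ, map_one, map_one]
      map_zero' := ext_of_cover _ _ fun i ↦ by rw [hρ, map_zero, map_zero]
      map_mul' := fun f g ↦ ext_of_cover _ _ fun i ↦ by rw [hρ, map_mul, map_mul, hρ, hρ]
      map_add' := fun f g ↦ ext_of_cover _ _ fun i ↦ by rw [hρ, map_add, map_add, hρ, hρ] },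
    fun i f ↦ hρ f i⟩

end MapsToB

section OverB

variable {k : Type u} [CommRing k] {n r : ℕ} {X : Over (Spec (.of k))}

/-- The structure homomorphism from the base ring to the sections over an open subset. -/
def baseSec (X : Over (Spec (.of k))) (W : X.left.Opens) : k →+* Γ(X.left, W) :=
  (globalHom (R := .of k) X.hom ≫ X.left.presheaf.map (homOfLE le_top).op).hom

lemma baseSec_map {W W' : X.left.Opens} (h : W' ≤ W) (c : k) :
    X.left.presheaf.map (homOfLE h).op (baseSec X W c) = baseSec X W' c :=
  map_map_apply _ _ _

lemma baseSec_top (c : k) : baseSec X ⊤ c = globalHom (R := .of k) X.hom c :=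
  ConcreteCategory.congr_hom (X.left.presheaf.map_id (op ⊤)) _

lemma pullInv_algebraMap (φ : X ⟶ B k n r) (c : k) :
    pullInv φ.left (algebraMap k (Inv k n r) c) = baseSec X ⊤ c := by
  have comp_hom_eq : ((show X.left ⟶ BScheme k n r from φ.left) ≫ (BOpens k n r).ι) ≫
      Spec.map (CommRingCat.ofHom (algebraMap k (Inv k n r))) = X.hom :=
    (Category.assoc _ _ _).trans (Over.w φ)
  rw [baseSec_top, ← comp_hom_eq, globalHom_comp_specMap]
  rfl

lemma exists_over_hom (ρ : Inv k n r →+* Γ(X.left, ⊤))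
    (h : ∀ y, specHom (R := .of (Inv k n r)) (CommRingCat.ofHom ρ) y ∈ BOpens k n r)
    (hk : ∀ c, ρ (algebraMap k (Inv k n r) c) = baseSec X ⊤ c) :
    ∃ φ : X ⟶ B k n r, pullInv φ.left = ρ := by
  obtain ⟨φ, hφ⟩ := exists_pullInv_eq ρ h
  refine ⟨Over.homMk φ ?_, hφ⟩
  change φ ≫ (BOpens k n r).ι ≫ Spec.map _ = _
  refine globalHom_injective (R := .of k) ?_
  rw [← Category.assoc, globalHom_comp_specMap]
  refine CommRingCat.hom_ext (RingHom.ext fun c ↦ ?_)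
  change pullInv φ (algebraMap k (Inv k n r) c) = _
  rw [hφ, hk, baseSec_top]

lemma over_hom_ext {φ ψ : X ⟶ B k n r} (h : pullInv φ.left = pullInv ψ.left) : φ = ψ :=
  Over.OverMorphism.ext (pullInv_injective h)

lemma exists_over_hom_of_valueHom {I : Type u} (W : I → X.left.Opens) (hW : ∀ y, ∃ i, y ∈ W i)
    (C D : I → Type u) [∀ i, CommRing (C i)] [∀ i, CommRing (D i)] [∀ i, Algebra (C i) (D i)]
    [∀ i, Algebra.Etale (C i) (D i)] (e : ∀ i, Module.Basis (Fin n) (C i) (D i))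
    (κ : ∀ i, k →+* C i) (b : ∀ i, Fin r → D i)
    (hb : ∀ i, Algebra.adjoin (C i) (Set.range (b i)) = ⊤) (g : ∀ i, C i →+* Γ(X.left, W i))
    (hk : ∀ i c, g i (κ i c) = baseSec X (W i) c)
    (hv : ∀ i j, ∀ y ∈ W i, y ∈ W j →
      ∃ (O : X.left.Opens) (hi : O ≤ W i) (hj : O ≤ W j), y ∈ O ∧ ∀ f : Inv k n r,
        X.left.presheaf.map (homOfLE hi).op (g i (valueHom (e i) (κ i) (b i) f)) =
          X.left.presheaf.map (homOfLE hj).op (g j (valueHom (e j) (κ j) (b j) f))) :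
    ∃ φ : X ⟶ B k n r, ∀ i f, X.left.presheaf.map (homOfLE le_top).op (pullInv φ.left f) =
      g i (valueHom (e i) (κ i) (b i) f) := by
  obtain ⟨ρ, hρ⟩ := exists_ringHom_gluing W hW
    (fun i ↦ (g i).comp (valueHom (e i) (κ i) (b i))) hv
  have mem_BOpens (y : X.left) :
      specHom (R := .of (Inv k n r)) (CommRingCat.ofHom ρ) y ∈ BOpens k n r := by
    obtain ⟨i, hi⟩ := hW y
    refine mem_BOpens_of_valueHom _ hi (e i) (κ i) (hb i) (g i) fun q ↦ ?_
    rw [globalHom_specHom]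
    exact hρ i q
  have ρ_algebraMap (c : k) : ρ (algebraMap k (Inv k n r) c) = baseSec X ⊤ c :=
    section_ext fun y _ ↦ by
      obtain ⟨i, hi⟩ := hW y
      refine ⟨W i, le_top, hi, ?_⟩
      rw [hρ, baseSec_map, ← hk]
      refine congrArg (g i) (IsValue.unique (e i) (valueHom_isValue (e i) (κ i) (b i) _)
        fun L _ _ s _ ↦ ?_)
      exact (evalPt_C ((algebraMap (C i) L).comp (κ i)) _ c).symm
  obtain ⟨φ, rfl⟩ := exists_over_hom ρ mem_BOpens ρ_algebraMap
  exact ⟨φ, hρ⟩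

end OverB

/-! ### Local structure of étale algebras -/

namespace AlgSheaf

variable {X : Scheme.{u}} {A A' : AlgSheaf X}

lemma res_self {U : X.Opens} (s : A.sec U) : A.res le_rfl s = s :=
  ConcreteCategory.congr_hom (A.sheaf.obj.map_id (op U)) s

lemma res_res {U V W : X.Opens} (h : V ≤ U) (h' : W ≤ V) (s : A.sec U) :
    A.res h' (A.res h s) = A.res (h'.trans h) s := by
  rw [res, res, ← CommRingCat.comp_apply, ← Functor.map_comp]
  rfl

lemma res_algebraMap {U V : X.Opens} (h : V ≤ U) (c : Γ(X, U)) :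
    A.res h (algebraMap Γ(X, U) (A.sec U) c) =
      algebraMap Γ(X, V) (A.sec V) (X.presheaf.map (homOfLE h).op c) :=
  (ConcreteCategory.congr_hom (A.unit.hom.naturality (homOfLE h).op) c).symm

lemma res_smul {U V : X.Opens} (h : V ≤ U) (c : Γ(X, U)) (s : A.sec U) :
    A.res h (c • s) = X.presheaf.map (homOfLE h).op c • A.res h s := by
  rw [Algebra.smul_def, Algebra.smul_def, map_mul, res_algebraMap]

lemma hom_app_res (β : A.sheaf ⟶ A'.sheaf) {U V : X.Opens} (h : V ≤ U) (s : A.sec U) :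
    β.hom.app (op V) (A.res h s) = A'.res h (β.hom.app (op U) s) :=
  ConcreteCategory.congr_hom (β.hom.naturality (homOfLE h).op) s

lemma hom_app_algebraMap {β : A.sheaf ⟶ A'.sheaf} (hβ : A.unit ≫ β = A'.unit) (U : X.Opens)
    (c : Γ(X, U)) :
    β.hom.app (op U) (algebraMap Γ(X, U) (A.sec U) c) = algebraMap Γ(X, U) (A'.sec U) c :=
  congrArg (fun f : X.sheaf ⟶ A'.sheaf ↦ f.hom.app (op U) c) hβ

lemma inv_app_hom_app (α : A.sheaf ≅ A'.sheaf) (U : X.Opens) (s : A.sec U) :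
    α.inv.hom.app (op U) (α.hom.hom.app (op U) s) = s :=
  congrArg (fun f : A.sheaf ⟶ A.sheaf ↦ f.hom.app (op U) s) α.hom_inv_id

lemma sec_ext {U : X.Opens} {s t : A.sec U}
    (h : ∀ x ∈ U, ∃ (V : X.Opens) (hV : V ≤ U), x ∈ V ∧ A.res hV s = A.res hV t) : s = t := by
  choose V hV hx hst using h
  exact A.sheaf.eq_of_locally_eq' (fun x : U ↦ V x.1 x.2) U (fun x ↦ homOfLE (hV _ _))
    (fun x hxU ↦ Opens.mem_iSup.2 ⟨⟨x, hxU⟩, hx _ _⟩) s t fun x ↦ hst _ _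

variable (A) in
/-- An affine open over which the algebra is free of rank `n`. -/
structure IsTrivializing (n : ℕ) (W : X.Opens) : Prop where
  isAffineOpen : IsAffineOpen W
  exists_basis : ∃ e : Fin n → A.sec W, ∀ (W' : X.Opens) (h : W' ≤ W),
    Function.Bijective fun c : Fin n → Γ(X, W') ↦ ∑ i, c i • A.res h (e i)

variable {n : ℕ}

lemma IsTrivializing.of_le {W W' : X.Opens} (hW : A.IsTrivializing n W) (h : W' ≤ W)
    (hW' : IsAffineOpen W') : A.IsTrivializing n W' := by
  obtain ⟨e, he⟩ := hW.exists_basis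
  refine ⟨hW', fun i ↦ A.res h (e i), fun W'' h' ↦ ?_⟩
  simpa only [res_res] using he W'' (h'.trans h)

lemma IsEtaleOfDegree.exists_isTrivializing (hA : A.IsEtaleOfDegree n) {x : X} {O : X.Opens}
    (hx : x ∈ O) : ∃ W, A.IsTrivializing n W ∧ x ∈ W ∧ W ≤ O := by
  obtain ⟨V, e, hxV, he⟩ := hA.locallyFree x
  obtain ⟨W, hW, hxW, hWV : W ≤ V ⊓ O⟩ :=
    exists_isAffineOpen_mem_and_subset (show x ∈ V ⊓ O from ⟨hxV, hx⟩)
  refine ⟨W, ⟨hW, fun i ↦ A.res (hWV.trans inf_le_left) (e i), fun W' h ↦ ?_⟩, hxW,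
    hWV.trans inf_le_right⟩
  simpa only [res_res] using he W' (h.trans (hWV.trans inf_le_left))

/-- A basis of the sections over a trivializing open. -/
def IsTrivializing.basis {W : X.Opens} (hW : A.IsTrivializing n W) :
    Module.Basis (Fin n) Γ(X, W) (A.sec W) :=
  .ofEquivFun (LinearEquiv.ofBijective
    (Fintype.linearCombination Γ(X, W) hW.exists_basis.choose) (by
    have bijective := hW.exists_basis.choose_spec W le_rfl
    simp only [res_self] at bijective
    exact bijective)).symm

lemma IsTrivializing.adjoin_range_res {W W' : X.Opens} (hW : A.IsTrivializing n W) (h : W' ≤ W) :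
    Algebra.adjoin Γ(X, W') (Set.range (A.res h).hom) = ⊤ := by
  obtain ⟨e, he⟩ := hW.exists_basis
  rw [eq_top_iff]
  rintro s -
  obtain ⟨c, rfl⟩ := (he W' h).2 s
  exact sum_mem fun i _ ↦ Subalgebra.smul_mem _ (Algebra.subset_adjoin (Set.mem_range_self (e i))) _

end AlgSheaf

/-! ### Morphisms computing the multisymmetric functions of a tuple of sections -/

open AlgSheaf

section Computes

variable {k : Type u} [CommRing k] {n r : ℕ} {X Y : Over (Spec (.of k))}

lemma appLE_baseSec (φ : X ⟶ Y) {V : Y.left.Opens} {W : X.left.Opens} (e : W ≤ φ.left ⁻¹ᵁ V)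
    (c : k) : φ.left.appLE V W e (baseSec Y V c) = baseSec X W c := by
  change φ.left.appLE V W e (Y.left.presheaf.map (homOfLE le_top).op _) =
    X.left.presheaf.map _ (globalHom (R := .of k) X.hom c)
  rw [map_appLE_apply, ← Over.w φ, globalHom_comp]
  rfl

variable {A A' : AlgSheaf X.left}

lemma IsValue.res {W W' : X.left.Opens} (hW : A.IsTrivializing n W) (h : W' ≤ W)
    {a : Fin r → A.sec W} {f : Inv k n r} {x : Γ(X.left, W)}
    (hx : IsValue (baseSec X W) a f x) :
    IsValue (baseSec X W') (fun j ↦ A.res h (a j)) f (X.left.presheaf.map (homOfLE h).op x) := by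
  have comp_baseSec : (X.left.presheaf.map (homOfLE h).op).hom.comp (baseSec X W) = baseSec X W' :=
    RingHom.ext (baseSec_map h)
  rw [← comp_baseSec]
  exact hx.map (X.left.presheaf.map (homOfLE h).op).hom (A.res h).hom (res_algebraMap h)
    (hW.adjoin_range_res h)

lemma AlgSheaf.IsEtaleOfDegree.isValue_of_local (hA : A.IsEtaleOfDegree n)
    {W : X.left.Opens} (hW : A.IsTrivializing n W) {a : Fin r → A.sec W}
    {f : Inv k n r} {x : Γ(X.left, W)}
    (h : ∀ y ∈ W, ∃ (W' : X.left.Opens) (hW' : W' ≤ W), y ∈ W' ∧ A.IsTrivializing n W' ∧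
      IsValue (baseSec X W') (fun j ↦ A.res hW' (a j)) f
        (X.left.presheaf.map (homOfLE hW').op x)) :
    IsValue (baseSec X W) a f x := by
  have := hA.etale W hW.isAffineOpen
  obtain ⟨x', hx'⟩ := exists_isValue hW.basis (baseSec X W) a f
  suffices x = x' by rwa [this]
  refine section_ext fun y hy ↦ ?_
  obtain ⟨W', hW', hyW', trivializing, hval⟩ := h y hy
  have := hA.etale W' trivializing.isAffineOpen
  exact ⟨W', hW', hyW', hval.unique trivializing.basis (hx'.res hW hW')⟩

/-- The pullbacks of invariant polynomials along `φ` are the values of these polynomials at the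
tuple `a`. Once `a` generates `𝒜`, this is equivalent to `φ` classifying `(𝒜, a)`. -/
def Computes (φ : X ⟶ B k n r) (A : AlgSheaf X.left) (a : Fin r → A.sec ⊤) : Prop :=
  ∀ W, A.IsTrivializing n W → ∀ f : Inv k n r,
    IsValue (baseSec X W) (fun j ↦ A.res (le_top : W ≤ ⊤) (a j)) f
      (X.left.presheaf.map (homOfLE le_top).op (pullInv φ.left f))

lemma Computes.eq (hA : A.IsEtaleOfDegree n) {φ ψ : X ⟶ B k n r} {a : Fin r → A.sec ⊤}
    (hφ : Computes φ A a) (hψ : Computes ψ A a) : φ = ψ := by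
  refine over_hom_ext (RingHom.ext fun f ↦ section_ext fun y hy ↦ ?_)
  obtain ⟨W, hW, hyW, -⟩ := hA.exists_isTrivializing hy
  have := hA.etale W hW.isAffineOpen
  exact ⟨W, le_top, hyW, (hφ W hW f).unique hW.basis (hψ W hW f)⟩

lemma map_valueHom_eq_of_isTrivializing (hA : A.IsEtaleOfDegree n) {W W' O : X.left.Opens}
    (hW : A.IsTrivializing n W) (hW' : A.IsTrivializing n W') (hO : A.IsTrivializing n O)
    (h : O ≤ W) (h' : O ≤ W') [Algebra.Etale Γ(X.left, W) (A.sec W)]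
    [Algebra.Etale Γ(X.left, W') (A.sec W')] (a : Fin r → A.sec ⊤) (f : Inv k n r) :
    X.left.presheaf.map (homOfLE h).op
        (valueHom hW.basis (baseSec X W) (fun j ↦ A.res le_top (a j)) f) =
      X.left.presheaf.map (homOfLE h').op
        (valueHom hW'.basis (baseSec X W') (fun j ↦ A.res le_top (a j)) f) := by
  have := hA.etale O hO.isAffineOpen
  have value := (valueHom_isValue hW.basis (baseSec X W) (fun j ↦ A.res le_top (a j)) f).res hW h
  have value' :=
    (valueHom_isValue hW'.basis (baseSec X W') (fun j ↦ A.res le_top (a j)) f).res hW' h'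
  simp only [res_res] at value value'
  exact value.unique hO.basis value'

lemma exists_computes (hA : A.IsEtaleOfDegree n) {a : Fin r → A.sec ⊤} (ha : A.Generates a) :
    ∃ φ : X ⟶ B k n r, Computes φ A a := by
  let I := {W : X.left.Opens // A.IsTrivializing n W}
  have etale (i : I) : Algebra.Etale Γ(X.left, i.1) (A.sec i.1) := hA.etale i.1 i.2.isAffineOpen
  have cover (y : X.left) : ∃ i : I, y ∈ i.1 := by
    obtain ⟨W, hW, hyW, -⟩ := hA.exists_isTrivializing (Opens.mem_top y)
    exact ⟨⟨W, hW⟩, hyW⟩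
  obtain ⟨φ, hφ⟩ := exists_over_hom_of_valueHom (X := X) (I := I) (fun i ↦ i.1) cover
    (fun i ↦ Γ(X.left, i.1)) (fun i ↦ A.sec i.1) (fun i ↦ i.2.basis) (fun i ↦ baseSec X i.1)
    (fun i j ↦ A.res le_top (a j)) (fun i ↦ ha _ i.2.isAffineOpen) (fun i ↦ RingHom.id _)
    (fun i c ↦ rfl) (fun i j y hi hj ↦ by
      obtain ⟨W, hW, hyW, hWO⟩ := hA.exists_isTrivializing (O := i.1 ⊓ j.1) ⟨hi, hj⟩
      exact ⟨W, hWO.trans inf_le_left, hWO.trans inf_le_right, hyW,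
        map_valueHom_eq_of_isTrivializing hA i.2 j.2 hW _ _ a⟩)
  refine ⟨φ, fun W hW f ↦ ?_⟩
  have := hA.etale W hW.isAffineOpen
  rw [hφ ⟨W, hW⟩]
  exact valueHom_isValue hW.basis _ _ f

lemma Computes.of_isIsomorphic (hA : A.IsEtaleOfDegree n) (hA' : A'.IsEtaleOfDegree n)
    {α : A.sheaf ≅ A'.sheaf} (hα : A.unit ≫ α.hom = A'.unit) {φ : X ⟶ B k n r}
    {a' : Fin r → A'.sec ⊤} (hφ : Computes φ A' a') :
    Computes φ A fun j ↦ α.inv.hom.app (op ⊤) (a' j) := by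
  intro W hW f
  refine hA.isValue_of_local hW fun y hy ↦ ?_
  obtain ⟨W', hW', hyW', hle⟩ := hA'.exists_isTrivializing hy
  refine ⟨W', hle, hyW', hW.of_le hle hW'.isAffineOpen, ?_⟩
  have value := (hφ W' hW' f).map (RingHom.id _) (α.inv.hom.app (op W')).hom
    (hom_app_algebraMap ((Iso.comp_inv_eq α).2 hα.symm) W') <| eq_top_iff.2 fun z _ ↦
      Algebra.subset_adjoin ⟨α.hom.hom.app (op W') z, inv_app_hom_app α W' z⟩
  rw [map_map_apply]
  simp only [res_res]
  convert! value using 2 with j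
  exact (hom_app_res α.inv le_top (a' j)).symm

end Computes

/-! ### Stabilization -/

section Padding

variable {A A' F : Type*} [Zero A] [Zero A'] [FunLike F A A'] [ZeroHomClass F A A'] {r : ℕ}

/-- The tuple of length `R` obtained by putting zeros at the end. -/
def padTuple (R : ℕ) (a : Fin r → A) : Fin R → A :=
  fun j ↦ if h : j.1 < r then a ⟨j, h⟩ else 0

lemma map_padTuple (R : ℕ) (a : Fin r → A) (f : F) (j : Fin R) :
    f (padTuple R a j) = padTuple R (fun j ↦ f (a j)) j := by
  unfold padTuple
  split_ifs <;> simp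

end Padding

section Stab

variable {k : Type u} [CommRing k] {n r R : ℕ}

lemma evalPt_padHom {L : Type*} [CommRing L] (κ : k →+* L) (α : Fin r → Fin n → L)
    (p : Coord k n R) : evalPt κ α (padHom k n r R p) = evalPt κ (padTuple R α) p := by
  have comp_padHom : (evalPt κ α).comp (padHom k n r R).toRingHom = evalPt κ (padTuple R α) := by
    refine coord_ringHom_ext (fun c ↦ ?_) fun j i ↦ ?_
    · simp [padHom, MvPolynomial.algebraMap_eq]
    · simp only [AlgHom.toRingHom_eq_coe, RingHom.coe_comp, RingHom.coe_coe, padHom,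
        Function.comp_apply, MvPolynomial.aeval_X, evalPt_X, padTuple]
      split_ifs <;> simp
  exact RingHom.congr_fun comp_padHom p

variable {X : Over (Spec (.of k))}

lemma pullInv_eq_padInv {Y : Scheme.{u}} {ψ : Y ⟶ BScheme k n R} {φ : Y ⟶ BScheme k n r}
    (h : ψ ≫ (BOpens k n R).ι = (φ ≫ (BOpens k n r).ι) ≫ stabQuot k n r R) (f : Inv k n R) :
    pullInv ψ f = pullInv φ (padInv k n r R f) := by
  change globalHom (R := .of (Inv k n R)) (ψ ≫ (BOpens k n R).ι) f = _
  rw [h, stabQuot, globalHom_comp_specMap]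
  rfl

lemma pullInv_comp_stab (h : r ≤ R) (φ : X ⟶ B k n r) (f : Inv k n R) :
    pullInv (φ ≫ stab k n h).left f = pullInv φ.left (padInv k n r R f) := by
  let stabScheme : BScheme k n r ⟶ BScheme k n R :=
    (stabQuot k n r R).resLE (BOpens k n R) (BOpens k n r) (BOpens_le_stabQuot k n h)
  have stabScheme_ι : stabScheme ≫ (BOpens k n R).ι = (BOpens k n r).ι ≫ stabQuot k n r R :=
    Scheme.Hom.resLE_comp_ι _ _
  have comp_stabScheme_ι (ψ : X.left ⟶ BScheme k n r) : (ψ ≫ stabScheme) ≫ (BOpens k n R).ι =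
      (ψ ≫ (BOpens k n r).ι) ≫ stabQuot k n r R := by
    rw [Category.assoc, stabScheme_ι, Category.assoc]
  exact pullInv_eq_padInv (comp_stabScheme_ι φ.left) f

lemma Computes.comp_stab {A : AlgSheaf X.left} (h : r ≤ R) {φ : X ⟶ B k n r}
    {a : Fin r → A.sec ⊤} (hφ : Computes φ A a) :
    Computes (φ ≫ stab k n h) A (padTuple R a) := by
  intro W hW f L _ _ s hs
  refine (congrArg (fun y ↦ algebraMap _ L (X.left.presheaf.map _ y))
    (pullInv_comp_stab h φ f)).trans ?_
  rw [hφ W hW _ L s hs]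
  refine (evalPt_padHom _ _ (f : Coord k n R)).trans ?_
  congr 2 with j i
  simp only [padTuple]
  split_ifs <;> simp

end Stab

/-! ### Homotopies along paths of generating tuples -/

section PolynomialAlgebra

open Polynomial

attribute [local instance] Polynomial.algebra

lemma etale_polynomial {R A : Type u} [CommRing R] [CommRing A] [Algebra R A] [Algebra.Etale R A] :
    Algebra.Etale R[X] A[X] :=
  Algebra.Etale.of_equiv (Algebra.IsPushout.equiv R R[X] A A[X])

variable {R A : Type*} [CommRing R] [CommRing A] [Algebra R A]

/-- The basis of the polynomial ring over an algebra induced by a basis of the algebra. -/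
def polynomialBasis {ι : Type*} (e : Module.Basis ι R A) : Module.Basis ι R[X] A[X] :=
  (e.baseChange R[X]).map (Algebra.IsPushout.equiv R R[X] A A[X]).toLinearEquiv

lemma X_mem_subalgebra (Q : Subalgebra R[X] A[X]) : (X : A[X]) ∈ Q := by
  simpa [algebraMap_def] using Q.algebraMap_mem X

lemma polynomial_subalgebra_eq_top {κ : Type*} {a : κ → A}
    (ha : Algebra.adjoin R (Set.range a) = ⊤) {Q : Subalgebra R[X] A[X]}
    (hQ : ∀ j, C (a j) ∈ Q) : Q = ⊤ := by
  have C_mem (s : A) : C s ∈ Q := by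
    have hs : s ∈ Algebra.adjoin R (Set.range a) := ha ▸ Algebra.mem_top
    induction hs using Algebra.adjoin_induction with
    | mem s hs =>
      obtain ⟨j, rfl⟩ := hs
      exact hQ j
    | algebraMap c => simpa [algebraMap_def] using Q.algebraMap_mem (C c)
    | add s t _ _ hs ht => exact C_add (R := A) ▸ add_mem hs ht
    | mul s t _ _ hs ht => exact C_mul (R := A) ▸ mul_mem hs ht
  refine eq_top_iff.2 fun P _ ↦ ?_
  rw [P.as_sum_range_C_mul_X_pow]
  exact sum_mem fun m _ ↦ mul_mem (C_mem _) (pow_mem (X_mem_subalgebra Q) m)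

/-- The tuple `x + t (y - x)` over the polynomial ring in `t`. -/
def pathTuple {r : ℕ} (x y : Fin r → A) : Fin r → A[X] :=
  fun j ↦ C (x j) + X * C (y j - x j)

lemma map_pathTuple {A' : Type*} [CommRing A'] (h : A →+* A') {r : ℕ} (x y : Fin r → A)
    (j : Fin r) : (pathTuple x y j).map h = pathTuple (fun j ↦ h (x j)) (fun j ↦ h (y j)) j := by
  simp [pathTuple]

lemma eval_pathTuple {r : ℕ} (x y : Fin r → A) (j : Fin r) (c : A) :
    (pathTuple x y j).eval c = x j + c * (y j - x j) := by
  simp [pathTuple]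

end PolynomialAlgebra

section Path

open Polynomial

attribute [local instance] Polynomial.algebra

variable {k : Type u} [CommRing k] {n r : ℕ} {X : Over (Spec (.of k))}

/-- The coordinate function on `X × 𝔸¹`. -/
def coordA1 (X : Over (Spec (.of k))) : Γ((timesA1 X).left, ⊤) :=
  AffineSpace.coord X.left PUnit.unit

lemma sectionA1_projA1 (c : Γ(X.left, ⊤)) : sectionA1 X c ≫ projA1 X = 𝟙 X :=
  Over.OverMorphism.ext (AffineSpace.homOfVector_over (𝟙 X.left) fun _ : PUnit.{u + 1} ↦ c)

lemma sectionA1_left_projA1_left (c : Γ(X.left, ⊤)) :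
    (sectionA1 X c).left ≫ (projA1 X).left = 𝟙 X.left :=
  congrArg (fun f : X ⟶ X ↦ f.left) (sectionA1_projA1 c)

lemma sectionA1_appTop_coordA1 (c : Γ(X.left, ⊤)) :
    (sectionA1 X c).left.appTop (coordA1 X) = c :=
  AffineSpace.homOfVector_appTop_coord (𝟙 X.left) (fun _ : PUnit.{u + 1} ↦ c) PUnit.unit

/-- The homomorphism turning polynomials over the ring of sections over `W` into functions on
`W × 𝔸¹`, regarded as the preimage of `W` in `X × 𝔸¹`. -/
def polyA1 (W : X.left.Opens) :
    Γ(X.left, W)[X] →+* Γ((timesA1 X).left, (projA1 X).left ⁻¹ᵁ W) :=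
  eval₂RingHom ((projA1 X).left.app W).hom
    ((timesA1 X).left.presheaf.map (homOfLE le_top).op (coordA1 X))

lemma polyA1_C_baseSec (W : X.left.Opens) (c : k) :
    polyA1 W (C (baseSec X W c)) = baseSec (timesA1 X) ((projA1 X).left ⁻¹ᵁ W) c := by
  have app_baseSec := appLE_baseSec (projA1 X) (V := W) le_rfl c
  rw [Scheme.Hom.appLE_eq_app] at app_baseSec
  exact (eval₂_C _ _).trans app_baseSec

lemma polyA1_map {W W' : X.left.Opens} (h : W' ≤ W) (P : Γ(X.left, W)[X]) :
    (timesA1 X).left.presheaf.map (homOfLE ((projA1 X).left.preimage_mono h)).op (polyA1 W P) =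
      polyA1 W' (P.map (X.left.presheaf.map (homOfLE h).op).hom) := by
  have map_comp : ((timesA1 X).left.presheaf.map
      (homOfLE ((projA1 X).left.preimage_mono h)).op).hom.comp (polyA1 W) =
        (polyA1 W').comp (mapRingHom (X.left.presheaf.map (homOfLE h).op).hom) := by
    refine Polynomial.ringHom_ext (fun c ↦ ?_) ?_
    · simp only [polyA1, RingHom.comp_apply, coe_eval₂RingHom, eval₂_C, coe_mapRingHom, map_C]
      exact (app_map_apply _ _ _).symm
    · simp only [polyA1, RingHom.comp_apply, coe_eval₂RingHom, eval₂_X, coe_mapRingHom, map_X]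
      exact map_map_apply _ _ _
  exact RingHom.congr_fun map_comp P

lemma le_sectionA1_preimage (c : Γ(X.left, ⊤)) (W : X.left.Opens) :
    W ≤ (sectionA1 X c).left ⁻¹ᵁ ((projA1 X).left ⁻¹ᵁ W) := by
  rw [← Scheme.Hom.comp_preimage, sectionA1_left_projA1_left]
  rfl

lemma sectionA1_appLE_app (c : Γ(X.left, ⊤)) (W : X.left.Opens) (x : Γ(X.left, W)) :
    (sectionA1 X c).left.appLE _ W (le_sectionA1_preimage c W) ((projA1 X).left.app W x) = x :=
  (ConcreteCategory.congr_hom (Scheme.Hom.comp_appLE (sectionA1 X c).left (projA1 X).left W W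
    (le_sectionA1_preimage c W)) x).symm.trans
      (appLE_apply_of_eq_id (sectionA1_left_projA1_left c) W _ x)

lemma sectionA1_appLE_map (c : Γ(X.left, ⊤)) (W : X.left.Opens) (s : Γ((timesA1 X).left, ⊤)) :
    (sectionA1 X c).left.appLE _ W (le_sectionA1_preimage c W)
        ((timesA1 X).left.presheaf.map (homOfLE le_top).op s) =
      X.left.presheaf.map (homOfLE le_top).op ((sectionA1 X c).left.appTop s) := by
  rw [map_appLE_apply]
  refine (appLE_map_apply (sectionA1 X c).left (U := ⊤) le_rfl le_top s).symm.trans ?_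
  rw [Scheme.Hom.appLE_eq_app]
  rfl

lemma sectionA1_appLE_polyA1 (c : Γ(X.left, ⊤)) (W : X.left.Opens) (P : Γ(X.left, W)[X]) :
    (sectionA1 X c).left.appLE _ W (le_sectionA1_preimage c W) (polyA1 W P) =
      P.eval (X.left.presheaf.map (homOfLE le_top).op c) := by
  have appLE_comp : ((sectionA1 X c).left.appLE _ W (le_sectionA1_preimage c W)).hom.comp
      (polyA1 W) = evalRingHom (X.left.presheaf.map (homOfLE le_top).op c) := by
    refine Polynomial.ringHom_ext (fun x ↦ ?_) ?_
    · simp only [polyA1, RingHom.comp_apply, coe_eval₂RingHom, eval₂_C, coe_evalRingHom, eval_C]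
      exact sectionA1_appLE_app c W x
    · simp only [polyA1, RingHom.comp_apply, coe_eval₂RingHom, eval₂_X, coe_evalRingHom, eval_X]
      exact (sectionA1_appLE_map c W (coordA1 X)).trans (by rw [sectionA1_appTop_coordA1])
  exact RingHom.congr_fun appLE_comp P

variable {A : AlgSheaf X.left} {x y : Fin r → A.sec ⊤}

variable (x y) in
/-- The path `x + t (y - x)` between two tuples of global sections, over the open subset `W`. -/
def pathSec (W : X.left.Opens) : Fin r → (A.sec W)[X] :=
  pathTuple (fun j ↦ A.res le_top (x j)) fun j ↦ A.res le_top (y j)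

lemma IsValue.map_pathSec {W W' : X.left.Opens} (hW : A.IsTrivializing n W) (h : W' ≤ W)
    {f : Inv k n r} {P : Γ(X.left, W)[X]}
    (hP : IsValue (C.comp (baseSec X W)) (pathSec x y W) f P) :
    IsValue (C.comp (baseSec X W')) (pathSec x y W') f
      (P.map (X.left.presheaf.map (homOfLE h).op).hom) := by
  have mapped := hP.map (mapRingHom (X.left.presheaf.map (homOfLE h).op).hom)
    (mapRingHom (A.res h).hom) (fun Q ↦ ?_) ?_
  · convert! mapped using 1
    · refine RingHom.ext fun c ↦ ?_
      simp only [RingHom.comp_apply, coe_mapRingHom, map_C]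
      exact congrArg C (baseSec_map h c).symm
    · refine funext fun j ↦ (Eq.trans (map_pathTuple _ _ _ j) ?_).symm
      exact congrArg₂ (fun x y ↦ pathTuple x y j) (funext fun j ↦ res_res le_top h (x j))
        (funext fun j ↦ res_res le_top h (y j))
  · rw [algebraMap_def, algebraMap_def, ← RingHom.comp_apply, ← RingHom.comp_apply,
      mapRingHom_comp, mapRingHom_comp]
    exact congrArg (fun g ↦ mapRingHom g Q) (RingHom.ext (res_algebraMap h))
  · exact polynomial_subalgebra_eq_top (hW.adjoin_range_res h) fun s ↦
      Algebra.subset_adjoin ⟨C s, map_C _⟩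

lemma IsValue.eval_pathSec {W : X.left.Opens} {f : Inv k n r} {P : Γ(X.left, W)[X]}
    (hP : IsValue (C.comp (baseSec X W)) (pathSec x y W) f P) (c : Γ(X.left, ⊤)) :
    IsValue (baseSec X W) (fun j ↦ A.res (le_top : W ≤ ⊤) (x j + c • (y j - x j))) f
      (P.eval (X.left.presheaf.map (homOfLE le_top).op c)) := by
  set c' := X.left.presheaf.map (homOfLE (le_top : W ≤ ⊤)).op c
  have evaluated := hP.map (evalRingHom c') (evalRingHom (algebraMap Γ(X.left, W) (A.sec W) c'))
    (fun Q ↦ ?_) ?_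
  · convert! evaluated using 1
    · exact RingHom.ext fun c ↦ eval_C.symm
    · refine funext fun j ↦ (Eq.trans (eval_pathTuple _ _ j _) ?_).symm
      rw [map_add, res_smul, Algebra.smul_def, map_sub]
  · rw [algebraMap_def, coe_mapRingHom, coe_evalRingHom, coe_evalRingHom,
      Polynomial.eval_map, eval₂_at_apply]
  · have surjective : Function.Surjective (evalRingHom (algebraMap Γ(X.left, W) (A.sec W) c')) :=
      fun s ↦ ⟨C s, eval_C⟩
    rw [surjective.range_eq, Algebra.adjoin_univ]

lemma exists_over_hom_of_pathSec (hA : A.IsEtaleOfDegree n)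
    (hgen : ∀ W, A.IsTrivializing n W →
      Algebra.adjoin Γ(X.left, W)[X] (Set.range (pathSec x y W)) = ⊤) :
    ∃ H : timesA1 X ⟶ B k n r, ∀ W, A.IsTrivializing n W → ∀ f : Inv k n r, ∃ P,
      IsValue (C.comp (baseSec X W)) (pathSec x y W) f P ∧
        (timesA1 X).left.presheaf.map (homOfLE le_top).op (pullInv H.left f) = polyA1 W P := by
  let I := {W : X.left.Opens // A.IsTrivializing n W}
  have etale (i : I) : Algebra.Etale Γ(X.left, i.1)[X] (A.sec i.1)[X] := by
    have := hA.etale i.1 i.2.isAffineOpen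
    exact etale_polynomial
  let value (i : I) : Inv k n r →+* Γ(X.left, i.1)[X] :=
    valueHom (polynomialBasis i.2.basis) (C.comp (baseSec X i.1)) (pathSec x y i.1)
  have isValue (i : I) (f : Inv k n r) :
      IsValue (C.comp (baseSec X i.1)) (pathSec x y i.1) f (value i f) :=
    valueHom_isValue _ _ _ f
  let p := (projA1 X).left
  have cover (z : (timesA1 X).left) : ∃ i : I, z ∈ p ⁻¹ᵁ i.1 := by
    obtain ⟨W, hW, hzW, -⟩ := hA.exists_isTrivializing (Opens.mem_top (p z))
    exact ⟨⟨W, hW⟩, hzW⟩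
  obtain ⟨H, hH⟩ := exists_over_hom_of_valueHom (X := timesA1 X) (fun i : I ↦ p ⁻¹ᵁ i.1) cover
    (fun i ↦ Γ(X.left, i.1)[X]) (fun i ↦ (A.sec i.1)[X]) (fun i ↦ polynomialBasis i.2.basis)
    (fun i ↦ C.comp (baseSec X i.1)) (fun i ↦ pathSec x y i.1) (fun i ↦ hgen _ i.2)
    (fun i ↦ polyA1 i.1) (fun i ↦ polyA1_C_baseSec i.1) (fun i j z hi hj ↦ by
      obtain ⟨W, hW, hzW, hWO⟩ := hA.exists_isTrivializing (x := p z) (O := i.1 ⊓ j.1) ⟨hi, hj⟩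
      have := etale ⟨W, hW⟩
      have hWi := hWO.trans inf_le_left
      have hWj := hWO.trans inf_le_right
      refine ⟨p ⁻¹ᵁ W, p.preimage_mono hWi, p.preimage_mono hWj, hzW, fun f ↦ ?_⟩
      rw [polyA1_map hWi, polyA1_map hWj]
      exact congrArg (polyA1 W) (((isValue i f).map_pathSec i.2 hWi).unique
        (polynomialBasis hW.basis) ((isValue j f).map_pathSec j.2 hWj)))
  exact ⟨H, fun W hW f ↦ ⟨_, isValue ⟨W, hW⟩ f, hH ⟨W, hW⟩ f⟩⟩

lemma exists_homotopy (hA : A.IsEtaleOfDegree n)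
    (hgen : ∀ W, A.IsTrivializing n W →
      Algebra.adjoin Γ(X.left, W)[X] (Set.range (pathSec x y W)) = ⊤) :
    ∃ H : timesA1 X ⟶ B k n r, ∀ c : Γ(X.left, ⊤),
      Computes (sectionA1 X c ≫ H) A fun j ↦ x j + c • (y j - x j) := by
  obtain ⟨H, hH⟩ := exists_over_hom_of_pathSec hA hgen
  refine ⟨H, fun c W hW f ↦ ?_⟩
  obtain ⟨P, hP, pullInv_eq⟩ := hH W hW f
  convert! hP.eval_pathSec c using 1
  rw [← sectionA1_appLE_polyA1, ← pullInv_eq, sectionA1_appLE_map]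
  exact congrArg _ (pullInv_comp (sectionA1 X c).left H.left f)

lemma exists_elementaryHomotopic (hA : A.IsEtaleOfDegree n)
    (hgen : ∀ W, A.IsTrivializing n W →
      Algebra.adjoin Γ(X.left, W)[X] (Set.range (pathSec x y W)) = ⊤) :
    ∃ f g : X ⟶ B k n r, Computes f A x ∧ Computes g A y ∧ ElementaryHomotopic f g := by
  obtain ⟨H, hH⟩ := exists_homotopy hA hgen
  refine ⟨_, _, ?_, ?_, H, rfl, rfl⟩
  · simpa using hH 0
  · simpa using hH 1

end Path

/-! ### The chain of homotopies -/

section Generation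

open Polynomial

attribute [local instance] Polynomial.algebra

/-- The tuple of length `r + r'` obtained by putting `r` zeros at the beginning. -/
def shiftTuple {A : Type*} [Zero A] (r : ℕ) {r' : ℕ} (a : Fin r' → A) : Fin (r + r') → A :=
  fun j ↦ if h : r ≤ j.1 then a ⟨j.1 - r, by omega⟩ else 0

lemma map_shiftTuple {A A' F : Type*} [Zero A] [Zero A'] [FunLike F A A'] [ZeroHomClass F A A']
    (r : ℕ) {r' : ℕ} (a : Fin r' → A) (f : F) (j : Fin (r + r')) :
    f (shiftTuple r a j) = shiftTuple r (fun j ↦ f (a j)) j := by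
  unfold shiftTuple
  split_ifs <;> simp

variable {R A : Type*} [CommRing R] [CommRing A] [Algebra R A] {r r' : ℕ}

lemma adjoin_pathTuple_pad_pad_add_shift {a : Fin r → A} {a' : Fin r' → A}
    (ha : Algebra.adjoin R (Set.range a) = ⊤) :
    Algebra.adjoin R[X] (Set.range (pathTuple (padTuple (r + r') a)
      (padTuple (r + r') a + shiftTuple r a'))) = ⊤ := by
  refine polynomial_subalgebra_eq_top ha fun j ↦ Algebra.subset_adjoin ⟨Fin.castAdd r' j, ?_⟩
  simp [pathTuple, padTuple, shiftTuple, not_le.2 j.2]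

-- The coordinate `r + j` of the path is `a' j + t * a' (r + j)`, or `a' j` if `r + j ≥ r'`, so the
-- entries of `a'` are recovered from the last one to the first one.
lemma adjoin_pathTuple_pad_add_shift (hr : 1 ≤ r) {a : Fin r → A} {a' : Fin r' → A}
    (ha' : Algebra.adjoin R (Set.range a') = ⊤) :
    Algebra.adjoin R[X] (Set.range (pathTuple (padTuple (r + r') a + shiftTuple r a')
      (padTuple (r + r') a' + shiftTuple r a'))) = ⊤ := by
  set p := pathTuple (padTuple (r + r') a + shiftTuple r a')
    (padTuple (r + r') a' + shiftTuple r a') with hp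
  refine polynomial_subalgebra_eq_top ha' fun j ↦ ?_
  induction hm : r' - j.1 using Nat.strong_induction_on generalizing j with
  | _ m ih =>
    have coord_mem : p (Fin.natAdd r j) ∈ Algebra.adjoin R[X] (Set.range p) :=
      Algebra.subset_adjoin ⟨_, rfl⟩
    have pad_mem : C (padTuple (r + r') a' (Fin.natAdd r j)) ∈
        Algebra.adjoin R[X] (Set.range p) := by
      unfold padTuple
      split_ifs with h
      · exact ih _ (by simp only [Fin.val_natAdd] at h ⊢; omega) ⟨_, h⟩ rfl
      · exact C_0 (R := A) ▸ zero_mem _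
    have C_eq : C (a' j) = p (Fin.natAdd r j) - X * C (padTuple (r + r') a' (Fin.natAdd r j)) := by
      have pad_eq : padTuple (r + r') a (Fin.natAdd r j) = 0 := by simp [padTuple]
      have shift_eq : shiftTuple r a' (Fin.natAdd r j) = a' j := by simp [shiftTuple]
      simp [hp, pathTuple, pad_eq, shift_eq]
    rw [C_eq]
    exact sub_mem coord_mem (mul_mem (X_mem_subalgebra _) pad_mem)

-- The coordinate `j < r'` of the path is `a' j + (1 - t) * a' (j - r)`, or `a' j` if `j < r`, so
-- the entries of `a'` are recovered from the first one to the last one.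
lemma adjoin_pathTuple_pad_add_shift_pad (hr : 1 ≤ r) {a' : Fin r' → A}
    (ha' : Algebra.adjoin R (Set.range a') = ⊤) :
    Algebra.adjoin R[X] (Set.range (pathTuple (padTuple (r + r') a' + shiftTuple r a')
      (padTuple (r + r') a'))) = ⊤ := by
  set p := pathTuple (padTuple (r + r') a' + shiftTuple r a') (padTuple (r + r') a') with hp
  refine polynomial_subalgebra_eq_top ha' fun j ↦ ?_
  induction hm : j.1 using Nat.strong_induction_on generalizing j with
  | _ m ih =>
    let j' : Fin (r + r') := Fin.castLE (Nat.le_add_left r' r) j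
    have coord_mem : p j' ∈ Algebra.adjoin R[X] (Set.range p) := Algebra.subset_adjoin ⟨_, rfl⟩
    have shift_mem : C (shiftTuple r a' j') ∈ Algebra.adjoin R[X] (Set.range p) := by
      unfold shiftTuple
      split_ifs with h
      · exact ih (j'.1 - r) (by simp only [j', Fin.val_castLE] at h ⊢; omega) _ rfl
      · exact C_0 (R := A) ▸ zero_mem _
    have C_eq : C (a' j) = p j' - (1 - X) * C (shiftTuple r a' j') := by
      have pad_eq : padTuple (r + r') a' j' = a' j := by simp [padTuple, j']
      simp only [hp, pathTuple, Pi.add_apply, pad_eq, C_add, C_sub]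
      ring
    rw [C_eq]
    exact sub_mem coord_mem (mul_mem (sub_mem (one_mem _) (X_mem_subalgebra _)) shift_mem)

end Generation

section Chain

variable {k : Type u} [CommRing k] {n r r' : ℕ} {X : Over (Spec (.of k))} {A : AlgSheaf X.left}

lemma res_padTuple (W : X.left.Opens) (R : ℕ) (a : Fin r → A.sec ⊤) :
    (fun j ↦ A.res (le_top : W ≤ ⊤) (padTuple R a j)) = padTuple R fun j ↦ A.res le_top (a j) :=
  funext (map_padTuple R a (A.res (le_top : W ≤ ⊤)).hom)

lemma res_add_shiftTuple (W : X.left.Opens) (x : Fin (r + r') → A.sec ⊤)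
    (a : Fin r' → A.sec ⊤) :
    (fun j ↦ A.res (le_top : W ≤ ⊤) ((x + shiftTuple r a) j)) =
      (fun j ↦ A.res le_top (x j)) + shiftTuple r fun j ↦ A.res le_top (a j) :=
  funext fun j ↦ (map_add _ _ _).trans <|
    congrArg (_ + ·) (map_shiftTuple r a (A.res (le_top : W ≤ ⊤)).hom j)

-- The intermediate tuples are `(a, 0) + (0, a')` and `(a', 0) + (0, a')`.
lemma naivelyHomotopic_of_computes (hr : 1 ≤ r) (hA : A.IsEtaleOfDegree n)
    {a : Fin r → A.sec ⊤} {a' : Fin r' → A.sec ⊤} (ha : A.Generates a) (ha' : A.Generates a')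
    {f g : X ⟶ B k n (r + r')} (hf : Computes f A (padTuple (r + r') a))
    (hg : Computes g A (padTuple (r + r') a')) : NaivelyHomotopic f g := by
  obtain ⟨f₁, g₁, hf₁, hg₁, homotopic₁⟩ := exists_elementaryHomotopic (X := X) hA
    (x := padTuple (r + r') a) (y := padTuple (r + r') a + shiftTuple r a') fun W hW ↦ by
      rw [pathSec, res_add_shiftTuple, res_padTuple]
      exact adjoin_pathTuple_pad_pad_add_shift (ha W hW.isAffineOpen)
  obtain ⟨f₂, g₂, hf₂, hg₂, homotopic₂⟩ := exists_elementaryHomotopic (X := X) hA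
    (x := padTuple (r + r') a + shiftTuple r a')
    (y := padTuple (r + r') a' + shiftTuple r a') fun W hW ↦ by
      rw [pathSec, res_add_shiftTuple, res_add_shiftTuple, res_padTuple, res_padTuple]
      exact adjoin_pathTuple_pad_add_shift hr (ha' W hW.isAffineOpen)
  obtain ⟨f₃, g₃, hf₃, hg₃, homotopic₃⟩ := exists_elementaryHomotopic (X := X) hA
    (x := padTuple (r + r') a' + shiftTuple r a') (y := padTuple (r + r') a') fun W hW ↦ by
      rw [pathSec, res_add_shiftTuple, res_padTuple]
      exact adjoin_pathTuple_pad_add_shift_pad hr (ha' W hW.isAffineOpen)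
  obtain rfl := hf.eq hA hf₁
  obtain rfl := hg₁.eq hA hf₂
  obtain rfl := hg₂.eq hA hf₃
  obtain rfl := hg.eq hA hg₃
  exact .head homotopic₁ (.head homotopic₂ (.single homotopic₃))

end Chain

lemma IsA1Invariant.map_eq {k : Type u} [CommRing k] {P : ObjectProperty (Over (Spec (.of k)))}
    {hP : ∀ X, P X → P (timesA1 X)} {C : Type v} [Category.{w} C]
    {E : P.FullSubcategoryᵒᵖ ⥤ C} (hE : IsA1Invariant hP E) {X Y : Over (Spec (.of k))}
    (hX : P X) (hY : P Y) {f g : X ⟶ Y} (h : NaivelyHomotopic f g) :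
    E.map (P.homMk (X := ⟨X, hX⟩) (Y := ⟨Y, hY⟩) f).op =
      E.map (P.homMk (X := ⟨X, hX⟩) (Y := ⟨Y, hY⟩) g).op := by
  let proj := P.homMk (X := ⟨timesA1 X, hP X hX⟩) (Y := ⟨X, hX⟩) (projA1 X)
  let sect (c : Γ(X.left, ⊤)) := P.homMk (X := ⟨X, hX⟩) (Y := ⟨timesA1 X, hP X hX⟩) (sectionA1 X c)
  have proj_sect (c : Γ(X.left, ⊤)) : E.map proj.op ≫ E.map (sect c).op = 𝟙 _ := by
    rw [← E.map_comp, ← op_comp, ← E.map_id, ← op_id]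
    congr 2
    exact ObjectProperty.hom_ext _ (sectionA1_projA1 c)
  have : IsIso (E.map proj.op) := hE X hX
  have sect_zero_eq_one : E.map (sect 0).op = E.map (sect 1).op := by
    rw [← cancel_epi (E.map proj.op), proj_sect, proj_sect]
  have map_sect_comp (c : Γ(X.left, ⊤)) (H : timesA1 X ⟶ Y) :
      E.map (P.homMk (X := ⟨X, hX⟩) (Y := ⟨Y, hY⟩) (sectionA1 X c ≫ H)).op =
        E.map (P.homMk (X := ⟨timesA1 X, hP X hX⟩) (Y := ⟨Y, hY⟩) H).op ≫ E.map (sect c).op := by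
    rw [← E.map_comp, ← op_comp]
    rfl
  induction h with
  | refl => rfl
  | tail _ homotopic ih =>
    obtain ⟨H, rfl, rfl⟩ := homotopic
    rw [ih, map_sect_comp, map_sect_comp, sect_zero_eq_one]

/-! ### The canonical algebra over affine open subsets -/

section Components

variable {k : Type u} [CommRing k] {n r : ℕ} {V V' : (BScheme k n r).Opens}

variable (V) in
/-- The `i`-th component `Γ(V, ℰ) → Γ(π⁻¹ V, 𝒪_U)` of sections of the canonical algebra. -/
def component (i : Fin n) :
    (canonicalAlg k n r).sec V →ₐ[Γ(BScheme k n r, V)] Γ(U k n r, quotU k n r ⁻¹ᵁ V) where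
  toRingHom := (Pi.evalRingHom _ i).comp (equivSec k n r V).subtype
  commutes' _ := rfl

lemma component_canonicalSec (j : Fin r) (i : Fin n) :
    component V i ((canonicalAlg k n r).res le_top (canonicalSec k n r j)) =
      polySec _ (MvPolynomial.X (j, i)) := rfl

lemma isEquivariant_component (z : (canonicalAlg k n r).sec V) :
    IsEquivariant (Equiv.Perm (Fin n)) fun i ↦ component V i z :=
  fun σ i ↦ (show equivSec k n r V from z).2 σ i

lemma component_injective :
    Function.Injective fun (z : (canonicalAlg k n r).sec V) i ↦ component V i z :=
  fun _ _ h ↦ Subtype.ext h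

lemma sepFamily_component (hV : IsAffineOpen V) : SepFamily (component (r := r) V) := by
  intro i i' hi
  rw [eq_top_iff, ← span_polySec_eq_top (isAffineOpen_quotU_preimage hV) hi]
  refine Ideal.span_mono ?_
  rintro _ ⟨j, rfl⟩
  exact ⟨(canonicalAlg k n r).res le_top (canonicalSec k n r j), rfl⟩

lemma adjoin_canonicalSec (hV : IsAffineOpen V) :
    Algebra.adjoin Γ(BScheme k n r, V) (Set.range fun j ↦
      (canonicalAlg k n r).res (le_top : V ≤ ⊤) (canonicalSec k n r j)) = ⊤ := by
  refine Algebra.eq_top_iff.2 fun z ↦ ?_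
  let comp : (canonicalAlg k n r).sec V →ₐ[Γ(BScheme k n r, V)]
    Fin n → Γ(U k n r, quotU k n r ⁻¹ᵁ V) := AlgHom.pi (component V)
  have comp_mem := mem_adjoin_of_isEquivariant (sepFamily_toAlgHom_quotU hV)
    (isEquivariant_polySec V)
    (fun _ _ h ↦ span_polySec_eq_top (isAffineOpen_quotU_preimage hV) h)
    (isEquivariant_component z)
  have range_eq : (Set.range fun (j : Fin r) i ↦ polySec (quotU k n r ⁻¹ᵁ V)
      (MvPolynomial.X (j, i))) = comp '' Set.range fun j ↦
        (canonicalAlg k n r).res (le_top : V ≤ ⊤) (canonicalSec k n r j) :=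
    Set.range_comp comp fun j ↦ (canonicalAlg k n r).res le_top (canonicalSec k n r j)
  rw [range_eq, ← AlgHom.map_adjoin] at comp_mem
  obtain ⟨z', hz', comp_eq⟩ := comp_mem
  exact component_injective comp_eq ▸ hz'

end Components

/-! ### Classifying morphisms compute multisymmetric functions -/

section ClassifiesComputes

open TensorProduct

lemma IsValue.of_sepFamily_of_faithfulSMul {k : Type*} [CommRing k] {n r : ℕ} {R A L : Type u}
    [CommRing R] [CommRing A] [Algebra R A] [Algebra.Etale R A] [CommRing L] [Algebra R L]
    [FaithfulSMul R L] (e : Module.Basis (Fin n) R A) {s : Fin n → A →ₐ[R] L} (hs : SepFamily s)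
    {κ : k →+* R} {a : Fin r → A} {f : Inv k n r} {x : R}
    (hx : algebraMap R L x = evalPt ((algebraMap R L).comp κ) (fun j i ↦ s i (a j)) f) :
    IsValue κ a f x := by
  obtain ⟨y, hy⟩ := exists_isValue e κ a f
  exact FaithfulSMul.algebraMap_injective R L ((hy L s hs).trans hx.symm) ▸ hy

lemma exists_sepFamily_of_isPushout {ι : Type*} {S R E C T : Type u} [CommRing S] [CommRing R]
    [CommRing E] [CommRing C] [CommRing T] [Algebra S R] [Algebra S E] [Algebra R C] [Algebra S T]
    {t : E →+* C} (ht : IsPushout (CommRingCat.ofHom (algebraMap S R))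
      (CommRingCat.ofHom (algebraMap S E)) (CommRingCat.ofHom (algebraMap R C))
      (CommRingCat.ofHom t)) {ev : ι → E →ₐ[S] T} (hev : SepFamily ev) :
    ∃ s : ι → C →ₐ[R] R ⊗[S] T, SepFamily s ∧ ∀ i z, s i (t z) = 1 ⊗ₜ ev i z := by
  let incr : T →ₐ[S] R ⊗[S] T := Algebra.TensorProduct.includeRight
  have square_comm (i : ι) : CommRingCat.ofHom (algebraMap S R) ≫
      CommRingCat.ofHom (algebraMap R (R ⊗[S] T)) = CommRingCat.ofHom (algebraMap S E) ≫
        CommRingCat.ofHom (incr.comp (ev i)).toRingHom :=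
    CommRingCat.hom_ext (RingHom.ext fun c ↦ ((incr.comp (ev i)).commutes c).symm)
  let s (i : ι) : C →ₐ[R] R ⊗[S] T :=
    { (ht.desc _ _ (square_comm i)).hom with
      commutes' := fun c ↦ ConcreteCategory.congr_hom (ht.inl_desc _ _ (square_comm i)) c }
  have s_apply (i : ι) (z : E) : s i (t z) = incr (ev i z) :=
    ConcreteCategory.congr_hom (ht.inr_desc _ _ (square_comm i)) z
  refine ⟨s, fun i i' hi ↦ ?_, s_apply⟩
  rw [eq_top_iff, ← Ideal.map_top incr, ← hev i i' hi, Ideal.map_span]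
  refine Ideal.span_mono ?_
  rintro _ ⟨_, ⟨z, rfl⟩, rfl⟩
  exact ⟨t z, by simp [s_apply]⟩

variable {k : Type u} [CommRing k] {n r : ℕ} {X : Over (Spec (.of k))} {A : AlgSheaf X.left}

lemma isValue_of_isPushout (hA : A.IsEtaleOfDegree n) (φ : X ⟶ B k n r) {a : Fin r → A.sec ⊤}
    {V : (BScheme k n r).Opens} (hV : IsAffineOpen V) {W : X.left.Opens}
    (hW : A.IsTrivializing n W) (h : W ≤ φ.left ⁻¹ᵁ V) {t : (canonicalAlg k n r).sec V ⟶ A.sec W}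
    (hpo : IsPushout (Scheme.Hom.appLE (Y := BScheme k n r) φ.left V W h)
      ((canonicalAlg k n r).str V) (A.str W) t)
    (ht : ∀ j, t ((canonicalAlg k n r).res le_top (canonicalSec k n r j)) = A.res le_top (a j))
    (f : Inv k n r) :
    IsValue (baseSec X W) (fun j ↦ A.res (le_top : W ≤ ⊤) (a j)) f
      (X.left.presheaf.map (homOfLE le_top).op (pullInv φ.left f)) := by
  have := hA.etale W hW.isAffineOpen
  let R := Γ(X.left, W)
  let S := Γ(BScheme k n r, V)
  let T := Γ(U k n r, quotU k n r ⁻¹ᵁ V)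
  let φ_VW : S ⟶ R := Scheme.Hom.appLE (Y := BScheme k n r) φ.left V W h
  let _ : Algebra S R := φ_VW.hom.toAlgebra
  have : FaithfulSMul R (R ⊗[S] T) := (faithfulSMul_iff_algebraMap_injective _ _).2 <|
    includeLeft_injective_of_isInvariant (sepFamily_toAlgHom_quotU hV)
  obtain ⟨s, hs, s_apply⟩ := exists_sepFamily_of_isPushout (S := S) (R := R) (T := T)
    (t := t.hom) hpo (sepFamily_component hV)
  have algebraMap_eq (f : Inv k n r) : algebraMap R (R ⊗[S] T)
      (X.left.presheaf.map (homOfLE le_top).op (pullInv φ.left f)) = 1 ⊗ₜ polySec _ f.1 := by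
    rw [← quotU_app_invPolySec, ← appLE_invPolySec φ.left V W h]
    exact ((Algebra.TensorProduct.includeRight : T →ₐ[S] R ⊗[S] T).commutes _).symm
  refine .of_sepFamily_of_faithfulSMul hW.basis hs ((algebraMap_eq f).trans ?_)
  have evalPt_eq : evalPt ((algebraMap R (R ⊗[S] T)).comp (baseSec X W))
      (fun j i ↦ s i (A.res le_top (a j))) =
        (Algebra.TensorProduct.includeRight : T →ₐ[S] R ⊗[S] T).toRingHom.comp (polySec _) := by
    refine coord_ringHom_ext (fun c ↦ ?_) fun j i ↦ ?_
    · rw [evalPt_C]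
      refine Eq.trans ?_ (algebraMap_eq (algebraMap k (Inv k n r) c))
      rw [pullInv_algebraMap, baseSec_map]
      rfl
    · rw [evalPt_X, ← ht]
      exact s_apply i _
  rw [evalPt_eq]
  rfl

lemma Classifies.computes (hA : A.IsEtaleOfDegree n) {φ : X ⟶ B k n r}
    {a : Fin r → A.sec ⊤} (h : Classifies φ A a) : Computes φ A a := by
  obtain ⟨θ, hθ, hθa⟩ := h
  intro W₀ hW₀ f
  refine hA.isValue_of_local hW₀ fun y hy ↦ ?_
  obtain ⟨V, hV, hyV, -⟩ :=
    exists_isAffineOpen_mem_and_subset (X := BScheme k n r) (Opens.mem_top (φ.left y))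
  obtain ⟨W, hW, hyW, hWO⟩ := hA.exists_isTrivializing (x := y) (O := W₀ ⊓ φ.left ⁻¹ᵁ V) ⟨hy, hyV⟩
  have hWV : W ≤ φ.left ⁻¹ᵁ V := hWO.trans inf_le_right
  refine ⟨W, hWO.trans inf_le_left, hyW, hW, ?_⟩
  rw [map_map_apply]
  simp only [res_res]
  refine isValue_of_isPushout hA φ hV hW hWV (hθ V W hWV hV hW.isAffineOpen) (fun j ↦ ?_) f
  have app_res := ConcreteCategory.congr_hom (θ.naturality (le_top : V ≤ ⊤)) (canonicalSec k n r j)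
  rw [CommRingCat.comp_apply, CommRingCat.comp_apply, hθa] at app_res
  rw [CommRingCat.comp_apply, app_res]
  exact A.res_res _ _ (a j)

end ClassifiesComputes

/-! ### Points of the torsor defined by splittings -/

section SplittingPoints

lemma specMap_fromSpec_appLE {X : Scheme.{u}} {W : X.Opens} (hW : IsAffineOpen W)
    {L : CommRingCat.{u}} (m : Γ(X, W) ⟶ L) {O : X.Opens} (h : W ≤ O)
    (e : ⊤ ≤ (Spec.map m ≫ hW.fromSpec) ⁻¹ᵁ O) (z : Γ(X, O)) :
    (Spec.map m ≫ hW.fromSpec).appLE O ⊤ e z =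
      (Scheme.ΓSpecIso L).inv (m (X.presheaf.map (homOfLE h).op z)) := by
  rw [Scheme.Hom.comp_appLE, hW.fromSpec_app_of_le O h]
  refine (specMap_appLE_algebraMap m (hW.fromSpec ⁻¹ᵁ O) ⊤ e
    (X.presheaf.map (homOfLE h).op z)).trans ?_
  exact ConcreteCategory.congr_hom ((Spec L).presheaf.map_id (op ⊤)) ((Scheme.ΓSpecIso L).inv _)

lemma top_le_specMap_fromSpec_preimage {X : Scheme.{u}} {W : X.Opens} (hW : IsAffineOpen W)
    {L : CommRingCat.{u}} (m : Γ(X, W) ⟶ L) : ⊤ ≤ (Spec.map m ≫ hW.fromSpec) ⁻¹ᵁ W := by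
  intro q _
  change hW.fromSpec (Spec.map m q) ∈ (W : Set X)
  exact hW.range_fromSpec ▸ Set.mem_range_self _

lemma appLE_app_of_comp_eq {Z Y Y' T : Scheme.{u}} {ψ : Z ⟶ Y} {π : Y ⟶ T} {χ : Z ⟶ Y'}
    {φ : Y' ⟶ T} (h : ψ ≫ π = χ ≫ φ) {V : T.Opens} {W : Y'.Opens} {O : Z.Opens}
    (hφ : W ≤ φ ⁻¹ᵁ V) (hχ : O ≤ χ ⁻¹ᵁ W) (hψ : O ≤ ψ ⁻¹ᵁ (π ⁻¹ᵁ V)) (c : Γ(T, V)) :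
    ψ.appLE (π ⁻¹ᵁ V) O hψ (π.app V c) = χ.appLE W O hχ (φ.appLE V W hφ c) := by
  have appLE_congr : ∀ {f : Z ⟶ T} (_ : ψ ≫ π = f) (e : O ≤ f ⁻¹ᵁ V),
      (ψ ≫ π).appLE V O hψ = f.appLE V O e := by
    rintro _ rfl _
    rfl
  refine (ConcreteCategory.congr_hom (Scheme.Hom.comp_appLE ψ π V O hψ) c).symm.trans ?_
  rw [appLE_congr h (hχ.trans (χ.preimage_mono hφ)), ← CommRingCat.comp_apply,
    Scheme.Hom.appLE_comp_appLE]

variable {k : Type u} [CommRing k] {n r : ℕ}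

section TupleHom

variable {L : Type u} [CommRing L] {κ : k →+* L} {α : Fin r → Fin n → L}
  (hα : ∀ i i', i ≠ i' → Ideal.span (Set.range fun j ↦ α j i - α j i') = ⊤)

/-- The `L`-valued point of `U(r; 𝔸ⁿ)` with coordinates `α`, where `hα` expresses that no two
coordinates of the tuple agree at any point of `Spec L`. -/
def tupleHom : Spec (.of L) ⟶ U k n r :=
  IsOpenImmersion.lift (UOpens k n r).ι (Spec.map (CommRingCat.ofHom (evalPt κ α))) <| by
    rw [Scheme.Opens.range_ι]
    rintro _ ⟨q, rfl⟩
    exact comap_evalPt_mem_UOpens κ hα q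

lemma tupleHom_ι : tupleHom (κ := κ) hα ≫ (UOpens k n r).ι =
    Spec.map (CommRingCat.ofHom (evalPt κ α)) :=
  IsOpenImmersion.lift_fac _ _ _

lemma tupleHom_appLE_polySec {W : (U k n r).Opens} (e : ⊤ ≤ tupleHom (κ := κ) hα ⁻¹ᵁ W)
    (p : Coord k n r) :
    (tupleHom hα).appLE W ⊤ e (polySec W p) = (Scheme.ΓSpecIso (.of L)).inv (evalPt κ α p) := by
  change (tupleHom hα).appLE W ⊤ e ((U k n r).presheaf.map (homOfLE le_top).op
    (globalHom (R := .of (Coord k n r)) (UOpens k n r).ι p)) = _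
  have globalHom_eq := globalHom_comp (R := .of (Coord k n r)) (tupleHom (κ := κ) hα)
    (UOpens k n r).ι
  rw [tupleHom_ι, globalHom, ← Scheme.ΓSpecIso_inv_naturality] at globalHom_eq
  rw [map_appLE_apply]
  refine (ConcreteCategory.congr_hom (Scheme.Hom.appLE_eq_app (U := ⊤) _) _).trans ?_
  exact (ConcreteCategory.congr_hom globalHom_eq p).symm

lemma pullInv_tupleHom_quotU (f : Inv k n r) : pullInv (tupleHom (κ := κ) hα ≫ quotU k n r) f =
    (Scheme.ΓSpecIso (.of L)).inv (evalPt κ α f) := by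
  have pullInv_quotU : pullInv (quotU k n r) f = polySec ⊤ (f : Coord k n r) := by
    refine Eq.trans ?_ (quotU_app_invPolySec ⊤ f)
    rw [← Scheme.Hom.appLE_eq_app, appLE_invPolySec]
    exact (ConcreteCategory.congr_hom ((U k n r).presheaf.map_id (op ⊤)) _).symm
  rw [pullInv_comp, pullInv_quotU, ← tupleHom_appLE_polySec hα (W := ⊤) le_top]
  exact (ConcreteCategory.congr_hom (Scheme.Hom.appLE_eq_app (U := ⊤) _) _).symm

end TupleHom

/-- Over a splitting `s` of `A`, the ring homomorphism `g : Γ(π⁻¹ V, 𝒪_U) → L` is an `L`-valued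
point of `U(r; 𝔸ⁿ)` that lies over `φ` and has the coordinates `s i (a j)`. -/
structure IsCoordPoint {X : Scheme.{u}} (φ : X ⟶ BScheme k n r) {A : AlgSheaf X}
    (a : Fin r → A.sec ⊤) {V : (BScheme k n r).Opens} {W : X.Opens} (h : W ≤ φ ⁻¹ᵁ V)
    {L : Type u} [CommRing L] [Algebra Γ(X, W) L] (s : Fin n → A.sec W →ₐ[Γ(X, W)] L)
    (g : Γ(U k n r, quotU k n r ⁻¹ᵁ V) →+* L) : Prop where
  app (c : Γ(BScheme k n r, V)) :
    g ((quotU k n r).app V c) = algebraMap Γ(X, W) L (φ.appLE V W h c)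
  coord (j : Fin r) (i : Fin n) :
    g (polySec _ (MvPolynomial.X (j, i))) = s i (A.res le_top (a j))

variable {X : Over (Spec (.of k))} {A : AlgSheaf X.left} {φ : X ⟶ B k n r} {a : Fin r → A.sec ⊤}
  {W : X.left.Opens} {L : Type u} [CommRing L] [Algebra Γ(X.left, W) L]
  {s : Fin n → A.sec W →ₐ[Γ(X.left, W)] L}

lemma Computes.tupleHom_quotU (hφ : Computes φ A a) (hW : A.IsTrivializing n W)
    (hs : SepFamily s)
    (hα : ∀ i i', i ≠ i' → Ideal.span (Set.range fun j ↦
      s i (A.res le_top (a j)) - s i' (A.res le_top (a j))) = ⊤) :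
    tupleHom (κ := (algebraMap Γ(X.left, W) L).comp (baseSec X W)) hα ≫ quotU k n r =
      (Spec.map (CommRingCat.ofHom (algebraMap Γ(X.left, W) L)) ≫ hW.isAffineOpen.fromSpec) ≫
        φ.left := by
  refine pullInv_injective (RingHom.ext fun f ↦ ?_)
  refine (pullInv_tupleHom_quotU hα f).trans ?_
  rw [← hφ W hW f L s hs]
  refine (specMap_fromSpec_appLE hW.isAffineOpen (CommRingCat.ofHom (algebraMap _ L)) le_top le_top
    (pullInv φ.left f)).symm.trans ?_
  exact (ConcreteCategory.congr_hom (Scheme.Hom.appLE_eq_app _) _).trans (pullInv_comp _ _ f).symm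

lemma Computes.exists_isCoordPoint (hφ : Computes φ A a) (ha : A.Generates a)
    {V : (BScheme k n r).Opens} (hW : A.IsTrivializing n W) (h : W ≤ φ.left ⁻¹ᵁ V)
    (hs : SepFamily s) :
    ∃ g : Γ(U k n r, quotU k n r ⁻¹ᵁ V) →+* L, IsCoordPoint φ.left a h s g := by
  have hα := (sepFamily_iff_of_adjoin (ha W hW.isAffineOpen) s).1 hs
  let m : Γ(X.left, W) ⟶ .of L := CommRingCat.ofHom (algebraMap Γ(X.left, W) L)
  let χ : Spec (.of L) ⟶ X.left := Spec.map m ≫ hW.isAffineOpen.fromSpec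
  let ψ := tupleHom (κ := (algebraMap Γ(X.left, W) L).comp (baseSec X W)) hα
  have comp_eq : ψ ≫ quotU k n r = χ ≫ φ.left := hφ.tupleHom_quotU hW hs hα
  have hχ : ⊤ ≤ χ ⁻¹ᵁ W := top_le_specMap_fromSpec_preimage hW.isAffineOpen m
  have hψ : ⊤ ≤ ψ ⁻¹ᵁ (quotU k n r ⁻¹ᵁ V) := by
    rw [← Scheme.Hom.comp_preimage, comp_eq]
    exact hχ.trans (χ.preimage_mono h)
  have hom_eq_of_eq_inv {x : Γ(Spec (.of L), ⊤)} {y : L}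
      (hxy : x = (Scheme.ΓSpecIso (.of L)).inv y) : (Scheme.ΓSpecIso (.of L)).hom x = y :=
    hxy ▸ ConcreteCategory.congr_hom (Scheme.ΓSpecIso (.of L)).inv_hom_id y
  refine ⟨(ψ.appLE (quotU k n r ⁻¹ᵁ V) ⊤ hψ ≫ (Scheme.ΓSpecIso (.of L)).hom).hom,
    fun c ↦ hom_eq_of_eq_inv ?_, fun j i ↦ hom_eq_of_eq_inv ?_⟩
  · refine (appLE_app_of_comp_eq comp_eq h hχ hψ c).trans ?_
    refine (specMap_fromSpec_appLE hW.isAffineOpen m le_rfl hχ _).trans ?_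
    refine congrArg (fun z ↦ (Scheme.ΓSpecIso (.of L)).inv (m z)) ?_
    exact ConcreteCategory.congr_hom (X.left.presheaf.map_id (op W)) _
  · exact (tupleHom_appLE_polySec hα hψ _).trans (congrArg _ (evalPt_X _ _ _))

end SplittingPoints

/-! ### The pullback of the canonical algebra along a computing morphism -/

section Match

variable {k : Type u} [CommRing k] {n r : ℕ} {X : Scheme.{u}} (φ : X ⟶ BScheme k n r)
  (A : AlgSheaf X) (a : Fin r → A.sec ⊤)

/-- A section `b` of `𝒜` over the preimage of `V` matches a section `z` of the canonical algebra
over `V` if, at every point of `U(r; 𝔸ⁿ)` defined by a splitting of `𝒜`, the values of `b` are the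
components of `z`. -/
def IsMatch (V : (BScheme k n r).Opens) (z : (canonicalAlg k n r).sec V)
    (b : A.sec (φ ⁻¹ᵁ V)) : Prop :=
  ∀ ⦃V' : (BScheme k n r).Opens⦄ (hV : V' ≤ V) ⦃W : X.Opens⦄ (h : W ≤ φ ⁻¹ᵁ V'), IsAffineOpen V' →
    ∀ ⦃L : Type u⦄ [CommRing L] [Algebra Γ(X, W) L] ⦃s : Fin n → A.sec W →ₐ[Γ(X, W)] L⦄
      ⦃g : Γ(U k n r, quotU k n r ⁻¹ᵁ V') →+* L⦄, IsCoordPoint φ a h s g →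
        ∀ i, s i (A.res (h.trans (φ.preimage_mono hV)) b) =
          g (component V' i ((canonicalAlg k n r).res hV z))

variable {φ A a} {V : (BScheme k n r).Opens} {z z' : (canonicalAlg k n r).sec V}
  {b b' : A.sec (φ ⁻¹ᵁ V)}

lemma IsMatch.add (hb : IsMatch φ A a V z b) (hb' : IsMatch φ A a V z' b') :
    IsMatch φ A a V (z + z') (b + b') :=
  fun V' hV W h hV' L _ _ s g hg i ↦ by simp only [map_add, hb hV h hV' hg, hb' hV h hV' hg]

lemma IsMatch.mul (hb : IsMatch φ A a V z b) (hb' : IsMatch φ A a V z' b') :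
    IsMatch φ A a V (z * z') (b * b') :=
  fun V' hV W h hV' L _ _ s g hg i ↦ by simp only [map_mul, hb hV h hV' hg, hb' hV h hV' hg]

lemma isMatch_algebraMap (c : Γ(BScheme k n r, V)) : IsMatch φ A a V
    (algebraMap Γ(BScheme k n r, V) ((canonicalAlg k n r).sec V) c)
    (algebraMap Γ(X, φ ⁻¹ᵁ V) (A.sec (φ ⁻¹ᵁ V)) (φ.app V c)) :=
  fun V' hV W h _ L _ _ s g hg i ↦ by
    rw [res_algebraMap, res_algebraMap, AlgHom.commutes, AlgHom.commutes, algebraMap_quotU, hg.app,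
      map_appLE_apply, ← Scheme.Hom.appLE_eq_app, appLE_map_apply]

lemma isMatch_one : IsMatch φ A a V 1 1 := by
  simpa only [map_one] using isMatch_algebraMap (φ := φ) (A := A) (a := a) (V := V) 1

lemma isMatch_zero : IsMatch φ A a V 0 0 := by
  simpa only [map_zero] using isMatch_algebraMap (φ := φ) (A := A) (a := a) (V := V) 0

lemma isMatch_canonicalSec (j : Fin r) : IsMatch φ A a V
    ((canonicalAlg k n r).res le_top (canonicalSec k n r j)) (A.res le_top (a j)) :=
  fun V' hV W h _ L _ _ s g hg i ↦ by
    rw [res_res, res_res, component_canonicalSec, hg.coord]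

lemma IsMatch.res {V' : (BScheme k n r).Opens} (hV : V' ≤ V) (hb : IsMatch φ A a V z b) :
    IsMatch φ A a V' ((canonicalAlg k n r).res hV z) (A.res (φ.preimage_mono hV) b) :=
  fun V'' hV' W h hV'' L _ _ s g hg i ↦ by
    rw [res_res, res_res]
    exact hb (hV'.trans hV) h hV'' hg i

lemma isMatch_of_forall_isAffineOpen
    (h : ∀ (V' : (BScheme k n r).Opens) (hV : V' ≤ V), IsAffineOpen V' →
      IsMatch φ A a V' ((canonicalAlg k n r).res hV z) (A.res (φ.preimage_mono hV) b)) :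
    IsMatch φ A a V z b :=
  fun V' hV W hW hV' L _ _ s g hg i ↦ by
    simpa only [res_res] using h V' hV hV' le_rfl hW hV' hg i

lemma exists_isMatch_of_isAffineOpen (hV : IsAffineOpen V) (z : (canonicalAlg k n r).sec V) :
    ∃ b, IsMatch φ A a V z b := by
  have hz : z ∈ Algebra.adjoin Γ(BScheme k n r, V) _ := adjoin_canonicalSec hV ▸ Algebra.mem_top
  induction hz using Algebra.adjoin_induction with
  | mem _ hz =>
    obtain ⟨j, rfl⟩ := hz
    exact ⟨_, isMatch_canonicalSec j⟩
  | algebraMap c => exact ⟨_, isMatch_algebraMap c⟩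
  | add _ _ _ _ ih ih' =>
    obtain ⟨_, hb⟩ := ih
    obtain ⟨_, hb'⟩ := ih'
    exact ⟨_, hb.add hb'⟩
  | mul _ _ _ _ ih ih' =>
    obtain ⟨_, hb⟩ := ih
    obtain ⟨_, hb'⟩ := ih'
    exact ⟨_, hb.mul hb'⟩

end Match

section ComputesClassifies

open TensorProduct

lemma AlgSheaf.IsEtaleOfDegree.exists_sepFamily_of_ne_zero {X : Scheme.{u}} {A : AlgSheaf X} {n : ℕ}
    (hA : A.IsEtaleOfDegree n) {W : X.Opens} {c : Γ(X, W)} (hc : c ≠ 0) :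
    ∃ (W' : X.Opens) (h : W' ≤ W) (_ : A.IsTrivializing n W') (L : Type u) (_ : CommRing L)
      (_ : Algebra Γ(X, W') L) (s : Fin n → A.sec W' →ₐ[Γ(X, W')] L),
      SepFamily s ∧ algebraMap Γ(X, W') L (X.presheaf.map (homOfLE h).op c) ≠ 0 := by
  by_contra! all_zero
  refine hc (section_ext fun x hx ↦ ?_)
  obtain ⟨W', hW', hxW', h⟩ := hA.exists_isTrivializing hx
  have := hA.etale W' hW'.isAffineOpen
  obtain ⟨L, _, _, _, s, hs⟩ := exists_sepFamily hW'.basis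
  refine ⟨W', h, hxW', FaithfulSMul.algebraMap_injective Γ(X, W') L ?_⟩
  rw [all_zero W' h hW' L _ _ s hs, map_zero, map_zero]

variable {k : Type u} [CommRing k] {n r : ℕ} {X : Over (Spec (.of k))} {A : AlgSheaf X.left}
  {φ : X ⟶ B k n r} {a : Fin r → A.sec ⊤}

lemma IsMatch.eq (hA : A.IsEtaleOfDegree n) (ha : A.Generates a) (hφ : Computes φ A a)
    {V : (BScheme k n r).Opens} {z : (canonicalAlg k n r).sec V} {b b' : A.sec (φ.left ⁻¹ᵁ V)}
    (hb : IsMatch φ.left A a V z b) (hb' : IsMatch φ.left A a V z b') : b = b' := by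
  refine A.sec_ext fun x hx ↦ ?_
  obtain ⟨V', hV', hxV', hV⟩ :=
    exists_isAffineOpen_mem_and_subset (X := BScheme k n r) (x := φ.left x) hx
  obtain ⟨W, hW, hxW, h⟩ := hA.exists_isTrivializing (x := x) (O := φ.left ⁻¹ᵁ V') hxV'
  have := hA.etale W hW.isAffineOpen
  refine ⟨W, h.trans (Scheme.Hom.preimage_mono _ hV), hxW, ?_⟩
  obtain ⟨L, _, _, _, s, hs⟩ := exists_sepFamily hW.basis
  obtain ⟨g, hg⟩ := hφ.exists_isCoordPoint ha hW h hs
  have : Module.Free Γ(X.left, W) (A.sec W) := Module.Free.of_basis hW.basis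
  have includeRight_injective : Function.Injective
      (Algebra.TensorProduct.includeRight : A.sec W →ₐ[Γ(X.left, W)] L ⊗[Γ(X.left, W)] A.sec W) :=
    Algebra.TensorProduct.includeRight_injective (FaithfulSMul.algebraMap_injective _ L)
  refine includeRight_injective ((hs.familyHom_bijective hW.basis).1 (funext fun i ↦ ?_))
  rw [Algebra.TensorProduct.includeRight_apply, Algebra.TensorProduct.includeRight_apply,
    familyHom_tmul, familyHom_tmul]
  exact congrArg (1 * ·) ((hb hV h hV' hg i).trans (hb' hV h hV' hg i).symm)

lemma exists_isMatch (hA : A.IsEtaleOfDegree n) (ha : A.Generates a) (hφ : Computes φ A a)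
    (V : (BScheme k n r).Opens) (z : (canonicalAlg k n r).sec V) :
    ∃ b, IsMatch φ.left A a V z b := by
  let φ₀ : X.left ⟶ BScheme k n r := φ.left
  let I := {V' : (BScheme k n r).Opens // V' ≤ V ∧ IsAffineOpen V'}
  choose c hc using fun i : I ↦ exists_isMatch_of_isAffineOpen (φ := φ₀) (A := A) (a := a) i.2.2
    ((canonicalAlg k n r).res i.2.1 z)
  have cover : φ₀ ⁻¹ᵁ V ≤ ⨆ i : I, φ₀ ⁻¹ᵁ i.1 := fun x hx ↦ by
    obtain ⟨V', hV', hxV', hV⟩ := exists_isAffineOpen_mem_and_subset (x := φ₀ x) hx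
    exact Opens.mem_iSup.2 ⟨⟨V', hV, hV'⟩, hxV'⟩
  have compatible (i j : I) : A.res (φ₀.preimage_mono inf_le_left) (c i) =
      A.res (φ₀.preimage_mono (inf_le_right : i.1 ⊓ j.1 ≤ j.1)) (c j) := by
    have isMatch_left := (hc i).res (inf_le_left : i.1 ⊓ j.1 ≤ i.1)
    have isMatch_right := (hc j).res (inf_le_right : i.1 ⊓ j.1 ≤ j.1)
    rw [res_res] at isMatch_left isMatch_right
    exact isMatch_left.eq hA ha hφ isMatch_right
  obtain ⟨b, hb, -⟩ := A.sheaf.existsUnique_gluing' (fun i : I ↦ φ₀ ⁻¹ᵁ i.1) (φ₀ ⁻¹ᵁ V)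
    (fun i ↦ homOfLE (φ₀.preimage_mono i.2.1)) cover c compatible
  refine ⟨b, isMatch_of_forall_isAffineOpen fun V' hV hV' ↦ ?_⟩
  have res_eq : A.res (φ₀.preimage_mono hV) b = c ⟨V', hV, hV'⟩ := hb ⟨V', hV, hV'⟩
  exact res_eq ▸ hc ⟨V', hV, hV'⟩

/-- The section of `𝒜` matching a given section of the canonical algebra. -/
def matchSec (hA : A.IsEtaleOfDegree n) (ha : A.Generates a) (hφ : Computes φ A a)
    {V : (BScheme k n r).Opens} (z : (canonicalAlg k n r).sec V) : A.sec (φ.left ⁻¹ᵁ V) :=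
  (exists_isMatch hA ha hφ V z).choose

lemma isMatch_matchSec (hA : A.IsEtaleOfDegree n) (ha : A.Generates a) (hφ : Computes φ A a)
    {V : (BScheme k n r).Opens} (z : (canonicalAlg k n r).sec V) :
    IsMatch φ.left A a V z (matchSec hA ha hφ z) :=
  (exists_isMatch hA ha hφ V z).choose_spec

lemma IsMatch.matchSec_eq (hA : A.IsEtaleOfDegree n) (ha : A.Generates a) (hφ : Computes φ A a)
    {V : (BScheme k n r).Opens} {z : (canonicalAlg k n r).sec V} {b : A.sec (φ.left ⁻¹ᵁ V)}
    (hb : IsMatch φ.left A a V z b) : matchSec hA ha hφ z = b :=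
  (isMatch_matchSec hA ha hφ z).eq hA ha hφ hb

/-- The homomorphism from the canonical algebra to `𝒜`, over a morphism computing a generating
tuple of `𝒜`, that sends a section to the section matching it. -/
def matchHom (hA : A.IsEtaleOfDegree n) (ha : A.Generates a) (hφ : Computes φ A a) :
    HomOver (Y := BScheme k n r) φ.left (canonicalAlg k n r) A where
  app _ := CommRingCat.ofHom
    { toFun := matchSec hA ha hφ
      map_one' := isMatch_one.matchSec_eq hA ha hφ
      map_zero' := isMatch_zero.matchSec_eq hA ha hφ
      map_add' := fun z z' ↦
        ((isMatch_matchSec hA ha hφ z).add (isMatch_matchSec hA ha hφ z')).matchSec_eq hA ha hφ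
      map_mul' := fun z z' ↦
        ((isMatch_matchSec hA ha hφ z).mul (isMatch_matchSec hA ha hφ z')).matchSec_eq hA ha hφ }
  naturality h := CommRingCat.hom_ext <| RingHom.ext fun z ↦
    ((isMatch_matchSec hA ha hφ z).res h).matchSec_eq hA ha hφ
  linear _ := CommRingCat.hom_ext <| RingHom.ext fun c ↦
    (isMatch_algebraMap c).matchSec_eq hA ha hφ

lemma matchHom_app_canonicalSec (hA : A.IsEtaleOfDegree n) (ha : A.Generates a)
    (hφ : Computes φ A a) (V : (BScheme k n r).Opens) (j : Fin r) :
    (matchHom hA ha hφ).app V ((canonicalAlg k n r).res le_top (canonicalSec k n r j)) =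
      A.res le_top (a j) :=
  (isMatch_canonicalSec j).matchSec_eq hA ha hφ

lemma isPushout_of_adjoin_range {S R E C : Type u} [CommRing S] [CommRing R] [CommRing E]
    [CommRing C] [Algebra S R] [Algebra S E] [Algebra R C] {t : E →+* C}
    (ht : ∀ c, t (algebraMap S E c) = algebraMap R C (algebraMap S R c))
    (adjoin_range : Algebra.adjoin R (Set.range t) = ⊤)
    (hinj : ∀ Φ : R ⊗[S] E →ₐ[R] C, (∀ z, Φ (1 ⊗ₜ z) = t z) → Function.Injective Φ) :
    IsPushout (CommRingCat.ofHom (algebraMap S R)) (CommRingCat.ofHom (algebraMap S E))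
      (CommRingCat.ofHom (algebraMap R C)) (CommRingCat.ofHom t) := by
  let _ : Algebra S C := ((algebraMap R C).comp (algebraMap S R)).toAlgebra
  have : IsScalarTower S R C := .of_algebraMap_eq' rfl
  let Φ : R ⊗[S] E →ₐ[R] C := Algebra.TensorProduct.lift (Algebra.ofId R C)
    { t with commutes' := ht } fun _ _ ↦ Commute.all _ _
  have Φ_tmul (z : E) : Φ (1 ⊗ₜ z) = t z := by simp [Φ]
  have bijective : Function.Bijective Φ := by
    refine ⟨hinj Φ Φ_tmul, ?_⟩
    rw [← AlgHom.range_eq_top, eq_top_iff, ← adjoin_range, Algebra.adjoin_le_iff]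
    rintro _ ⟨z, rfl⟩
    exact ⟨1 ⊗ₜ z, Φ_tmul z⟩
  exact (CommRingCat.isPushout_tensorProduct S R E).of_iso (Iso.refl _) (Iso.refl _) (Iso.refl _)
    (RingEquiv.ofBijective Φ bijective).toCommRingCatIso (by simp) (by simp)
    (CommRingCat.hom_ext (RingHom.ext Φ.commutes)) (CommRingCat.hom_ext (RingHom.ext Φ_tmul))

lemma isPullback_matchHom (hA : A.IsEtaleOfDegree n) (ha : A.Generates a)
    (hφ : Computes φ A a) : (matchHom hA ha hφ).IsPullback := by
  intro V W h hV hW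
  let R := Γ(X.left, W)
  let S := Γ(BScheme k n r, V)
  let φ_VW : S ⟶ R := Scheme.Hom.appLE (Y := BScheme k n r) φ.left V W h
  let _ : Algebra S R := φ_VW.hom.toAlgebra
  refine isPushout_of_adjoin_range (S := S) (R := R) (E := (canonicalAlg k n r).sec V)
    (C := A.sec W) (t := ((matchHom hA ha hφ).app V ≫ A.res h).hom) (fun c ↦ ?_) ?_ fun Φ hΦ ↦ ?_
  · have linear := ConcreteCategory.congr_hom ((matchHom hA ha hφ).linear V) c
    exact (congrArg (A.res h) linear).trans (A.res_algebraMap h _)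
  · rw [eq_top_iff, ← ha W hW]
    refine Algebra.adjoin_mono ?_
    rintro _ ⟨j, rfl⟩
    refine ⟨(canonicalAlg k n r).res le_top (canonicalSec k n r j), ?_⟩
    exact (congrArg (A.res h) (matchHom_app_canonicalSec hA ha hφ V j)).trans (A.res_res _ _ _)
  refine injective_of_isEquivariant (sepFamily_toAlgHom_quotU hV) (sepFamily_component hV)
    isEquivariant_component component_injective fun c hc ↦ ?_
  obtain ⟨W', hle, hW', L, _, _, s, hs, map_ne_zero⟩ := hA.exists_sepFamily_of_ne_zero hc
  obtain ⟨g, hg⟩ := hφ.exists_isCoordPoint ha hW' (hle.trans h) hs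
  let ρ : R →+* L := (algebraMap Γ(X.left, W') L).comp (X.left.presheaf.map (homOfLE hle).op).hom
  let _ : Algebra R L := ρ.toAlgebra
  let s' (i : Fin n) : A.sec W →ₐ[R] L :=
    { (s i : A.sec W' →+* L).comp (A.res hle).hom with
      commutes' := fun d ↦ (congrArg (s i) (A.res_algebraMap hle d)).trans ((s i).commutes _) }
  refine ⟨L, _, _, s', g, map_ne_zero, fun d ↦ ?_, fun i z ↦ ?_⟩
  · refine (hg.app d).trans (congrArg (algebraMap Γ(X.left, W') L) ?_)
    exact (appLE_map_apply (Y := BScheme k n r) φ.left h hle d).symm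
  · have s_res := isMatch_matchSec hA ha hφ z le_rfl (hle.trans h) hV hg i
    rw [res_self] at s_res
    refine Eq.trans (congrArg (s i) ?_) s_res
    exact (congrArg (A.res hle) (hΦ z)).trans (A.res_res h hle (matchSec hA ha hφ z))

lemma Computes.classifies (hA : A.IsEtaleOfDegree n) (ha : A.Generates a)
    (hφ : Computes φ A a) : Classifies φ A a := by
  refine ⟨matchHom hA ha hφ, isPullback_matchHom hA ha hφ, fun j ↦ ?_⟩
  have app_canonicalSec := matchHom_app_canonicalSec hA ha hφ ⊤ j
  rw [res_self] at app_canonicalSec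
  exact app_canonicalSec.trans (A.res_self (a j))

end ComputesClassifies

section Main

lemma AlgSheaf.Generates.of_isIsomorphic {X : Scheme.{u}} {A A' : AlgSheaf X}
    {α : A.sheaf ≅ A'.sheaf} (hα : A.unit ≫ α.hom = A'.unit) {r : ℕ} {a' : Fin r → A'.sec ⊤}
    (ha' : A'.Generates a') : A.Generates fun j ↦ α.inv.hom.app (op ⊤) (a' j) := by
  intro W hW
  let f : A'.sec W →ₐ[Γ(X, W)] A.sec W :=
    { (α.inv.hom.app (op W)).hom with
      commutes' := hom_app_algebraMap ((Iso.comp_inv_eq α).2 hα.symm) W }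
  have f_range : f.range = ⊤ := (AlgHom.range_eq_top f).2 fun z ↦
    ⟨α.hom.hom.app (op W) z, inv_app_hom_app α W z⟩
  have map_adjoin := f.map_adjoin (Set.range fun j ↦ A'.res (le_top : W ≤ ⊤) (a' j))
  rw [ha' W hW, Algebra.map_top, f_range, ← Set.range_comp] at map_adjoin
  rw [map_adjoin]
  exact congrArg (fun b ↦ Algebra.adjoin Γ(X, W) (Set.range b))
    (funext fun j ↦ (hom_app_res α.inv le_top (a' j)).symm)

lemma existsUnique_classifies {k : Type u} [CommRing k] {n r : ℕ} {X : Over (Spec (.of k))}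
    {A : AlgSheaf X.left} (hA : A.IsEtaleOfDegree n) {a : Fin r → A.sec ⊤} (ha : A.Generates a) :
    ∃! φ : X ⟶ B k n r, Classifies φ A a := by
  obtain ⟨φ, hφ⟩ := exists_computes (X := X) hA ha
  exact ⟨φ, hφ.classifies hA ha, fun ψ hψ ↦ (hψ.computes hA).eq hA hφ⟩

end Main

end EtaleGen

end

theorem proposition4p2 (k : Type u) [CommRing k] (n r r' : ℕ) (hn : 2 ≤ n) (hr : 1 ≤ r)
    (hr' : 1 ≤ r') (X : Over (Spec (.of k))) (A A' : AlgSheaf X.left)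
    (hA : A.IsEtaleOfDegree n) (hA' : A'.IsEtaleOfDegree n)
    (a : Fin r → A.sec ⊤) (a' : Fin r' → A'.sec ⊤) (ha : A.Generates a) (ha' : A'.Generates a')
    (hAA' : A.IsIsomorphic A') :
    (∃! φ : X ⟶ B k n r, Classifies φ A a) ∧ (∃! φ' : X ⟶ B k n r', Classifies φ' A' a') ∧
    ∀ (φ : X ⟶ B k n r) (φ' : X ⟶ B k n r'), Classifies φ A a → Classifies φ' A' a' →
      NaivelyHomotopic (φ ≫ stab k n (Nat.le_add_right r r'))
        (φ' ≫ stab k n (Nat.le_add_left r' r)) ∧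
      ∀ (P : ObjectProperty (Over (Spec (.of k)))) (hP : ∀ Y, P Y → P (timesA1 Y))
        (hX : P X) (hB : P (B k n (r + r'))) (C : Type v) [Category.{w} C]
        (E : P.FullSubcategoryᵒᵖ ⥤ C), IsA1Invariant hP E →
        E.map (P.homMk (X := ⟨X, hX⟩) (Y := ⟨B k n (r + r'), hB⟩)
            (φ ≫ stab k n (Nat.le_add_right r r'))).op =
          E.map (P.homMk (X := ⟨X, hX⟩) (Y := ⟨B k n (r + r'), hB⟩)
            (φ' ≫ stab k n (Nat.le_add_left r' r))).op := by
  refine ⟨existsUnique_classifies hA ha, existsUnique_classifies hA' ha',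
    fun φ φ' hφ hφ' ↦ ?_⟩
  obtain ⟨α, hα⟩ := hAA'
  have homotopic : NaivelyHomotopic (φ ≫ stab k n (Nat.le_add_right r r'))
      (φ' ≫ stab k n (Nat.le_add_left r' r)) :=
    naivelyHomotopic_of_computes hr hA ha (ha'.of_isIsomorphic hα)
      ((hφ.computes hA).comp_stab _)
      (((hφ'.computes hA').of_isIsomorphic hA hA' hα).comp_stab _)
  exact ⟨homotopic, fun P hP hX hB C _ E hE ↦ hE.map_eq hX hB homotopic⟩
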